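/- Let $\mathbb F$ be $\mathbb R$, $\mathbb C$ or the quaternions $\mathbb H$, and $d=\dim_{\mathbb R}\mathbb F$. Let $M_{p,q}$ be the space of $p\times q$ matrices over $\mathbb F$ with the Euclidean scalar product $(x|y)=\mathrm{Re}\,\mathrm{tr}(x^*y)$, let $\Sigma_{p,q}=\{x\in M_{p,q}: x^*x=I_q\}$ be the Stiefel manifold, and let $H_q$ be the real space of Hermitian $q\times q$ matrices over $\mathbb F$ with scalar product $\mathrm{Re}\,\mathrm{tr}(xy)$, of real dimension $n=q+\frac d2 q(q-1)$. Let $\Omega_q\subset H_q$ be the cone of positive definite matrices, $\Delta(x)$ the product of the $q$ eigenvalues of $x\in\Omega_q$ (so $\Delta=\det$ for $\mathbb F=\mathbb R,\mathbb C$), and $$\Gamma_{\Omega_q}(z)=\int_{\Omega_q}e^{-\mathrm{tr}\,x}\,\Delta(x)^{z-n/q}\,dx ,$$ where $dx$ is Lebesgue measure on the Euclidean space $H_q$. Let $p,q\ge 1$ and $k\ge 0$ be integers with $p-k\ge q$, and let $D_k=\{v\in M_{k,q}: I-v^*v\in\Omega_q\}$. Then the map $$\Phi: D_k\times\Sigma_{p-k,q}\to\Sigma_{p,q},\qquad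 (v,\sigma')\mapsto\begin{pmatrix} v\\ \sigma'\sqrt{I-v^*v}\end{pmatrix}$$ is a ($C^\infty$) diffeomorphism onto an open and dense subset $\widetilde\Sigma_{p,q}$ of $\Sigma_{p,q}$. Let $d\sigma$ and $d\sigma'$ denote the normalized Riemannian volume measures of $\Sigma_{p,q}$ and $\Sigma_{p-k,q}$ (as submanifolds of $M_{p,q}$ and $M_{p-k,q}$); these are probability measures, invariant under left multiplication by the unitary groups $U_p$ and $U_{p-k}$ over $\mathbb F$ respectively. Put $\eta=\frac d2(p-k)-\frac nq$, and let $dv$ be Lebesgue measure on the Euclidean space $M_{k,q}$. Then, in the coordinates $(v,\sigma')$ given by $\Phi$, on $\widetilde\Sigma_{p,q}$ $$d\sigma=c_{k,p}\,\Delta(I-v^*v)^{\eta}\,d\sigma'\,dv,$$ that is, the restriction of $d\sigma$ to $\widetilde\Sigma_{p,q}$ is the image under $\Phi$ of the measure on the right, where $\Delta(I-v^*v)^\eta$ is integrable over $D_k$ and $$c_{k,p}=\Bigl(\int_{D_k}\Delta(I-v^*v)^{\eta}\,dv\Bigr)^{-1}=\pi^{-dkq/2}\,\frac{\Gamma_{\Omega_q}\bigl(\frac{dp}{2}\bigr)}{\Gamma_{\Omega_q}\bigl(\frac{d(p-k)}{2}\bigr)}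 .$$ -/

import Mathlib

open MeasureTheory Matrix
open scoped ContDiff ENNReal Quaternion

attribute [local instance] Matrix.frobeniusNormedAddCommGroup Matrix.frobeniusNormedSpace

noncomputable section

namespace SplitStiefel

/-! ## The scalars -/

/-- `F` is one of the real division algebras `ℝ`, `ℂ`, `ℍ`, with its standard conjugation `star`
and its standard Euclidean norm (up to an isometric isomorphism of real star-algebras). -/
class IsRealComplexOrQuaternion (F : Type*) [NormedDivisionRing F] [StarRing F]
    [InnerProductSpace ℝ F] : Prop where
  out : (∃ e : F ≃⋆ₐ[ℝ] ℝ, ∀ x, ‖e x‖ = ‖x‖) ∨ (∃ e : F ≃⋆ₐ[ℝ] ℂ, ∀ x, ‖e x‖ = ‖x‖) ∨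
    (∃ e : F ≃⋆ₐ[ℝ] ℍ[ℝ], ∀ x, ‖e x‖ = ‖x‖)

instance : IsRealComplexOrQuaternion ℝ := ⟨Or.inl ⟨StarAlgEquiv.refl _ _, fun _ => rfl⟩⟩

instance : IsRealComplexOrQuaternion ℂ := ⟨Or.inr (Or.inl ⟨StarAlgEquiv.refl _ _, fun _ => rfl⟩)⟩

instance : IsRealComplexOrQuaternion ℍ[ℝ] :=
  ⟨Or.inr (Or.inr ⟨StarAlgEquiv.refl _ _, fun _ => rfl⟩)⟩

section Scalars

variable {F : Type*} [NormedDivisionRing F] [StarRing F] [InnerProductSpace ℝ F]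

/-- The properties of the scalars which are used by the definitions. -/
theorem scalar_facts {A : Type*} [NormedDivisionRing A] [StarRing A] [InnerProductSpace ℝ A]
    [FiniteDimensional ℝ A] [SMulCommClass ℝ A A] [StarModule ℝ A]
    (hA : ∀ a b : A, inner ℝ (1 : A) (star a * b) = inner ℝ a b)
    (e : F ≃⋆ₐ[ℝ] A) (he : ∀ x, ‖e x‖ = ‖x‖) :
    FiniteDimensional ℝ F ∧ SMulCommClass ℝ F F ∧ StarModule ℝ F ∧
      ∀ a b : F, inner ℝ (1 : F) (star a * b) = inner ℝ a b := by
  let l : F ≃ₗ[ℝ] A :=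
    { toFun := e, invFun := e.symm, map_add' := map_add e, map_smul' := fun r x => map_smul e r x
      left_inv := fun x => e.symm_apply_apply x, right_inv := fun x => e.apply_symm_apply x }
  let li : F ≃ₗᵢ[ℝ] A := ⟨l, he⟩
  have hinj : Function.Injective e := e.injective
  have h1 : e 1 = 1 := by
    have := map_mul e (e.symm 1) 1
    rw [mul_one, e.apply_symm_apply, one_mul] at this
    exact this.symm
  refine ⟨Module.Finite.equiv l.symm, ⟨fun r a b => hinj ?_⟩, ⟨fun r a => hinj ?_⟩, fun a b => ?_⟩
  · simp only [smul_eq_mul, map_smul, map_mul, mul_smul_comm]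
  · simp only [map_smul, map_star, star_smul]
  · have h := hA (e a) (e b)
    rw [← map_star, ← map_mul, ← h1] at h
    exact (li.inner_map_map 1 (star a * b)).symm.trans (h.trans (li.inner_map_map a b))

variable (F) in
theorem scalar_facts' [h : IsRealComplexOrQuaternion F] :
    FiniteDimensional ℝ F ∧ SMulCommClass ℝ F F ∧ StarModule ℝ F ∧
      ∀ a b : F, inner ℝ (1 : F) (star a * b) = inner ℝ a b := by
  obtain ⟨e, he⟩ | ⟨e, he⟩ | ⟨e, he⟩ := h.out
  · exact scalar_facts (fun a b => by simp [mul_comm]) e he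
  · exact scalar_facts (fun a b => by simp [Complex.inner, mul_comm]) e he
  · have : StarModule ℝ ℍ[ℝ] := ⟨fun r a => by ext <;> simp⟩
    exact scalar_facts (fun a b => by simp [Quaternion.inner_def]; ring) e he

instance [IsRealComplexOrQuaternion F] : FiniteDimensional ℝ F := (scalar_facts' F).1

instance [IsRealComplexOrQuaternion F] : SMulCommClass ℝ F F := (scalar_facts' F).2.1

instance [IsRealComplexOrQuaternion F] : StarModule ℝ F := (scalar_facts' F).2.2.1

instance [IsRealComplexOrQuaternion F] : IsScalarTower ℝ F F := ⟨fun r a b => by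
  have h : ∀ (r : ℝ) (a : F), star (r • a) = r • star a := fun r a => by simp
  have : star (star (r • a * b)) = star (star (r • (a * b))) := by
    rw [star_mul, h, mul_smul_comm, h (r := r) (a := a * b), star_mul]
  simpa using this⟩

/-- The real part of a scalar. -/
def re (t : F) : ℝ := inner ℝ (1 : F) t

end Scalars

/-! ## Matrix spaces as Euclidean spaces

The norm on matrices is the Frobenius norm, and Lebesgue measure `volume` is the one of the
scalar product `(x | y) = Re tr (x* y)`. -/

section MatrixSpaces

variable {F : Type*} [NormedDivisionRing F] [StarRing F] [InnerProductSpace ℝ F]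
variable {ι κ : Type*} [Fintype ι] [Fintype κ]

instance : InnerProductSpace ℝ (Matrix ι κ F) where
  inner x y := ∑ i, ∑ j, inner ℝ (x i j) (y i j)
  norm_sq_eq_re_inner x := by
    rw [Matrix.frobenius_norm_def, ← Real.sqrt_eq_rpow, Real.sq_sqrt (by positivity)]
    simp
  conj_inner_symm x y := by simp [real_inner_comm]
  add_left x y z := by simp [inner_add_left, Finset.sum_add_distrib]
  smul_left x y r := by simp [real_inner_smul_left, Finset.mul_sum]

theorem inner_eq_re_trace [IsRealComplexOrQuaternion F] (x y : Matrix ι κ F) :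
    inner ℝ x y = re (trace (xᴴ * y)) := by
  simp only [re, trace, Matrix.diag, Matrix.mul_apply, inner_sum, Matrix.conjTranspose_apply,
    (scalar_facts' F).2.2.2]
  exact Finset.sum_comm

instance : MeasurableSpace (Matrix ι κ F) := borel _

instance : BorelSpace (Matrix ι κ F) := ⟨rfl⟩

/-- The same fact with the other syntactic form of the (same) topology on matrices. -/
instance : @BorelSpace (Matrix ι κ F)
    (Matrix.frobeniusNormedAddCommGroup (m := ι) (n := κ)
      (α := F)).toPseudoMetricSpace.toUniformSpace.toTopologicalSpace _ := ⟨rfl⟩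

end MatrixSpaces

section Definitions

variable (F : Type*) [NormedDivisionRing F] [StarRing F] [InnerProductSpace ℝ F]
  [IsRealComplexOrQuaternion F]

/-- `d = dim_ℝ F`. -/
def scalarDim : ℝ := Module.finrank ℝ F

/-- `n = q + (d / 2) q (q - 1)`, the real dimension of the space of Hermitian matrices. -/
def hermDim (q : ℕ) : ℝ := q + scalarDim F / 2 * q * (q - 1)

/-- The real vector space `H_q` of Hermitian `q × q` matrices; as a subspace of the space of all
matrices it has the scalar product `Re tr (x y)` and the corresponding Lebesgue measure. -/
def Herm (q : ℕ) : Submodule ℝ (Matrix (Fin q) (Fin q) F) where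
  carrier := {x | xᴴ = x}
  add_mem' {x y} hx hy := by
    simp only [Set.mem_ofPred_eq] at *
    rw [conjTranspose_add, hx, hy]
  zero_mem' := by simp
  smul_mem' c x hx := by
    simp only [Set.mem_ofPred_eq] at *
    rw [conjTranspose_smul, hx, star_trivial]

variable {F}
variable {q : ℕ}

/-- Strict positive definiteness of a matrix over `F`. -/
def IsPosDef (x : Matrix (Fin q) (Fin q) F) : Prop :=
  xᴴ = x ∧ ∀ ξ : Fin q → F, ξ ≠ 0 → 0 < re (star ξ ⬝ᵥ (x *ᵥ ξ))

/-- Positive semidefiniteness of a matrix over `F`. -/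
def IsPosSemidef (x : Matrix (Fin q) (Fin q) F) : Prop :=
  xᴴ = x ∧ ∀ ξ : Fin q → F, 0 ≤ re (star ξ ⬝ᵥ (x *ᵥ ξ))

open Classical in
/-- The positive semidefinite square root of a positive semidefinite matrix. -/
def msqrt (x : Matrix (Fin q) (Fin q) F) : Matrix (Fin q) (Fin q) F :=
  if h : ∃ s : Matrix (Fin q) (Fin q) F, IsPosSemidef s ∧ s * s = x then h.choose else 0

/-- The real-linear endomorphism `ξ ↦ x ξ` of `F^q`. -/
def mulLeftLin (x : Matrix (Fin q) (Fin q) F) : (Fin q → F) →ₗ[ℝ] (Fin q → F) where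
  toFun ξ := x *ᵥ ξ
  map_add' ξ ζ := Matrix.mulVec_add x ξ ζ
  map_smul' c ξ := Matrix.mulVec_smul x c ξ

/-- The determinant `Δ` of the Jordan algebra `H_q`, on positive definite matrices: the product
of the `q` eigenvalues (see `jdet_eq_prod`).  Each eigenvalue of a positive definite `x` occurs `d`
times in the real-linear endomorphism `ξ ↦ x ξ` of `F^q`, so that the real determinant of the
latter is `Δ(x)^d`. -/
def jdet (x : Matrix (Fin q) (Fin q) F) : ℝ :=
  (LinearMap.det (mulLeftLin x)) ^ (1 / scalarDim F)

/-- `Δ` is the product of the eigenvalues. -/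
theorem jdet_eq_prod (u : Matrix (Fin q) (Fin q) F) (hu : u * uᴴ = 1) (ξ : Fin q → ℝ)
    (hξ : ∀ i, 0 < ξ i) :
    jdet (u * Matrix.diagonal (fun i => ξ i • (1 : F)) * uᴴ) = ∏ i, ξ i := by
  have hmul : ∀ x y : Matrix (Fin q) (Fin q) F,
      mulLeftLin (x * y) = mulLeftLin x ∘ₗ mulLeftLin y := fun x y => by
    refine LinearMap.ext fun ζ => ?_
    simp [mulLeftLin, Matrix.mulVec_mulVec]
  have h1 : mulLeftLin (1 : Matrix (Fin q) (Fin q) F) = LinearMap.id := by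
    refine LinearMap.ext fun ζ => ?_
    simp [mulLeftLin]
  have hd : mulLeftLin (Matrix.diagonal (fun i => ξ i • (1 : F))) =
      LinearMap.pi fun i => (ξ i • LinearMap.id) ∘ₗ LinearMap.proj i := by
    refine LinearMap.ext fun ζ => funext fun i => ?_
    simp [mulLeftLin, Matrix.mulVec_diagonal]
  have hdet : LinearMap.det (mulLeftLin (u * Matrix.diagonal (fun i => ξ i • (1 : F)) * uᴴ)) =
      (∏ i, ξ i) ^ Module.finrank ℝ F := by
    have hu' : LinearMap.det (mulLeftLin u) * LinearMap.det (mulLeftLin uᴴ) = 1 := by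
      rw [← LinearMap.det_comp, ← hmul, hu, h1, LinearMap.det_id]
    rw [hmul, hmul, LinearMap.det_comp, LinearMap.det_comp, mul_right_comm, hu', one_mul, hd,
      LinearMap.det_pi]
    simp [LinearMap.det_smul, Finset.prod_pow]
  have hF : (Module.finrank ℝ F) ≠ 0 := Module.finrank_pos.ne'
  rw [jdet, hdet, scalarDim, one_div, Real.pow_rpow_inv_natCast
    (Finset.prod_nonneg fun i _ => (hξ i).le) hF]

/-- The gamma function `Γ_Ω(z) = ∫_Ω e^{-tr x} Δ(x)^{z - n/q} dx` of the cone `Ω_q` of positive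
definite matrices, at real `z`. -/
def coneGamma (F : Type*) [NormedDivisionRing F] [StarRing F] [InnerProductSpace ℝ F]
    [IsRealComplexOrQuaternion F] (q : ℕ) (z : ℝ) : ℝ :=
  ∫ x in {x : Herm F q | IsPosDef (x : Matrix (Fin q) (Fin q) F)},
    Real.exp (-re (trace (x : Matrix (Fin q) (Fin q) F))) *
      jdet (x : Matrix (Fin q) (Fin q) F) ^ (z - hermDim F q / q)

variable (F)

/-- The ball `D_k = {v ∈ M_{k,q} : v* v < I}`. -/
def matBall (k q : ℕ) : Set (Matrix (Fin k) (Fin q) F) := {v | IsPosDef (1 - vᴴ * v)}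

/-- The Stiefel manifold `Σ_{p,q} = {x ∈ M_{p,q} : x* x = I}`. -/
def stiefel (p q : ℕ) : Set (Matrix (Fin p) (Fin q) F) := {x | xᴴ * x = 1}

/-- The dimension `d p q - n` of the Stiefel manifold `Σ_{p,q}`. -/
def stiefelDim (p q : ℕ) : ℝ := scalarDim F * p * q - hermDim F q

/-- The normalized Riemannian volume of the Stiefel manifold `Σ_{p,q}` as a submanifold of the
Euclidean space `M_{p,q}`, considered as a measure on `M_{p,q}`.  On an embedded submanifold of
dimension `D`, the `D`-dimensional Hausdorff measure is a constant multiple of the Riemannian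
volume. -/
def stiefelMeasure (p q : ℕ) : Measure (Matrix (Fin p) (Fin q) F) :=
  (Measure.hausdorffMeasure (stiefelDim F p q) (stiefel F p q))⁻¹ •
    (Measure.hausdorffMeasure (stiefelDim F p q)).restrict (stiefel F p q)

variable {F}

/-- The map `Φ(v, σ') = (v ; σ' √(I - v* v))`, with the second block below the first one. -/
def splitMap {k m : ℕ} (x : Matrix (Fin k) (Fin q) F × Matrix (Fin m) (Fin q) F) :
    Matrix (Fin (k + m)) (Fin q) F :=
  (fromRows x.1 (x.2 * msqrt (1 - x.1ᴴ * x.1))).submatrix finSumFinEquiv.symm id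

end Definitions

/-! ## Diffeomorphisms between subsets of Euclidean spaces -/

section Smooth

variable {E E' : Type*} [NormedAddCommGroup E] [NormedSpace ℝ E] [NormedAddCommGroup E']
  [NormedSpace ℝ E']

/-- A map on a subset `s` of a Euclidean space (such as an embedded submanifold) is smooth if it
extends to a `C^∞` map on an open neighbourhood of each point of `s`. -/
def IsSmoothOn (f : E → E') (s : Set E) : Prop :=
  ∀ x ∈ s, ∃ U : Set E, IsOpen U ∧ x ∈ U ∧ ∃ g : E → E', ContDiffOn ℝ ∞ g U ∧
    ∀ y ∈ s ∩ U, g y = f y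

/-- `f` restricts to a diffeomorphism from `s` onto `t`: a bijection which is smooth together with
its inverse. -/
def IsDiffeoOnto (f : E → E') (s : Set E) (t : Set E') : Prop :=
  ∃ g : E' → E, Set.MapsTo f s t ∧ Set.MapsTo g t s ∧ Set.InvOn g f s t ∧
    IsSmoothOn f s ∧ IsSmoothOn g t

end Smooth

end SplitStiefel

end

set_option linter.unusedSectionVars false

noncomputable section

namespace SplitStiefel

/-! Write `p = k + m`. The formula is a statement about Gaussian matrices. Give `M_{p,q}` the weight
`exp(-|x|²)`. Almost every `x` has a positive definite Gram matrix `r = x* x`, and by unitary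
invariance the angular part `x r^{-1/2}` is distributed like `σ`, independently of `r`
(`lintegral_gaussM_polar`, `lintegral_gaussM_angular`).

Now cut `x` into its upper `k` rows `x₁` and lower `m` rows `x₂`, which are independent. Write `x₂ =
s' r₂^{1/2}`, where `s'` is uniform on `Σ_{m,q}` and `r₂` has the Wishart density `e^{-tr} Δ^{dm/2 -
n/q}`. Put `r = x₁* x₁ + r₂` and `x₁ = v r^{1/2}`. Then `r₂ = r^{1/2} (1 - v* v) r^{1/2}` and `dx₁
dr₂ = Δ(r)^{dk/2} dv dr`, so the joint density becomes a function of `r` times `Δ(1 - v* v)^η`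
(`lintegral_gaussM_coneDensity`). The angular part of `x` is `(v ; s' r₂^{1/2} r^{-1/2})`. Since
`r₂^{1/2} r^{-1/2} = w (1 - v* v)^{1/2}` with `w` unitary, and `σ'` is right invariant, `w`
disappears and `Φ(v, s')` remains (`lintegral_splitMapM_of_unitary`). The integral over `r` then
factors out. The proportionality constant is found by testing on the function `1`, and the same
change of variables, without the angular part, evaluates the ball integral
(`gammaL_mul_ballIntegral`).

The Wishart density comes from Laplace transforms. Both the law of `x* x` and the measure `e^{-tr}
Δ^{z - n/q} dr` with `z = dm/2` have transforms proportional to `Δ(1 - b)^{-z}` near `b = 0`, and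
equality near the origin determines a finite measure (`measure_ext_of_laplace`, `map_gram_gaussM`).

On the geometric side, `1` is a regular value of `x ↦ x* x`, which makes the Hausdorff measure of
the Stiefel manifold finite and positive on nonempty relatively open sets. Smoothness of `Φ` and its
inverse reduces to smoothness of the positive square root. The image of `Φ` consists of the points
whose upper block lies in the ball; it has full measure by the splitting formula, hence is dense.

All three scalar algebras are treated at once: real parts of traces are cyclic, and eigenvalues,
dimensions and determinants are taken over `ℝ`. -/

/-- The topology of the Frobenius norm. -/
abbrev frobeniusTopology {ι κ F : Type*} [Fintype ι] [Fintype κ] [NormedAddCommGroup F] :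
    TopologicalSpace (Matrix ι κ F) :=
  (Matrix.frobeniusNormedAddCommGroup (m := ι) (n := κ)
    (α := F)).toPseudoMetricSpace.toUniformSpace.toTopologicalSpace

attribute [local instance] frobeniusTopology

/-! ### Scalars: conjugation, norm and real part -/

section ScalarFacts

variable {F : Type*} [NormedDivisionRing F] [StarRing F] [InnerProductSpace ℝ F]

theorem star_facts_of_equiv {A : Type*} [NormedDivisionRing A] [StarRing A] [InnerProductSpace ℝ A]
    (hA : ∀ a : A, star a * a = (‖a‖ ^ 2) • (1 : A)) (hA' : ∀ a : A, star a = a → ∃ r : ℝ, a = r • 1)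
    (e : F ≃⋆ₐ[ℝ] A) (he : ∀ x, ‖e x‖ = ‖x‖) :
    (∀ a : F, star a * a = (‖a‖ ^ 2) • (1 : F)) ∧ ∀ a : F, star a = a → ∃ r : ℝ, a = r • 1 := by
  have h1 : e 1 = 1 := by
    have := map_mul e (e.symm 1) 1
    rw [mul_one, e.apply_symm_apply, one_mul] at this
    exact this.symm
  refine ⟨fun a => ?_, fun a ha => ?_⟩
  · have h : e (star a * a) = e ((‖a‖ ^ 2) • (1 : F)) := by
      rw [map_mul, map_star, hA, he, map_smul, h1]
    exact e.injective h
  · obtain ⟨r, hr⟩ := hA' (e a) (by rw [← map_star, ha])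
    have h : e a = e (r • (1 : F)) := by rw [hr, map_smul, h1]
    exact ⟨r, e.injective h⟩

-- Together with `scalar_facts'`, the only place where the three algebras are inspected
-- individually; everything afterwards uses these identities and the positivity of the dimension.
variable (F) in
theorem star_facts [h : IsRealComplexOrQuaternion F] :
    (∀ a : F, star a * a = (‖a‖ ^ 2) • (1 : F)) ∧ ∀ a : F, star a = a → ∃ r : ℝ, a = r • 1 := by
  obtain ⟨e, he⟩ | ⟨e, he⟩ | ⟨e, he⟩ := h.out
  · exact star_facts_of_equiv (fun a => by simp [sq]) (fun a _ => ⟨a, by simp⟩) e he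
  · refine star_facts_of_equiv (fun a => ?_) (fun a h => ⟨a.re, ?_⟩) e he
    · rw [Complex.star_def, ← Complex.normSq_eq_conj_mul_self, Complex.normSq_eq_norm_sq]
      simp
    · rw [Complex.star_def] at h
      simpa using (Complex.conj_eq_iff_re.1 h).symm
  · refine star_facts_of_equiv (fun a => ?_) (fun a h => ⟨a.re, ?_⟩) e he
    · rw [Quaternion.star_mul_self, Quaternion.normSq_eq_norm_mul_self, sq]
      ext <;> simp
    · have h2 := Quaternion.star_eq_self.1 h
      conv_lhs => rw [h2]
      ext <;> simp

variable [IsRealComplexOrQuaternion F]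

theorem star_mul_self_eq (a : F) : star a * a = (‖a‖ ^ 2) • (1 : F) := (star_facts F).1 a

theorem re_smul_one (r : ℝ) : re (r • (1 : F)) = r := by simp [re, inner_smul_right]

theorem re_add (a b : F) : re (a + b) = re a + re b := inner_add_right _ _ _

theorem re_zero : re (0 : F) = 0 := inner_zero_right _

theorem re_sum {ι : Type*} (s : Finset ι) (f : ι → F) : re (∑ i ∈ s, f i) = ∑ i ∈ s, re (f i) :=
  inner_sum _ _ _

theorem re_smul (r : ℝ) (a : F) : re (r • a) = r * re a := inner_smul_right _ _ _

theorem eq_re_smul_one {a : F} (h : star a = a) : a = re a • 1 := by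
  obtain ⟨r, rfl⟩ := (star_facts F).2 a h
  rw [re_smul_one]

theorem inner_eq_re (a b : F) : inner ℝ a b = re (star a * b) := ((scalar_facts' F).2.2.2 a b).symm

theorem norm_star_eq (a : F) : ‖star a‖ = ‖a‖ := by
  by_cases ha : a = 0
  · simp [ha]
  have h := congrArg norm (star_mul_self_eq a)
  rw [norm_mul, norm_smul, norm_one, mul_one, Real.norm_of_nonneg (by positivity), sq] at h
  exact mul_right_cancel₀ (norm_ne_zero_iff.2 ha) h

theorem inner_star_star (a b : F) : inner ℝ (star a) (star b) = inner ℝ a b := by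
  rw [real_inner_eq_norm_add_mul_self_sub_norm_mul_self_sub_norm_mul_self_div_two,
    real_inner_eq_norm_add_mul_self_sub_norm_mul_self_sub_norm_mul_self_div_two, ← star_add,
    norm_star_eq, norm_star_eq, norm_star_eq]

theorem re_star (a : F) : re (star a) = re a := by
  have := inner_star_star (1 : F) a
  rwa [star_one] at this

/-- The substitute for commutativity: both sides are scalar products, exchanged by conjugation,
which is an isometry. -/
theorem re_mul_comm (a b : F) : re (a * b) = re (b * a) := by
  have h1 := inner_eq_re (star a) b
  have h2 := inner_eq_re (star b) a
  rw [star_star] at h1 h2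
  rw [← h1, ← h2, ← inner_star_star, star_star, real_inner_comm]

theorem scalarDim_pos : 0 < scalarDim F := Nat.cast_pos.2 Module.finrank_pos

theorem one_le_scalarDim : 1 ≤ scalarDim F := by
  have : 0 < Module.finrank ℝ F := Module.finrank_pos
  exact Nat.one_le_cast.2 this

end ScalarFacts

/-! ### Matrices: adjoints of multiplications and isometries -/

section MatrixFacts

variable {F : Type*} [NormedDivisionRing F] [StarRing F] [InnerProductSpace ℝ F]
  [IsRealComplexOrQuaternion F]
variable {ι κ μ : Type*} [Fintype ι] [Fintype κ] [Fintype μ]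

/-- Over the quaternions the trace itself is not cyclic; only its real part is. -/
theorem re_trace_mul_comm (x : Matrix ι κ F) (y : Matrix κ ι F) :
    re (trace (x * y)) = re (trace (y * x)) := by
  simp only [trace, Matrix.diag, Matrix.mul_apply, re_sum]
  rw [Finset.sum_comm]
  simp only [re_mul_comm]

theorem re_trace_conjTranspose (x : Matrix ι ι F) : re (trace xᴴ) = re (trace x) := by
  simp [trace, re_sum, re_star]

theorem inner_mul_left_eq (a : Matrix ι κ F) (x : Matrix κ μ F) (y : Matrix ι μ F) :
    inner ℝ (a * x) y = inner ℝ x (aᴴ * y) := by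
  rw [inner_eq_re_trace, inner_eq_re_trace, conjTranspose_mul, Matrix.mul_assoc]

theorem inner_mul_right_eq (x : Matrix ι κ F) (a : Matrix κ μ F) (y : Matrix ι μ F) :
    inner ℝ (x * a) y = inner ℝ x (y * aᴴ) := by
  rw [inner_eq_re_trace, inner_eq_re_trace, conjTranspose_mul, Matrix.mul_assoc, re_trace_mul_comm,
    Matrix.mul_assoc]

theorem inner_conjTranspose (x y : Matrix ι κ F) : inner ℝ xᴴ yᴴ = inner ℝ x y := by
  rw [inner_eq_re_trace, inner_eq_re_trace, conjTranspose_conjTranspose, re_trace_mul_comm,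
    ← re_trace_conjTranspose, conjTranspose_mul, conjTranspose_conjTranspose]

theorem norm_sq_eq_re_trace (x : Matrix ι κ F) : ‖x‖ ^ 2 = re (trace (xᴴ * x)) := by
  rw [← inner_eq_re_trace, real_inner_self_eq_norm_sq]

theorem norm_mul_of_conjTranspose_mul_self [DecidableEq ι] {u : Matrix μ ι F} (hu : uᴴ * u = 1) (x : Matrix ι κ F) :
    ‖u * x‖ = ‖x‖ := by
  rw [← sq_eq_sq₀ (norm_nonneg _) (norm_nonneg _), ← real_inner_self_eq_norm_sq,
    inner_mul_left_eq, ← Matrix.mul_assoc, hu, Matrix.one_mul, real_inner_self_eq_norm_sq]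

theorem norm_mul_of_mul_conjTranspose_self [DecidableEq κ] {w : Matrix κ μ F} (hw : w * wᴴ = 1) (x : Matrix ι κ F) :
    ‖x * w‖ = ‖x‖ := by
  rw [← sq_eq_sq₀ (norm_nonneg _) (norm_nonneg _), ← real_inner_self_eq_norm_sq,
    inner_mul_right_eq, Matrix.mul_assoc, hw, Matrix.mul_one, real_inner_self_eq_norm_sq]

theorem finrank_matrix_eq : Module.finrank ℝ (Matrix ι κ F)
    = Fintype.card ι * Fintype.card κ * Module.finrank ℝ F := by
  rw [Module.finrank_matrix]

/-- Left multiplication as a real-linear map. -/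
def lmul (a : Matrix ι κ F) : Matrix κ μ F →ₗ[ℝ] Matrix ι μ F where
  toFun x := a * x
  map_add' := Matrix.mul_add a
  map_smul' c x := Matrix.mul_smul a c x

/-- Right multiplication as a real-linear map. -/
def rmul (a : Matrix κ μ F) : Matrix ι κ F →ₗ[ℝ] Matrix ι μ F where
  toFun x := x * a
  map_add' x y := Matrix.add_mul x y a
  map_smul' c x := Matrix.smul_mul c x a

@[simp] theorem lmul_apply (a : Matrix ι κ F) (x : Matrix κ μ F) : lmul a x = a * x := rfl

/-- A matrix is determined by its products with columns. -/
theorem eq_of_mul_column_eq [DecidableEq κ] {a b : Matrix ι κ F}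
    (h : ∀ z : Matrix κ (Fin 1) F, a * z = b * z) : a = b := by
  ext i j
  have := congrFun (congrFun (h (Matrix.of fun l _ => if l = j then 1 else 0)) i) 0
  simpa [Matrix.mul_apply] using this

/-- Isometric matrices of square shape are unitary. -/
theorem mul_conjTranspose_eq_one [DecidableEq ι] [DecidableEq κ] {u : Matrix ι κ F} (h : Fintype.card ι = Fintype.card κ)
    (hu : uᴴ * u = 1) : u * uᴴ = 1 := by
  have hinj : Function.Injective (lmul u : Matrix κ (Fin 1) F →ₗ[ℝ] Matrix ι (Fin 1) F) := by
    intro x y hxy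
    have := congrArg (fun z => uᴴ * z) hxy
    simpa [← Matrix.mul_assoc, hu] using this
  -- An injective real-linear map between column spaces of equal real dimension is onto; a right
  -- inverse is then checked on columns `u y`.
  have hsurj := (LinearMap.injective_iff_surjective_of_finrank_eq_finrank
    (by rw [finrank_matrix_eq, finrank_matrix_eq, h])).1 hinj
  refine eq_of_mul_column_eq fun z => ?_
  obtain ⟨y, rfl⟩ := hsurj z
  rw [lmul_apply, Matrix.mul_assoc, ← Matrix.mul_assoc uᴴ, hu, Matrix.one_mul, Matrix.one_mul]

end MatrixFacts

/-! ### Orthonormal frames and the spectral theorem -/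

section Frames

variable {F : Type*} [NormedDivisionRing F] [StarRing F] [InnerProductSpace ℝ F]
  [IsRealComplexOrQuaternion F]
variable {ι : Type*} [Fintype ι] [DecidableEq ι]

theorem column_conjTranspose_mul_self (z : Matrix ι (Fin 1) F) :
    zᴴ * z = (‖z‖ ^ 2) • (1 : Matrix (Fin 1) (Fin 1) F) := by
  have h : star ((zᴴ * z) 0 0) = (zᴴ * z) 0 0 := by
    have : (zᴴ * z)ᴴ = zᴴ * z := by rw [conjTranspose_mul, conjTranspose_conjTranspose]
    exact congrFun (congrFun this 0) 0
  have h2 : ‖z‖ ^ 2 = re ((zᴴ * z) 0 0) := by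
    rw [norm_sq_eq_re_trace]
    simp [trace]
  ext i j
  fin_cases i; fin_cases j
  rw [h2]
  simpa using eq_re_smul_one h

/-- A Hermitian matrix leaving the span of an orthonormal frame invariant has a unit eigenvector
orthogonal to the frame. -/
theorem exists_unit_eigenvector {κ : Type*} [Fintype κ] [DecidableEq κ] {x : Matrix ι ι F}
    (hx : xᴴ = x) {y : Matrix ι κ F} {a : Matrix κ κ F} (ha : x * y = y * a)
    (hc : Fintype.card κ < Fintype.card ι) :
    ∃ (z : Matrix ι (Fin 1) F) (c : ℝ), zᴴ * z = 1 ∧ yᴴ * z = 0 ∧ x * z = c • z := by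
  -- The orthogonal complement of the frame. It is nonzero by counting real dimensions, and `x`
  -- preserves it because `x` is Hermitian and preserves the span of the frame.
  set V : Submodule ℝ (Matrix ι (Fin 1) F) :=
    LinearMap.ker (lmul yᴴ : Matrix ι (Fin 1) F →ₗ[ℝ] Matrix κ (Fin 1) F) with hV
  have hVne : Nontrivial V := by
    have h := LinearMap.ker_ne_bot_of_finrank_lt
      (f := (lmul yᴴ : Matrix ι (Fin 1) F →ₗ[ℝ] Matrix κ (Fin 1) F)) (by
        rw [finrank_matrix_eq, finrank_matrix_eq]
        have : 0 < Module.finrank ℝ F := Module.finrank_pos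
        simp only [Fintype.card_fin, mul_one]
        gcongr)
    exact (Submodule.nontrivial_iff_ne_bot).2 h
  have hinv : ∀ z ∈ V, (lmul x : Matrix ι (Fin 1) F →ₗ[ℝ] _) z ∈ V := by
    intro z hz
    rw [hV, LinearMap.mem_ker, lmul_apply] at hz ⊢
    have h1 : yᴴ * x = aᴴ * yᴴ := by rw [← conjTranspose_mul, ← ha, conjTranspose_mul, hx]
    rw [lmul_apply, ← Matrix.mul_assoc, h1, Matrix.mul_assoc, hz, Matrix.mul_zero]
  have hsymm : ((lmul x).restrict hinv).IsSymmetric := by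
    rintro ⟨z, hz⟩ ⟨w, hw⟩
    change inner ℝ (x * z) w = inner ℝ z (x * w)
    rw [inner_mul_left_eq, hx]
  -- The eigenvalue belongs to a real symmetric operator, hence is real and commutes with all
  -- scalars: left and right eigenvalues need not be distinguished.
  obtain ⟨⟨z, hz⟩, hzz⟩ := hsymm.hasEigenvalue_iSup_of_finiteDimensional.exists_hasEigenvector
  set c : ℝ := _
  have hz0 : z ≠ 0 := fun h => hzz.2 (Subtype.ext h)
  have hxz : x * z = c • z := congrArg Subtype.val hzz.apply_eq_smul
  have hn : ‖z‖ ≠ 0 := norm_ne_zero_iff.2 hz0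
  refine ⟨‖z‖⁻¹ • z, c, ?_, ?_, ?_⟩
  · rw [column_conjTranspose_mul_self, norm_smul, norm_inv, norm_norm, inv_mul_cancel₀ hn]
    simp
  · have : yᴴ * z = 0 := hz
    rw [Matrix.mul_smul, this, smul_zero]
  · rw [Matrix.mul_smul, hxz, smul_comm]

/-- Induction on the missing dimension `n`: a unit eigenvector `w` orthogonal to the frame `y` is
appended to it, and the enlarged frame is again invariant, with matrix `diag(a, c)`. Starting from
an arbitrary frame lets the lemma serve twice: the empty frame gives the spectral theorem, and `x =
0` gives completion of a frame to an orthonormal basis. -/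
theorem exists_eigenframe (n : ℕ) : ∀ {κ : Type _} [Fintype κ] [DecidableEq κ] {x : Matrix ι ι F}
    (_ : xᴴ = x) {y : Matrix ι κ F} {a : Matrix κ κ F} (_ : yᴴ * y = 1) (_ : x * y = y * a)
    (_ : Fintype.card κ + n = Fintype.card ι),
    ∃ (κ' : Type) (_ : Fintype κ') (_ : DecidableEq κ') (z : Matrix ι κ' F) (ξ : κ' → ℝ),
      Fintype.card κ' = n ∧ zᴴ * z = 1 ∧ yᴴ * z = 0 ∧
        x * z = z * diagonal (fun i => ξ i • (1 : F)) := by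
  induction n with
  | zero =>
    intro κ _ _ x hx y a hy ha hc
    exact ⟨Fin 0, inferInstance, inferInstance, 0, 0, by simp, Subsingleton.elim _ _, by simp,
      by simp⟩
  | succ n ih =>
    intro κ _ _ x hx y a hy ha hc
    obtain ⟨w, c, hw, hyw, hxw⟩ := exists_unit_eigenvector hx ha (by omega)
    have hwy : wᴴ * y = 0 := by
      have := congrArg conjTranspose hyw
      simpa using this
    obtain ⟨κ', _, _, z, ξ, hcard, hz, hyz, hxz⟩ := ih hx (y := fromCols y w)
      (a := fromBlocks a 0 0 (c • 1)) (by
        rw [conjTranspose_fromCols_eq_fromRows_conjTranspose, fromRows_mul_fromCols, hy, hw, hyw,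
          hwy, fromBlocks_one])
      (by rw [mul_fromCols, fromCols_mul_fromBlocks, ha, hxw]; simp)
      (by rw [Fintype.card_sum, Fintype.card_fin]; omega)
    rw [conjTranspose_fromCols_eq_fromRows_conjTranspose, fromRows_mul] at hyz
    have hyz1 : yᴴ * z = 0 := by
      ext i j; exact congrFun (congrFun hyz (Sum.inl i)) j
    have hwz : wᴴ * z = 0 := by
      ext i j; exact congrFun (congrFun hyz (Sum.inr i)) j
    have hzw : zᴴ * w = 0 := by
      have := congrArg conjTranspose hwz
      simpa using this
    refine ⟨Fin 1 ⊕ κ', inferInstance, inferInstance, fromCols w z, Sum.elim (fun _ => c) ξ,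
      by simp [hcard, add_comm], ?_, ?_, ?_⟩
    · rw [conjTranspose_fromCols_eq_fromRows_conjTranspose, fromRows_mul_fromCols, hz, hw, hzw,
          hwz, fromBlocks_one]
    · rw [mul_fromCols, hyw, hyz1, fromCols_zero]
    · have : (diagonal fun i => (Sum.elim (fun _ : Fin 1 => c) ξ i) • (1 : F)) =
          fromBlocks (c • 1) 0 0 (diagonal fun i => ξ i • (1 : F)) := by
        ext (i | i) (j | j) <;> simp [diagonal_apply, Matrix.one_apply]
      rw [this, mul_fromCols, fromCols_mul_fromBlocks, hxw, hxz]
      simp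

/-- Spectral theorem for Hermitian matrices over `F`. -/
theorem exists_diagonalization {q : ℕ} {x : Matrix (Fin q) (Fin q) F} (hx : xᴴ = x) :
    ∃ (u : Matrix (Fin q) (Fin q) F) (ξ : Fin q → ℝ), uᴴ * u = 1 ∧ u * uᴴ = 1 ∧
      x = u * diagonal (fun i => ξ i • (1 : F)) * uᴴ := by
  obtain ⟨κ, _, _, z, ξ, hκ, hz, -, hxz⟩ := exists_eigenframe q (κ := Fin 0) hx (y := 0) (a := 0)
    (Subsingleton.elim _ _) (by simp) (by simp)
  have e : Fin q ≃ κ := Fintype.equivOfCardEq (by simp [hκ])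
  have h1 : (z.submatrix id e)ᴴ * z.submatrix id e = 1 := by
    have : (z.submatrix id e)ᴴ * z.submatrix id e = (zᴴ * z).submatrix e e := rfl
    rw [this, hz, submatrix_one_equiv]
  have h2 := mul_conjTranspose_eq_one rfl h1
  refine ⟨z.submatrix id e, ξ ∘ e, h1, h2, ?_⟩
  have h3 : x * z.submatrix id e = z.submatrix id e *
      diagonal (fun i => (ξ ∘ e) i • (1 : F)) := by
    have : diagonal (fun i => (ξ ∘ e) i • (1 : F)) =
        (diagonal (fun i => ξ i • (1 : F))).submatrix e e := by
      rw [submatrix_diagonal_equiv]; rfl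
    rw [this, submatrix_mul_equiv, ← hxz]
    rfl
  rw [← h3, Matrix.mul_assoc, h2, Matrix.mul_one]

/-- The unitary group acts transitively on the Stiefel manifold. -/
theorem exists_unitary_mul_eq {κ : Type*} [Fintype κ] [DecidableEq κ] {y y' : Matrix ι κ F}
    (hy : yᴴ * y = 1) (hy' : y'ᴴ * y' = 1) (hc : Fintype.card κ ≤ Fintype.card ι) :
    ∃ u : Matrix ι ι F, uᴴ * u = 1 ∧ u * uᴴ = 1 ∧ u * y = y' := by
  obtain ⟨n, hn⟩ := Nat.exists_eq_add_of_le hc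
  -- With `x = 0` every frame is invariant, so this merely completes `y` to an orthonormal basis;
  -- the next line does the same for `y'`.
  obtain ⟨κ₁, _, _, z, -, h1, hz, hyz, -⟩ := exists_eigenframe n (x := 0) (by simp) (a := 0) hy
    (by simp) hn.symm
  obtain ⟨κ₂, _, _, z', -, h2, hz', hyz', -⟩ := exists_eigenframe n (x := 0) (by simp) (a := 0) hy'
    (by simp) hn.symm
  have e : κ₁ ≃ κ₂ := Fintype.equivOfCardEq (by rw [h1, h2])
  have hz'' : (z'.submatrix id e)ᴴ * z'.submatrix id e = 1 := by
    have : (z'.submatrix id e)ᴴ * z'.submatrix id e = (z'ᴴ * z').submatrix e e := rfl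
    rw [this, hz', submatrix_one_equiv]
  have hyz'' : y'ᴴ * z'.submatrix id e = 0 := by
    have : y'ᴴ * z'.submatrix id e = (y'ᴴ * z').submatrix id e := rfl
    rw [this, hyz']; rfl
  set w := z'.submatrix id e
  have hzy : zᴴ * y = 0 := by
    have := congrArg conjTranspose hyz
    simpa using this
  have hzy' : wᴴ * y' = 0 := by
    have := congrArg conjTranspose hyz''
    simpa using this
  have hA : fromCols y' w * fromRows yᴴ zᴴ * (fromCols y z) = fromCols y' w := by
    rw [Matrix.mul_assoc, fromRows_mul_fromCols, hy, hz, hyz, hzy, fromBlocks_one, Matrix.mul_one]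
  have hcard : Fintype.card ι = Fintype.card (κ ⊕ κ₁) := by
    rw [Fintype.card_sum, hn, h1]
  have hB : (fromCols y z)ᴴ * fromCols y z = 1 := by
    rw [conjTranspose_fromCols_eq_fromRows_conjTranspose, fromRows_mul_fromCols, hy, hz, hyz, hzy,
      fromBlocks_one]
  have hB2 := mul_conjTranspose_eq_one hcard hB
  have hC : (fromCols y' w)ᴴ * fromCols y' w = 1 := by
    rw [conjTranspose_fromCols_eq_fromRows_conjTranspose, fromRows_mul_fromCols, hy', hz'', hyz'',
      hzy', fromBlocks_one]
  have hu : (fromCols y' w * (fromCols y z)ᴴ)ᴴ * (fromCols y' w * (fromCols y z)ᴴ) = 1 := by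
    rw [conjTranspose_mul, conjTranspose_conjTranspose, Matrix.mul_assoc, ← Matrix.mul_assoc _ᴴ,
      hC, Matrix.one_mul, hB2]
  -- The unitary carrying the basis `(y, z)` to the basis `(y', w)`.
  refine ⟨fromCols y' w * (fromCols y z)ᴴ, hu, mul_conjTranspose_eq_one rfl hu, ?_⟩
  rw [conjTranspose_fromCols_eq_fromRows_conjTranspose, Matrix.mul_assoc, fromRows_mul, hy, hzy,
    fromCols_mul_fromRows, Matrix.mul_one, Matrix.mul_zero, add_zero]

end Frames

/-! ### Positive definite matrices, square roots and inverses -/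

section PosDef

variable {F : Type*} [NormedDivisionRing F] [StarRing F] [InnerProductSpace ℝ F]
  [IsRealComplexOrQuaternion F]
variable {q : ℕ} {κ : Type*} [Fintype κ]

theorem inner_mul_self_eq_sum (x : Matrix (Fin q) (Fin q) F) (z : Matrix (Fin q) κ F) :
    inner ℝ z (x * z) =
      ∑ j, re (star (fun i => z i j) ⬝ᵥ (x *ᵥ fun i => z i j)) := by
  have : inner ℝ z (x * z) = ∑ i, ∑ j, inner ℝ (z i j) ((x * z) i j) := rfl
  rw [this, Finset.sum_comm]
  refine Finset.sum_congr rfl fun j _ => ?_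
  rw [dotProduct, re_sum]
  refine Finset.sum_congr rfl fun i _ => ?_
  rw [inner_eq_re]
  rfl

theorem IsPosDef.inner_pos {x : Matrix (Fin q) (Fin q) F} (hx : IsPosDef x)
    {z : Matrix (Fin q) κ F} (hz : z ≠ 0) : 0 < inner ℝ z (x * z) := by
  rw [inner_mul_self_eq_sum]
  obtain ⟨i, j, hij⟩ : ∃ i j, z i j ≠ 0 := by
    by_contra! h
    exact hz (Matrix.ext h)
  refine Finset.sum_pos' (fun j _ => ?_) ⟨j, Finset.mem_univ _, hx.2 _ fun h => hij (congrFun h i)⟩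
  by_cases h : (fun i => z i j) = 0
  · rw [h]; simp [re_zero]
  · exact (hx.2 _ h).le

theorem IsPosSemidef.inner_nonneg {x : Matrix (Fin q) (Fin q) F} (hx : IsPosSemidef x)
    (z : Matrix (Fin q) κ F) : 0 ≤ inner ℝ z (x * z) := by
  rw [inner_mul_self_eq_sum]
  exact Finset.sum_nonneg fun j _ => hx.2 _

/-- Vectors become one-column matrices, so that the adjointness rules for matrix products apply to
them. -/
theorem isPosDef_iff {x : Matrix (Fin q) (Fin q) F} :
    IsPosDef x ↔ xᴴ = x ∧ ∀ z : Matrix (Fin q) (Fin 1) F, z ≠ 0 → 0 < inner ℝ z (x * z) := by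
  refine ⟨fun h => ⟨h.1, fun z hz => h.inner_pos hz⟩, fun h => ⟨h.1, fun ξ hξ => ?_⟩⟩
  have := h.2 (Matrix.of fun i _ => ξ i) fun h0 => hξ (by
    ext i; exact congrFun (congrFun h0 i) 0)
  rw [inner_mul_self_eq_sum] at this
  simpa using this

theorem IsPosDef.isPosSemidef {x : Matrix (Fin q) (Fin q) F} (hx : IsPosDef x) :
    IsPosSemidef x := by
  refine ⟨hx.1, fun ξ => ?_⟩
  by_cases h : ξ = 0
  · rw [h]; simp [re_zero]
  · exact (hx.2 _ h).le

theorem IsPosDef.mul_ne_zero {x : Matrix (Fin q) (Fin q) F} (hx : IsPosDef x)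
    {z : Matrix (Fin q) κ F} (hz : z ≠ 0) : x * z ≠ 0 := fun h => by
  have := hx.inner_pos hz
  rw [h, inner_zero_right] at this
  exact lt_irrefl _ this

theorem IsPosDef.conj {x g : Matrix (Fin q) (Fin q) F} (hx : IsPosDef x)
    (hg : ∀ z : Matrix (Fin q) (Fin 1) F, z ≠ 0 → g * z ≠ 0) : IsPosDef (gᴴ * x * g) := by
  refine isPosDef_iff.2 ⟨?_, fun z hz => ?_⟩
  · rw [conjTranspose_mul, conjTranspose_mul, conjTranspose_conjTranspose, hx.1, Matrix.mul_assoc]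
  · rw [Matrix.mul_assoc, Matrix.mul_assoc, real_inner_comm, inner_mul_left_eq,
      conjTranspose_conjTranspose, real_inner_comm]
    exact hx.inner_pos (hg z hz)

theorem IsPosDef.conj_herm {x s : Matrix (Fin q) (Fin q) F} (hx : IsPosDef x)
    (hs : IsPosDef s) : IsPosDef (s * x * s) := by
  have := hx.conj (g := s) fun z hz => hs.mul_ne_zero hz
  rwa [hs.1] at this

theorem isPosDef_one : IsPosDef (1 : Matrix (Fin q) (Fin q) F) := by
  refine isPosDef_iff.2 ⟨conjTranspose_one, fun z hz => ?_⟩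
  rw [Matrix.one_mul]
  exact real_inner_self_pos.2 hz

theorem IsPosDef.add_conjTranspose_mul_self {x : Matrix (Fin q) (Fin q) F} (hx : IsPosDef x)
    (y : Matrix κ (Fin q) F) : IsPosDef (x + yᴴ * y) := by
  refine isPosDef_iff.2 ⟨by rw [conjTranspose_add, hx.1, conjTranspose_mul,
    conjTranspose_conjTranspose], fun z hz => ?_⟩
  rw [Matrix.add_mul, inner_add_right]
  have h1 := hx.inner_pos hz
  have h2 : inner ℝ z (yᴴ * y * z) = inner ℝ (y * z) (y * z) := by
    rw [inner_mul_left_eq, Matrix.mul_assoc]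
  rw [h2]
  have := real_inner_self_nonneg (x := y * z)
  linarith

theorem diagonal_conjTranspose_real {ι : Type*} [DecidableEq ι] (ξ : ι → ℝ) :
    (diagonal fun i => ξ i • (1 : F))ᴴ = diagonal fun i => ξ i • (1 : F) := by
  rw [diagonal_conjTranspose]
  congr 1
  ext i
  simp

theorem isPosDef_diagonal {ξ : Fin q → ℝ} (hξ : ∀ i, 0 < ξ i) :
    IsPosDef (diagonal fun i => ξ i • (1 : F)) := by
  refine ⟨diagonal_conjTranspose_real ξ, fun ζ hζ => ?_⟩
  obtain ⟨i, hi⟩ := Function.ne_iff.1 hζ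
  have : re (star ζ ⬝ᵥ (diagonal (fun i => ξ i • (1 : F)) *ᵥ ζ)) = ∑ i, ξ i * ‖ζ i‖ ^ 2 := by
    rw [dotProduct, re_sum]
    refine Finset.sum_congr rfl fun i _ => ?_
    rw [mulVec_diagonal, smul_one_mul, mul_smul_comm, re_smul, Pi.star_apply, ← inner_eq_re,
      real_inner_self_eq_norm_sq]
  rw [this]
  refine Finset.sum_pos' (fun i _ => mul_nonneg (hξ i).le (by positivity)) ⟨i, Finset.mem_univ _, ?_⟩
  exact mul_pos (hξ i) (by have := norm_pos_iff.2 hi; positivity)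

theorem diagonal_mul_diagonal_real (ξ ζ : Fin q → ℝ) :
    (diagonal fun i => ξ i • (1 : F)) * (diagonal fun i => ζ i • (1 : F)) =
      diagonal fun i => (ξ i * ζ i) • (1 : F) := by
  rw [diagonal_mul_diagonal]
  congr 1
  ext i
  rw [smul_one_mul, smul_smul]

theorem isPosDef_unitary_conj {u : Matrix (Fin q) (Fin q) F} (hu : u * uᴴ = 1) {ξ : Fin q → ℝ}
    (hξ : ∀ i, 0 < ξ i) : IsPosDef (u * (diagonal fun i => ξ i • (1 : F)) * uᴴ) := by
  have := (isPosDef_diagonal (F := F) hξ).conj (g := uᴴ) (fun z hz h => hz (by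
    rw [← Matrix.one_mul z, ← hu, Matrix.mul_assoc, h, Matrix.mul_zero]))
  rwa [conjTranspose_conjTranspose] at this

/-- Spectral theorem for positive definite matrices. -/
theorem IsPosDef.exists_diagonalization {x : Matrix (Fin q) (Fin q) F} (hx : IsPosDef x) :
    ∃ (u : Matrix (Fin q) (Fin q) F) (ξ : Fin q → ℝ), uᴴ * u = 1 ∧ u * uᴴ = 1 ∧ (∀ i, 0 < ξ i) ∧
      x = u * diagonal (fun i => ξ i • (1 : F)) * uᴴ := by
  obtain ⟨u, ξ, hu, hu', h⟩ := SplitStiefel.exists_diagonalization hx.1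
  refine ⟨u, ξ, hu, hu', fun i => ?_, h⟩
  have h1 := hx.conj (g := u) (fun z hz h => hz (by
    rw [← Matrix.one_mul z, ← hu, Matrix.mul_assoc, h, Matrix.mul_zero]))
  have h2 : uᴴ * x * u = diagonal fun i => ξ i • (1 : F) := by
    rw [h, Matrix.mul_assoc, Matrix.mul_assoc, hu, Matrix.mul_one, ← Matrix.mul_assoc, hu,
      Matrix.one_mul]
  rw [h2] at h1
  have h3 := h1.2 (Pi.single i 1) (by simp)
  rw [mulVec_single_one] at h3
  rw [dotProduct, Finset.sum_eq_single i] at h3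
  · simpa [re_smul_one] using h3
  · intro j _ hj; simp [hj]
  · simp

theorem IsPosDef.exists_sqrt {x : Matrix (Fin q) (Fin q) F} (hx : IsPosDef x) :
    ∃ s : Matrix (Fin q) (Fin q) F, IsPosDef s ∧ s * s = x := by
  obtain ⟨u, ξ, hu, hu', hξ, h⟩ := hx.exists_diagonalization
  refine ⟨u * diagonal (fun i => √(ξ i) • (1 : F)) * uᴴ,
    isPosDef_unitary_conj hu' fun i => Real.sqrt_pos.2 (hξ i), ?_⟩
  have h1 : ∀ d : Matrix (Fin q) (Fin q) F, u * d * uᴴ * (u * d * uᴴ) = u * (d * d) * uᴴ := by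
    intro d
    rw [Matrix.mul_assoc, ← Matrix.mul_assoc uᴴ, ← Matrix.mul_assoc uᴴ, hu, Matrix.one_mul]
    simp only [Matrix.mul_assoc]
  rw [h1, diagonal_mul_diagonal_real, h]
  simp [Real.mul_self_sqrt (hξ _).le]

/-- `s h + h s = 0` has only the trivial Hermitian solution, for `s` positive definite. -/
theorem eq_zero_of_anticomm {s t d : Matrix (Fin q) (Fin q) F} (hs : IsPosDef s)
    (ht : IsPosSemidef t) (hd : dᴴ = d) (h : s * d + d * t = 0) : d = 0 := by
  by_contra hne
  -- Pairing the equation with `d` gives `⟨d, s d⟩ + ⟨d, t d⟩ = 0`, where the first term is positive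
  -- for `d ≠ 0` and the second is nonnegative.
  have h1 := hs.inner_pos hne
  have h2 := ht.inner_nonneg d
  have h3 : inner ℝ d (d * t) = inner ℝ d (t * d) := by
    rw [← inner_conjTranspose, conjTranspose_mul, hd, ht.1]
  have h4 : inner ℝ d (s * d + d * t) = 0 := by rw [h, inner_zero_right]
  rw [inner_add_right, h3] at h4
  linarith

/-- For `d = s - t` one has `s d + d t = s² - t² = 0`, so `eq_zero_of_anticomm` applies. -/
theorem eq_of_sq_eq {s t : Matrix (Fin q) (Fin q) F} (hs : IsPosDef s)
    (ht : IsPosSemidef t) (h : s * s = t * t) : s = t := by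
  refine sub_eq_zero.1 (eq_zero_of_anticomm hs ht (by rw [conjTranspose_sub, hs.1, ht.1]) ?_)
  rw [Matrix.mul_sub, Matrix.sub_mul, h]
  abel

/-- Uniqueness of the positive root identifies the arbitrary choice made in `msqrt`; the later facts
about `msqrt` rest on this. -/
theorem msqrt_sq {s : Matrix (Fin q) (Fin q) F} (hs : IsPosDef s) : msqrt (s * s) = s := by
  have h : ∃ t : Matrix (Fin q) (Fin q) F, IsPosSemidef t ∧ t * t = s * s :=
    ⟨s, hs.isPosSemidef, rfl⟩
  rw [msqrt, dif_pos h]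
  exact (eq_of_sq_eq hs h.choose_spec.1 h.choose_spec.2.symm).symm

theorem isPosDef_msqrt {x : Matrix (Fin q) (Fin q) F} (hx : IsPosDef x) : IsPosDef (msqrt x) := by
  obtain ⟨s, hs, rfl⟩ := hx.exists_sqrt
  rwa [msqrt_sq hs]

theorem msqrt_mul_msqrt {x : Matrix (Fin q) (Fin q) F} (hx : IsPosDef x) :
    msqrt x * msqrt x = x := by
  obtain ⟨s, hs, rfl⟩ := hx.exists_sqrt
  rw [msqrt_sq hs]

theorem IsPosDef.isUnit {x : Matrix (Fin q) (Fin q) F} (hx : IsPosDef x) : IsUnit x := by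
  obtain ⟨u, ξ, hu, hu', hξ, rfl⟩ := hx.exists_diagonalization
  have h1 : ∀ ζ : Fin q → ℝ, (∀ i, ξ i * ζ i = 1) →
      (diagonal fun i => ξ i • (1 : F)) * (diagonal fun i => ζ i • (1 : F)) = 1 := by
    intro ζ h
    rw [diagonal_mul_diagonal_real]
    simp [h]
  have h2 : ∀ ζ : Fin q → ℝ, (∀ i, ζ i * ξ i = 1) →
      (diagonal fun i => ζ i • (1 : F)) * (diagonal fun i => ξ i • (1 : F)) = 1 := by
    intro ζ h
    rw [diagonal_mul_diagonal_real]
    simp [h]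
  have hU : IsUnit u := ⟨⟨u, uᴴ, hu', hu⟩, rfl⟩
  have hU' : IsUnit uᴴ := ⟨⟨uᴴ, u, hu, hu'⟩, rfl⟩
  refine (hU.mul ⟨⟨_, diagonal fun i => (ξ i)⁻¹ • (1 : F), h1 _ fun i => mul_inv_cancel₀ (hξ i).ne',
    h2 _ fun i => inv_mul_cancel₀ (hξ i).ne'⟩, rfl⟩).mul hU'

theorem IsPosDef.mul_inverse {x : Matrix (Fin q) (Fin q) F} (hx : IsPosDef x) :
    x * Ring.inverse x = 1 := Ring.mul_inverse_cancel _ hx.isUnit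

theorem IsPosDef.inverse_mul {x : Matrix (Fin q) (Fin q) F} (hx : IsPosDef x) :
    Ring.inverse x * x = 1 := Ring.inverse_mul_cancel _ hx.isUnit

theorem IsPosDef.inverse {x : Matrix (Fin q) (Fin q) F} (hx : IsPosDef x) :
    IsPosDef (Ring.inverse x) := by
  have hstar : (Ring.inverse x)ᴴ = Ring.inverse x := by
    have h1 : (Ring.inverse x)ᴴ * x = 1 := by
      have := congrArg conjTranspose hx.mul_inverse
      rwa [conjTranspose_mul, hx.1, conjTranspose_one] at this
    calc (Ring.inverse x)ᴴ = (Ring.inverse x)ᴴ * (x * Ring.inverse x) := by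
          rw [hx.mul_inverse, Matrix.mul_one]
      _ = Ring.inverse x := by rw [← Matrix.mul_assoc, h1, Matrix.one_mul]
  have := hx.conj (g := Ring.inverse x) (fun z hz h => hz (by
    rw [← Matrix.one_mul z, ← hx.mul_inverse, Matrix.mul_assoc, h, Matrix.mul_zero]))
  rwa [hstar, hx.inverse_mul, Matrix.one_mul] at this

end PosDef

/-! ### The Jordan determinant on positive definite matrices -/

section JordanDet

variable {F : Type*} [NormedDivisionRing F] [StarRing F] [InnerProductSpace ℝ F]
  [IsRealComplexOrQuaternion F]
variable {q : ℕ}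

theorem mulLeftLin_mul (x y : Matrix (Fin q) (Fin q) F) :
    mulLeftLin (x * y) = mulLeftLin x ∘ₗ mulLeftLin y := by
  refine LinearMap.ext fun ζ => ?_
  simp [mulLeftLin, Matrix.mulVec_mulVec]

/-- With `x = s²` the real determinant is the square of that of `s`, which is nonzero because `s` is
invertible. -/
theorem IsPosDef.det_pos {x : Matrix (Fin q) (Fin q) F} (hx : IsPosDef x) :
    0 < LinearMap.det (mulLeftLin x) := by
  have hne : ∀ y : Matrix (Fin q) (Fin q) F, IsPosDef y → LinearMap.det (mulLeftLin y) ≠ 0 := by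
    intro y hy h
    have h1 : mulLeftLin (1 : Matrix (Fin q) (Fin q) F) = LinearMap.id := by
      refine LinearMap.ext fun ζ => ?_
      simp [mulLeftLin]
    have := congrArg (fun z => LinearMap.det (mulLeftLin z)) hy.mul_inverse
    simp [mulLeftLin_mul, LinearMap.det_comp, h, h1] at this
  obtain ⟨s, hs, rfl⟩ := hx.exists_sqrt
  rw [mulLeftLin_mul, LinearMap.det_comp]
  exact mul_self_pos.2 (hne s hs)

theorem IsPosDef.jdet_pos {x : Matrix (Fin q) (Fin q) F} (hx : IsPosDef x) : 0 < jdet x :=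
  Real.rpow_pos_of_pos hx.det_pos _

theorem IsPosDef.det_eq {x : Matrix (Fin q) (Fin q) F} (hx : IsPosDef x) :
    LinearMap.det (mulLeftLin x) = jdet x ^ scalarDim F := by
  rw [jdet, ← Real.rpow_mul hx.det_pos.le, one_div, inv_mul_cancel₀ scalarDim_pos.ne',
    Real.rpow_one]

theorem jdet_conj {s x : Matrix (Fin q) (Fin q) F} (hs : IsPosDef s) (hx : IsPosDef x) :
    jdet (s * x * s) = jdet s ^ 2 * jdet x := by
  rw [jdet, mulLeftLin_mul, mulLeftLin_mul, LinearMap.det_comp, LinearMap.det_comp,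
    Real.mul_rpow (mul_pos hs.det_pos hx.det_pos).le hs.det_pos.le,
    Real.mul_rpow hs.det_pos.le hx.det_pos.le, ← jdet, ← jdet]
  ring

theorem jdet_one : jdet (1 : Matrix (Fin q) (Fin q) F) = 1 := by
  have := jdet_eq_prod (1 : Matrix (Fin q) (Fin q) F) (by simp) (fun _ => 1) (by simp)
  simpa using this

theorem jdet_sq {s : Matrix (Fin q) (Fin q) F} (hs : IsPosDef s) : jdet (s * s) = jdet s ^ 2 := by
  have := jdet_conj hs isPosDef_one
  rwa [Matrix.mul_one, jdet_one, mul_one] at this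

end JordanDet

/-! ### Smoothness of the Gram map, the square root and the inverse -/

section Smoothness

variable {F : Type*} [NormedDivisionRing F] [StarRing F] [InnerProductSpace ℝ F]
  [IsRealComplexOrQuaternion F]
variable {ι κ μ : Type*} [Fintype ι] [Fintype κ] [Fintype μ]

/-- Matrix multiplication as a continuous real-bilinear map. -/
def mulCLM : Matrix ι κ F →L[ℝ] Matrix κ μ F →L[ℝ] Matrix ι μ F :=
  LinearMap.toContinuousLinearMap
    { toFun := fun a => LinearMap.toContinuousLinearMap (lmul a)
      map_add' := fun a b => by ext1 x; simp [Matrix.add_mul]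
      map_smul' := fun c a => by ext1 x; simp }

/-- Conjugate transposition as a continuous real-linear map. -/
def ctCLM : Matrix ι κ F →L[ℝ] Matrix κ ι F :=
  LinearMap.toContinuousLinearMap
    { toFun := fun a => aᴴ
      map_add' := fun a b => conjTranspose_add a b
      map_smul' := fun c a => by ext; simp }

theorem contDiff_matrix_mul {n : WithTop ℕ∞} :
    ContDiff ℝ n fun p : Matrix ι κ F × Matrix κ μ F => p.1 * p.2 :=
  (mulCLM (F := F)).isBoundedBilinearMap.contDiff

theorem continuous_matrix_mul : Continuous fun p : Matrix ι κ F × Matrix κ μ F => p.1 * p.2 :=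
  (contDiff_matrix_mul (n := 0)).continuous

variable {q : ℕ}

/-- The Hermitian part of a matrix. -/
def hermPart : Matrix (Fin q) (Fin q) F →L[ℝ] Herm F q :=
  LinearMap.toContinuousLinearMap
    { toFun := fun a => ⟨(1 / 2 : ℝ) • (a + aᴴ), by
        change ((1 / 2 : ℝ) • (a + aᴴ))ᴴ = _
        rw [conjTranspose_smul, conjTranspose_add, conjTranspose_conjTranspose, add_comm,
          star_trivial]⟩
      map_add' := fun a b => Subtype.ext (by
        change (1 / 2 : ℝ) • (a + b + (a + b)ᴴ) = (1 / 2 : ℝ) • (a + aᴴ) + (1 / 2 : ℝ) • (b + bᴴ)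
        rw [conjTranspose_add, ← smul_add]
        congr 1
        abel)
      map_smul' := fun c a => Subtype.ext (by
        change (1 / 2 : ℝ) • (c • a + (c • a)ᴴ) = c • ((1 / 2 : ℝ) • (a + aᴴ))
        rw [conjTranspose_smul, star_trivial, ← smul_add, smul_comm]) }

theorem coe_hermPart (a : Matrix (Fin q) (Fin q) F) :
    (hermPart a : Matrix (Fin q) (Fin q) F) = (1 / 2 : ℝ) • (a + aᴴ) := rfl

theorem coe_hermPart_of_herm {a : Matrix (Fin q) (Fin q) F} (h : aᴴ = a) :
    (hermPart a : Matrix (Fin q) (Fin q) F) = a := by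
  rw [coe_hermPart, h, ← two_smul ℝ, smul_smul]
  norm_num

theorem herm_conjTranspose (r : Herm F q) :
    (r : Matrix (Fin q) (Fin q) F)ᴴ = (r : Matrix (Fin q) (Fin q) F) := r.2

theorem hermPart_coe (r : Herm F q) : hermPart (r : Matrix (Fin q) (Fin q) F) = r :=
  Subtype.ext (coe_hermPart_of_herm r.2)

/-- The cone of positive definite matrices, as a subset of the space of Hermitian matrices. -/
def posCone (F : Type*) [NormedDivisionRing F] [StarRing F] [InnerProductSpace ℝ F]
    [IsRealComplexOrQuaternion F] (q : ℕ) : Set (Herm F q) :=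
  {x : Herm F q | IsPosDef (x : Matrix (Fin q) (Fin q) F)}

theorem mem_posCone {r : Herm F q} : r ∈ posCone F q ↔ IsPosDef (r : Matrix (Fin q) (Fin q) F) :=
  Iff.rfl

/-- Positivity of the quadratic form need only be tested on the unit sphere, and compactness of the
sphere makes a condition over all its points open in `r`. -/
theorem isOpen_posCone : IsOpen (posCone F q) := by
  have hset : posCone F q = {r : Herm F q | ∀ z ∈ Metric.sphere (0 : Matrix (Fin q) (Fin 1) F) 1,
      0 < inner ℝ z ((r : Matrix (Fin q) (Fin q) F) * z)} := by
    ext r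
    rw [mem_posCone, isPosDef_iff, and_iff_right (herm_conjTranspose r)]
    refine ⟨fun h z hz => h z ?_, fun h z hz => ?_⟩
    · rintro rfl; simp at hz
    · have hn := norm_pos_iff.2 hz
      have := h (‖z‖⁻¹ • z) (by simp [norm_smul, hn.ne'])
      rw [Matrix.mul_smul, inner_smul_left, inner_smul_right] at this
      have h2 : (0 : ℝ) < ‖z‖⁻¹ := by positivity
      exact pos_of_mul_pos_right (pos_of_mul_pos_right this h2.le) h2.le
  rw [hset, isOpen_iff_eventually]
  intro r hr
  refine (isCompact_sphere _ _).eventually_forall_of_forall_eventually fun z hz => ?_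
  have hc : Continuous fun p : Herm F q × Matrix (Fin q) (Fin 1) F =>
      inner ℝ p.2 ((p.1 : Matrix (Fin q) (Fin q) F) * p.2) :=
    continuous_snd.inner (continuous_matrix_mul.comp
      ((continuous_subtype_val.comp continuous_fst).prodMk continuous_snd))
  exact (isOpen_lt continuous_const hc).mem_nhds (hr z hz)

theorem measurableSet_posCone : MeasurableSet (posCone F q) := isOpen_posCone.measurableSet

/-- The Gram matrix `x* x`. -/
def gram (x : Matrix ι (Fin q) F) : Herm F q :=
  ⟨xᴴ * x, by change (xᴴ * x)ᴴ = _; rw [conjTranspose_mul, conjTranspose_conjTranspose]⟩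

@[simp] theorem coe_gram (x : Matrix ι (Fin q) F) :
    (gram x : Matrix (Fin q) (Fin q) F) = xᴴ * x := rfl

/-- Writes `gram`, which takes values in a subspace, as a composition of linear and bilinear maps
into that subspace, so that smoothness and the derivative follow formally. -/
theorem gram_eq_hermPart (x : Matrix ι (Fin q) F) : gram x = hermPart (mulCLM (ctCLM x) x) :=
  (hermPart_coe (gram x)).symm

theorem contDiff_gram {n : WithTop ℕ∞} : ContDiff ℝ n (gram : Matrix ι (Fin q) F → Herm F q) := by
  rw [funext (gram_eq_hermPart (F := F) (ι := ι) (q := q))]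
  exact (hermPart (F := F) (q := q)).contDiff.comp (contDiff_matrix_mul.comp (ctCLM.contDiff.prodMk contDiff_id))

theorem continuous_gram : Continuous (gram : Matrix ι (Fin q) F → Herm F q) :=
  (contDiff_gram (n := 0)).continuous

/-- The derivative `h ↦ x* h + h* x` of the Gram matrix. -/
def gramDeriv (x : Matrix ι (Fin q) F) : Matrix ι (Fin q) F →L[ℝ] Herm F q :=
  (2 : ℝ) • hermPart ∘L mulCLM (ctCLM x)

theorem coe_gramDeriv (x h : Matrix ι (Fin q) F) :
    (gramDeriv x h : Matrix (Fin q) (Fin q) F) = xᴴ * h + hᴴ * x := by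
  change (2 : ℝ) • ((1 / 2 : ℝ) • (xᴴ * h + (xᴴ * h)ᴴ)) = _
  rw [smul_smul, conjTranspose_mul, conjTranspose_conjTranspose]
  norm_num

theorem hasStrictFDerivAt_gram (x : Matrix ι (Fin q) F) :
    HasStrictFDerivAt gram (gramDeriv x) x := by
  rw [funext (gram_eq_hermPart (F := F) (ι := ι) (q := q))]
  have h := (mulCLM (F := F) (ι := Fin q) (κ := ι) (μ := Fin q)).hasStrictFDerivAt_of_bilinear
    (ctCLM (F := F) (ι := ι) (κ := Fin q)).hasStrictFDerivAt (hasStrictFDerivAt_id x)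
  have h2 := (hermPart (F := F) (q := q)).hasStrictFDerivAt.comp x h
  refine h2.congr_fderiv ?_
  ext1 y
  refine Subtype.ext ?_
  rw [coe_gramDeriv]
  change (1 / 2 : ℝ) • ((xᴴ * y + yᴴ * x) + (xᴴ * y + yᴴ * x)ᴴ) = _
  rw [conjTranspose_add, conjTranspose_mul, conjTranspose_mul, conjTranspose_conjTranspose,
    conjTranspose_conjTranspose, add_comm (yᴴ * x), ← two_smul ℝ, smul_smul]
  norm_num

/-- The positive square root is smooth on the cone. -/
theorem contDiffAt_msqrt {r : Herm F q} (hr : r ∈ posCone F q) :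
    ContDiffAt ℝ ∞ (fun r : Herm F q => msqrt (r : Matrix (Fin q) (Fin q) F)) r := by
  obtain ⟨s, hs, hsr⟩ := IsPosDef.exists_sqrt hr
  set s' : Herm F q := ⟨s, hs.1⟩ with hs'
  set f : Herm F q → Herm F q := fun t => gram (t : Matrix (Fin q) (Fin q) F) with hf
  have hfc : ContDiff ℝ ∞ f := contDiff_gram.comp (Herm F q).subtypeL.contDiff
  -- The inverse function theorem for squaring on `H_q`, written as `t ↦ t* t`. Its derivative at
  -- `s` is `h ↦ s h + h s`, which is injective by `eq_zero_of_anticomm`.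
  set D : Herm F q →L[ℝ] Herm F q := gramDeriv s ∘L (Herm F q).subtypeL with hD
  have hfd : HasFDerivAt f D s' :=
    ((hasStrictFDerivAt_gram s).comp s' (Herm F q).subtypeL.hasStrictFDerivAt).hasFDerivAt
  have hinj : Function.Injective D := by
    refine (injective_iff_map_eq_zero D).2 fun h hh => ?_
    have h1 : (D h : Matrix (Fin q) (Fin q) F) = 0 := by rw [hh]; rfl
    have h2 : (D h : Matrix (Fin q) (Fin q) F) = sᴴ * h + (h : Matrix (Fin q) (Fin q) F)ᴴ * s :=
      coe_gramDeriv s h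
    rw [h1, hs.1, herm_conjTranspose] at h2
    exact Subtype.ext (eq_zero_of_anticomm hs hs.isPosSemidef (herm_conjTranspose h) h2.symm)
  set D' : Herm F q ≃L[ℝ] Herm F q :=
    (LinearEquiv.ofInjectiveEndo (D : Herm F q →ₗ[ℝ] Herm F q) hinj).toContinuousLinearEquiv
  have hD' : (D' : Herm F q →L[ℝ] Herm F q) = D := by ext1 x; rfl
  have hfd' : HasFDerivAt f (D' : Herm F q →L[ℝ] Herm F q) s' := by rwa [hD']
  have hfs : f s' = r := Subtype.ext (by
    change sᴴ * s = _
    rw [hs.1, hsr])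
  have hloc := hfc.contDiffAt.to_localInverse hfd' (by simp)
  have hst := hfc.contDiffAt.hasStrictFDerivAt' hfd' (by simp)
  have happ := hfc.contDiffAt.localInverse_apply_image hfd' (by simp)
  set g := hfc.contDiffAt.localInverse hfd' (by simp) with hg
  have hri : ∀ᶠ y in nhds (f s'), f (g y) = y := hst.eventually_right_inverse
  have hpos : ∀ᶠ y in nhds (f s'), g y ∈ posCone F q := by
    refine hloc.continuousAt.eventually_mem (isOpen_posCone.mem_nhds ?_)
    rw [happ]
    exact hs
  rw [hfs] at hri hpos hloc
  -- Near `r` the smooth local inverse stays in the open cone, so by uniqueness of the positive root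
  -- it coincides with `msqrt`.
  refine ((Herm F q).subtypeL.contDiff.contDiffAt.comp r hloc).congr_of_eventuallyEq ?_
  filter_upwards [hri, hpos] with y hy1 hy2
  have hy2' : IsPosDef (g y : Matrix (Fin q) (Fin q) F) := hy2
  have : (y : Matrix (Fin q) (Fin q) F) = (g y : Matrix (Fin q) (Fin q) F) * g y := by
    conv_lhs => rw [← hy1]
    change (g y : Matrix (Fin q) (Fin q) F)ᴴ * g y = _
    rw [hy2'.1]
  rw [this, msqrt_sq hy2']
  rfl

theorem continuousOn_msqrt :
    ContinuousOn (fun r : Herm F q => msqrt (r : Matrix (Fin q) (Fin q) F)) (posCone F q) :=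
  fun _ hr => (contDiffAt_msqrt hr).continuousAt.continuousWithinAt

/-- `x ↦ x s⁻¹` depends smoothly on the positive definite matrix `s`. -/
theorem contDiffAt_mul_inverse {s : Matrix (Fin q) (Fin q) F} (hs : IsPosDef s)
    (x : Matrix ι (Fin q) F) :
    ContDiffAt ℝ ∞ (fun p : Matrix ι (Fin q) F × Matrix (Fin q) (Fin q) F =>
      p.1 * Ring.inverse p.2) (x, s) := by
  -- `x s⁻¹` is the inverse of the operator `x ↦ x s` applied to `x`, and inversion of continuous
  -- linear maps is smooth at invertible ones.
  set R : Matrix (Fin q) (Fin q) F →L[ℝ] Matrix ι (Fin q) F →L[ℝ] Matrix ι (Fin q) F :=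
    (mulCLM (F := F)).flip with hR
  have hunit : ∀ t : Matrix (Fin q) (Fin q) F, IsUnit t →
      ∃ e : Matrix ι (Fin q) F ≃L[ℝ] Matrix ι (Fin q) F, (e : _ →L[ℝ] _) = R t ∧
        ∀ x, e.symm x = x * Ring.inverse t := by
    intro t ht
    refine ⟨ContinuousLinearEquiv.equivOfInverse (R t) (R (Ring.inverse t)) (fun x => ?_)
      (fun x => ?_), by ext1; rfl, fun x => rfl⟩
    · change x * t * Ring.inverse t = x
      rw [Matrix.mul_assoc, Ring.mul_inverse_cancel _ ht, Matrix.mul_one]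
    · change x * Ring.inverse t * t = x
      rw [Matrix.mul_assoc, Ring.inverse_mul_cancel _ ht, Matrix.mul_one]
  obtain ⟨e, he, -⟩ := hunit s hs.isUnit
  have h1 : ContDiffAt ℝ ∞ (fun t => ContinuousLinearMap.inverse (R t)) s := by
    have hR' : ContDiff ℝ ∞ fun t => R t := ContinuousLinearMap.contDiff (𝕜 := ℝ)
      (F := Matrix ι (Fin q) F →L[ℝ] Matrix ι (Fin q) F) R
    have he' : ContDiffAt ℝ ∞ ContinuousLinearMap.inverse (R s) := by
      rw [← he]
      exact contDiffAt_map_inverse e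
    exact he'.comp s hR'.contDiffAt
  have h2 : ContDiffAt ℝ ∞ (fun p : Matrix ι (Fin q) F × Matrix (Fin q) (Fin q) F =>
      ContinuousLinearMap.inverse (R p.2) p.1) (x, s) :=
    ContDiffAt.clm_apply (h1.comp (x, s) contDiff_snd.contDiffAt) contDiff_fst.contDiffAt
  refine h2.congr_of_eventuallyEq ?_
  -- Invertible operators form an open set, so right multiplication by `t` is invertible for `t`
  -- near `s`. Surjectivity gives `y t = 1`, and injectivity then gives `t y = 1`.
  have hev : ∀ᶠ t in nhds s, IsUnit t := by
    set R' : Matrix (Fin q) (Fin q) F →L[ℝ] Matrix (Fin q) (Fin q) F →L[ℝ] Matrix (Fin q) (Fin q) F :=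
      (mulCLM (F := F)).flip with hR'
    have hs1 : s * Ring.inverse s = 1 := hs.mul_inverse
    have hs2 : Ring.inverse s * s = 1 := hs.inverse_mul
    let e₀ : Matrix (Fin q) (Fin q) F ≃L[ℝ] Matrix (Fin q) (Fin q) F :=
      ContinuousLinearEquiv.equivOfInverse (R' s) (R' (Ring.inverse s))
        (fun x => by
          change x * s * Ring.inverse s = x
          rw [Matrix.mul_assoc, hs1, Matrix.mul_one])
        (fun x => by
          change x * Ring.inverse s * s = x
          rw [Matrix.mul_assoc, hs2, Matrix.mul_one])
    have he₀ : (e₀ : _ →L[ℝ] _) = R' s := by ext1; rfl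
    have h3 := e₀.nhds
    rw [he₀] at h3
    filter_upwards [R'.continuous.continuousAt.eventually_mem h3] with t ht
    obtain ⟨e₁, he₁⟩ := ht
    have happ : ∀ x, e₁ x = x * t := fun x => congrArg (fun f => f x) he₁
    obtain ⟨y, hy⟩ := e₁.surjective 1
    rw [happ] at hy
    refine ⟨⟨t, y, e₁.injective ?_, hy⟩, rfl⟩
    rw [happ, happ, Matrix.mul_assoc, hy, Matrix.mul_one, Matrix.one_mul]
  filter_upwards [continuous_snd.continuousAt.eventually hev] with p hp
  obtain ⟨e', he', he''⟩ := hunit p.2 hp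
  rw [← he', ContinuousLinearMap.inverse_equiv, ContinuousLinearEquiv.coe_coe, he'']

end Smoothness

/-! ### Dimension of `H_q`, Jacobians of congruences and right multiplications -/

section Determinants

variable {F : Type*} [NormedDivisionRing F] [StarRing F] [InnerProductSpace ℝ F]
  [IsRealComplexOrQuaternion F]
variable {q : ℕ}

theorem card_pairs_lt (q : ℕ) :
    (Fintype.card {p : Fin q × Fin q // p.1 < p.2} : ℝ) = q * (q - 1) / 2 := by
  have h1 : Fintype.card {p : Fin q × Fin q // p.1 < p.2} =
      Fintype.card {p : Fin q × Fin q // p.2 < p.1} :=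
    Fintype.card_congr ((Equiv.prodComm _ _).subtypeEquiv fun p => Iff.rfl)
  have h2 : Fintype.card {p : Fin q × Fin q // p.1 = p.2} = q := by
    rw [Fintype.card_congr (⟨fun p => p.1.1, fun i => ⟨(i, i), rfl⟩, fun ⟨⟨i, j⟩, h⟩ => by
      cases h; rfl, fun i => rfl⟩ : {p : Fin q × Fin q // p.1 = p.2} ≃ Fin q), Fintype.card_fin]
  have h3 : Fintype.card {p : Fin q × Fin q // p.1 < p.2} +
      Fintype.card {p : Fin q × Fin q // p.2 < p.1} +
      Fintype.card {p : Fin q × Fin q // p.1 = p.2} = q * q := by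
    have h4 : Fintype.card (Fin q × Fin q) = q * q := by simp
    rw [← h4]
    simp only [Fintype.card_subtype]
    rw [← Finset.card_union_of_disjoint, ← Finset.card_union_of_disjoint, ← Finset.card_univ]
    · congr 1
      ext p
      rcases lt_trichotomy p.1 p.2 with h | h | h <;> simp [h]
    · rw [Finset.disjoint_left]
      intro p hp hp'
      simp only [Finset.mem_union, Finset.mem_filter, Finset.mem_univ, true_and] at hp hp'
      omega
    · rw [Finset.disjoint_left]
      intro p hp hp'
      simp only [Finset.mem_filter, Finset.mem_univ, true_and] at hp hp'
      omega
  rw [← h1, h2] at h3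
  have : (2 * (Fintype.card {p : Fin q × Fin q // p.1 < p.2} : ℝ)) + q = q * q := by
    rw [two_mul]; exact_mod_cast h3
  linarith

/-- Coordinates on the space of Hermitian matrices. -/
def hermEquiv (F : Type*) [NormedDivisionRing F] [StarRing F] [InnerProductSpace ℝ F]
    [IsRealComplexOrQuaternion F] (q : ℕ) :
    Herm F q ≃ₗ[ℝ] (Fin q → ℝ) × ({p : Fin q × Fin q // p.1 < p.2} → F) where
  toFun x := (fun i => re ((x : Matrix (Fin q) (Fin q) F) i i),
    fun p => (x : Matrix (Fin q) (Fin q) F) p.1.1 p.1.2)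
  map_add' x y := by ext i <;> simp [re_add]
  map_smul' c x := by ext i <;> simp [re_smul]
  invFun v := ⟨Matrix.of fun i j => if h : i < j then v.2 ⟨(i, j), h⟩ else
    if h : j < i then star (v.2 ⟨(j, i), h⟩) else v.1 i • 1, by
      change _ᴴ = _
      ext i j
      rcases lt_trichotomy i j with h | h | h
      · simp [h, h.not_gt]
      · subst h; simp
      · simp [h, h.not_gt]⟩
  left_inv x := by
    refine Subtype.ext (Matrix.ext fun i j => ?_)
    have hx : ∀ i j, star ((x : Matrix (Fin q) (Fin q) F) j i) = (x : Matrix (Fin q) (Fin q) F) i j :=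
      fun i j => congrFun (congrFun (herm_conjTranspose x) i) j
    rcases lt_trichotomy i j with h | h | h
    · simp [h]
    · subst h; simpa using (eq_re_smul_one (hx i i)).symm
    · simp [h, h.not_gt, hx]
  right_inv v := by
    ext i
    · simp [re_smul_one]
    · have := i.2
      simp [this]

theorem finrank_herm : (Module.finrank ℝ (Herm F q) : ℝ) = hermDim F q := by
  rw [LinearEquiv.finrank_eq (hermEquiv F q), Module.finrank_prod, Module.finrank_pi,
    Module.finrank_pi_fintype]
  simp only [Finset.sum_const, Finset.card_univ, Fintype.card_fin, smul_eq_mul]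
  push_cast
  rw [card_pairs_lt, hermDim, scalarDim]
  ring

/-- The congruence `x ↦ g x g*` of the space of Hermitian matrices. -/
def congruence (g : Matrix (Fin q) (Fin q) F) : Herm F q →ₗ[ℝ] Herm F q where
  toFun x := ⟨g * (x : Matrix (Fin q) (Fin q) F) * gᴴ, by
    change _ᴴ = _
    rw [conjTranspose_mul, conjTranspose_mul, conjTranspose_conjTranspose, herm_conjTranspose,
      Matrix.mul_assoc]⟩
  map_add' x y := Subtype.ext (by simp [Matrix.mul_add, Matrix.add_mul])
  map_smul' c x := Subtype.ext (by simp)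

@[simp] theorem coe_congruence (g : Matrix (Fin q) (Fin q) F) (x : Herm F q) :
    (congruence g x : Matrix (Fin q) (Fin q) F) = g * (x : Matrix (Fin q) (Fin q) F) * gᴴ := rfl

theorem congruence_mul (g h : Matrix (Fin q) (Fin q) F) :
    congruence (g * h) = congruence g ∘ₗ congruence h := by
  refine LinearMap.ext fun x => Subtype.ext ?_
  simp [Matrix.mul_assoc]

theorem congruence_one : congruence (1 : Matrix (Fin q) (Fin q) F) = LinearMap.id := by
  refine LinearMap.ext fun x => Subtype.ext ?_
  simp

/-- The determinant of the congruence by a diagonal matrix, as a multiplicative function. -/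
def diagDet (F : Type*) [NormedDivisionRing F] [StarRing F] [InnerProductSpace ℝ F]
    [IsRealComplexOrQuaternion F] (q : ℕ) : (Fin q → ℝ) →* ℝ where
  toFun ξ := LinearMap.det (congruence (diagonal fun i => ξ i • (1 : F)))
  map_one' := by simp [congruence_one]
  map_mul' ξ ζ := by
    rw [← LinearMap.det_comp, ← congruence_mul, diagonal_mul_diagonal_real]
    rfl

theorem diagDet_apply (ξ : Fin q → ℝ) :
    diagDet F q ξ = LinearMap.det (congruence (diagonal fun i => ξ i • (1 : F))) := rfl

theorem diagDet_const (t : ℝ) : diagDet F q (fun _ => t) = t ^ (2 * Module.finrank ℝ (Herm F q)) := by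
  have : congruence (diagonal fun _ : Fin q => t • (1 : F)) = (t ^ 2) • LinearMap.id := by
    refine LinearMap.ext fun x => Subtype.ext ?_
    rw [coe_congruence, diagonal_conjTranspose_real fun _ => t]
    ext i j
    simp [smul_smul, sq]
  rw [diagDet_apply, this, LinearMap.det_smul, LinearMap.det_id, mul_one, pow_mul]

theorem diagDet_comp (ξ : Fin q → ℝ) (σ : Equiv.Perm (Fin q)) :
    diagDet F q (ξ ∘ σ) = diagDet F q ξ := by
  let e : Herm F q ≃ₗ[ℝ] Herm F q :=
    { toFun := fun x => ⟨(x : Matrix (Fin q) (Fin q) F).submatrix σ σ, by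
        change _ᴴ = _
        rw [conjTranspose_submatrix, herm_conjTranspose]⟩
      invFun := fun x => ⟨(x : Matrix (Fin q) (Fin q) F).submatrix σ.symm σ.symm, by
        change _ᴴ = _
        rw [conjTranspose_submatrix, herm_conjTranspose]⟩
      map_add' := fun x y => rfl
      map_smul' := fun c x => rfl
      left_inv := fun x => Subtype.ext (by ext; simp)
      right_inv := fun x => Subtype.ext (by ext; simp) }
  rw [diagDet_apply, diagDet_apply,
    ← LinearMap.det_conj (congruence (diagonal fun i => ξ i • (1 : F))) e]
  congr 1
  refine LinearMap.ext fun x => Subtype.ext ?_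
  rw [coe_congruence, diagonal_conjTranspose_real (ξ ∘ σ)]
  change _ = (((congruence (diagonal fun i => ξ i • (1 : F))) (e.symm x) :
    Herm F q) : Matrix (Fin q) (Fin q) F).submatrix σ σ
  rw [coe_congruence, diagonal_conjTranspose_real ξ]
  ext i j
  have : (e.symm x : Matrix (Fin q) (Fin q) F) (σ i) (σ j) = (x : Matrix (Fin q) (Fin q) F) i j := by
    change (x : Matrix (Fin q) (Fin q) F) (σ.symm (σ i)) (σ.symm (σ j)) = _
    simp
  simp [this]

/-- Avoids computing the congruence entry by entry. By multiplicativity it suffices to scale one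
coordinate by `t`; by permutation invariance all coordinates give the same value, and the product of
these `q` values is the determinant `t^{2n}` of the scalar `t²` on `H_q`. -/
theorem diagDet_eq {ξ : Fin q → ℝ} (hξ : ∀ i, 0 < ξ i) :
    diagDet F q ξ = (∏ i, ξ i) ^ (2 * hermDim F q / q) := by
  have h1 : ∀ (i : Fin q) (t : ℝ), 0 < t →
      diagDet F q (Pi.mulSingle i t) = t ^ (2 * hermDim F q / q) := by
    intro i t ht
    have hq : (q : ℝ) ≠ 0 := by
      have := i.pos
      positivity
    -- Only the `q`-th power of the value is known; nonnegativity, from writing `t` as a square,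
    -- makes its root unambiguous.
    have hnn : ∀ t, 0 < t → 0 ≤ diagDet F q (Pi.mulSingle i t) := by
      intro t ht
      have : (Pi.mulSingle i t : Fin q → ℝ) = Pi.mulSingle i (√t) * Pi.mulSingle i (√t) := by
        rw [← Pi.mulSingle_mul, Real.mul_self_sqrt ht.le]
      rw [this, map_mul]
      exact mul_self_nonneg _
    have hperm : ∀ j, diagDet F q (Pi.mulSingle j t) = diagDet F q (Pi.mulSingle i t) := by
      intro j
      rw [← diagDet_comp (Pi.mulSingle i t) (Equiv.swap i j)]
      congr 1
      ext l
      simp only [Function.comp, Pi.mulSingle_apply]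
      congr 1
      rw [eq_iff_iff, Equiv.swap_apply_eq_iff, Equiv.swap_apply_left]
    have hpow : diagDet F q (Pi.mulSingle i t) ^ q = t ^ (2 * Module.finrank ℝ (Herm F q)) := by
      rw [← diagDet_const, ← Finset.univ_prod_mulSingle (fun _ : Fin q => t), map_prod]
      simp [hperm]
    rw [← Real.pow_rpow_inv_natCast (hnn t ht) (by exact_mod_cast hq : q ≠ 0), hpow,
      ← Real.rpow_natCast, ← Real.rpow_mul ht.le]
    push_cast
    rw [finrank_herm]
    congr 1
  rw [← Finset.univ_prod_mulSingle ξ, map_prod, Finset.univ_prod_mulSingle,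
    ← Real.finsetProd_rpow _ _ fun i _ => (hξ i).le]
  exact Finset.prod_congr rfl fun i _ => h1 i _ (hξ i)

/-- After diagonalization the congruences by `u` and `u*` are mutually inverse and cancel. This
makes `Δ(r)^{-n/q} dr` invariant under congruences. -/
theorem det_congruence {s : Matrix (Fin q) (Fin q) F} (hs : IsPosDef s) :
    LinearMap.det (congruence s) = jdet s ^ (2 * hermDim F q / q) := by
  obtain ⟨u, ξ, hu, hu', hξ, rfl⟩ := hs.exists_diagonalization
  have h : LinearMap.det (congruence u) * LinearMap.det (congruence uᴴ) = 1 := by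
    rw [← LinearMap.det_comp, ← congruence_mul, hu', congruence_one, LinearMap.det_id]
  rw [congruence_mul, congruence_mul, LinearMap.det_comp, LinearMap.det_comp, mul_right_comm, h,
    one_mul, jdet_eq_prod u hu' ξ hξ, ← diagDet_apply, diagDet_eq hξ]

/-- Right multiplication acts on each row separately, and conjugation of scalars turns the action on
a row into left multiplication by `s* = s` on a column, whose determinant is `Δ(s)^d`. -/
theorem det_rmul {ι : Type*} [Fintype ι] {s : Matrix (Fin q) (Fin q) F} (hs : IsPosDef s) :
    LinearMap.det (rmul s : Matrix ι (Fin q) F →ₗ[ℝ] Matrix ι (Fin q) F) =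
      jdet s ^ (scalarDim F * Fintype.card ι) := by
  let f : (Fin q → F) →ₗ[ℝ] (Fin q → F) :=
    { toFun := fun ξ => ξ ᵥ* s
      map_add' := fun ξ ζ => Matrix.add_vecMul s ξ ζ
      map_smul' := fun c ξ => Matrix.smul_vecMul c ξ s }
  let e : (Fin q → F) ≃ₗ[ℝ] (Fin q → F) :=
    { toFun := star
      invFun := star
      map_add' := star_add
      map_smul' := fun c ξ => by ext; simp
      left_inv := star_star
      right_inv := star_star }
  have hf : LinearMap.det f = LinearMap.det (mulLeftLin s) := by
    rw [← LinearMap.det_conj (mulLeftLin s) e]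
    congr 1
    refine LinearMap.ext fun ξ => ?_
    change ξ ᵥ* s = star (s *ᵥ star ξ)
    rw [star_mulVec, star_star, hs.1]
  have h2 : (rmul s : Matrix ι (Fin q) F →ₗ[ℝ] Matrix ι (Fin q) F) =
      LinearMap.pi fun i => f ∘ₗ LinearMap.proj i := by
    refine LinearMap.ext fun x => ?_
    rfl
  have h3 : LinearMap.det (rmul s : Matrix ι (Fin q) F →ₗ[ℝ] Matrix ι (Fin q) F) =
      LinearMap.det (LinearMap.pi fun i : ι => f ∘ₗ LinearMap.proj i) := by
    rw [h2]; rfl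
  rw [h3, LinearMap.det_pi]
  rw [Finset.prod_const, Finset.card_univ, hf, hs.det_eq, Real.rpow_mul hs.jdet_pos.le,
    Real.rpow_natCast]

theorem lintegral_eq_rmul {ι : Type*} [Fintype ι] {s : Matrix (Fin q) (Fin q) F} (hs : IsPosDef s)
    {f : Matrix ι (Fin q) F → ℝ≥0∞} (hf : Measurable f) :
    ∫⁻ x, f x = ENNReal.ofReal (jdet s ^ (scalarDim F * Fintype.card ι)) *
      ∫⁻ x : Matrix ι (Fin q) F, f (x * s) := by
  have hd := det_rmul (ι := ι) hs
  have hpos : 0 < jdet s ^ (scalarDim F * Fintype.card ι) := Real.rpow_pos_of_pos hs.jdet_pos _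
  have h := Measure.map_linearMap_addHaar_eq_smul_addHaar (volume : Measure (Matrix ι (Fin q) F))
    (f := rmul s) (by rw [hd]; exact hpos.ne')
  have h2 : ∫⁻ x : Matrix ι (Fin q) F, f (x * s) =
      ∫⁻ x, f x ∂(Measure.map (rmul s) (volume : Measure (Matrix ι (Fin q) F))) :=
    (lintegral_map hf (rmul s).continuous_of_finiteDimensional.measurable).symm
  rw [h2, h, lintegral_smul_measure, hd, abs_inv, abs_of_pos hpos, smul_eq_mul, ← mul_assoc,
    ← ENNReal.ofReal_mul hpos.le, mul_inv_cancel₀ hpos.ne', ENNReal.ofReal_one, one_mul]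

theorem lintegral_eq_congruence {s : Matrix (Fin q) (Fin q) F} (hs : IsPosDef s)
    {f : Herm F q → ℝ≥0∞} (hf : Measurable f) :
    ∫⁻ x, f x = ENNReal.ofReal (jdet s ^ (2 * hermDim F q / q)) *
      ∫⁻ x : Herm F q, f (congruence s x) := by
  have hd := det_congruence hs
  have hpos : 0 < jdet s ^ (2 * hermDim F q / q) := Real.rpow_pos_of_pos hs.jdet_pos _
  have h := Measure.map_linearMap_addHaar_eq_smul_addHaar (volume : Measure (Herm F q))
    (f := congruence s) (by rw [hd]; exact hpos.ne')
  have h2 : ∫⁻ x : Herm F q, f (congruence s x) =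
      ∫⁻ x, f x ∂(Measure.map (congruence s) (volume : Measure (Herm F q))) :=
    (lintegral_map hf (congruence s).continuous_of_finiteDimensional.measurable).symm
  rw [h2, h, lintegral_smul_measure, hd, abs_inv, abs_of_pos hpos, smul_eq_mul, ← mul_assoc,
    ← ENNReal.ofReal_mul hpos.le, mul_inv_cancel₀ hpos.ne', ENNReal.ofReal_one, one_mul]

theorem congruence_mem_posCone_iff {s : Matrix (Fin q) (Fin q) F} (hs : IsPosDef s) {r : Herm F q} :
    congruence s r ∈ posCone F q ↔ r ∈ posCone F q := by
  simp only [mem_posCone, coe_congruence, hs.1]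
  refine ⟨fun h => ?_, fun h => h.conj_herm hs⟩
  have := h.conj_herm hs.inverse
  rwa [Matrix.mul_assoc, Matrix.mul_assoc, hs.mul_inverse, Matrix.mul_one, ← Matrix.mul_assoc,
    hs.inverse_mul, Matrix.one_mul] at this

theorem continuous_jdet : Continuous fun r : Matrix (Fin q) (Fin q) F => jdet r := by
  have h : Continuous fun r : Matrix (Fin q) (Fin q) F => LinearMap.det (mulLeftLin r) := by
    let b := Module.finBasis ℝ (Fin q → F)
    let L : Matrix (Fin q) (Fin q) F →ₗ[ℝ] Matrix (Fin (Module.finrank ℝ (Fin q → F)))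
        (Fin (Module.finrank ℝ (Fin q → F))) ℝ :=
      (LinearMap.toMatrix b b).toLinearMap ∘ₗ
        { toFun := fun r => mulLeftLin r
          map_add' := fun r t => LinearMap.ext fun ξ => Matrix.add_mulVec r t ξ
          map_smul' := fun c r => LinearMap.ext fun ξ => Matrix.smul_mulVec c r ξ }
    have h1 : (fun r : Matrix (Fin q) (Fin q) F => LinearMap.det (mulLeftLin r)) =
        fun r => (L r).det := by
      ext r
      exact (LinearMap.det_toMatrix b _).symm
    rw [h1]
    exact Continuous.matrix_det L.continuous_of_finiteDimensional
  -- The exponent `1/d` is positive, so zeros of the real determinant do no harm.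
  refine h.rpow_const fun r => Or.inr ?_
  have := scalarDim_pos (F := F)
  positivity

end Determinants

/-! ### Uniqueness of Laplace transforms -/

section LaplaceUniqueness

open ProbabilityTheory

variable {E : Type*} [NormedAddCommGroup E] [InnerProductSpace ℝ E] [MeasurableSpace E]
  [BorelSpace E] [SecondCountableTopology E] [CompleteSpace E]

/-- Finite measures whose Laplace transforms are finite and agree near the origin are equal. -/
theorem measure_ext_of_laplace {μ ν : Measure E} [IsFiniteMeasure μ] [IsFiniteMeasure ν]
    {ε : ℝ} (hε : 0 < ε)
    (hfin : ∀ b : E, ‖b‖ < ε → ∫⁻ x, ENNReal.ofReal (Real.exp (inner ℝ b x)) ∂μ ≠ ⊤)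
    (heq : ∀ b : E, ‖b‖ < ε → ∫⁻ x, ENNReal.ofReal (Real.exp (inner ℝ b x)) ∂μ =
      ∫⁻ x, ENNReal.ofReal (Real.exp (inner ℝ b x)) ∂ν) : μ = ν := by
  refine Measure.ext_of_charFun (funext fun t => ?_)
  set X : E → ℝ := fun x => inner ℝ x t with hX
  have hXm : Continuous X := continuous_id.inner continuous_const
  -- A width for which `r • t` stays in the `ε`-ball; the `+ 1` covers `t = 0`.
  set δ : ℝ := ε / (‖t‖ + 1) with hδ
  have hδ0 : 0 < δ := by positivity
  have hsmall : ∀ r ∈ Set.Ioo (-δ) δ, ‖r • t‖ < ε := by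
    intro r hr
    have h1 : |r| < δ := abs_lt.2 hr
    rw [norm_smul, Real.norm_eq_abs]
    have h2 : |r| * (‖t‖ + 1) < ε := by rwa [hδ, lt_div_iff₀ (by positivity)] at h1
    nlinarith [abs_nonneg r]
  have hexp : ∀ r x, r * X x = inner ℝ (r • t) x := fun r x => by
    rw [inner_smul_left, real_inner_comm]; simp [hX]
  have hint : ∀ (ρ : Measure E), (∀ b : E, ‖b‖ < ε →
      ∫⁻ x, ENNReal.ofReal (Real.exp (inner ℝ b x)) ∂ρ ≠ ⊤) →
      Set.Ioo (-δ) δ ⊆ interior (integrableExpSet X ρ) := by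
    intro ρ h
    refine isOpen_Ioo.subset_interior_iff.2 fun r hr => ?_
    change Integrable _ ρ
    refine ⟨by fun_prop, ?_⟩
    rw [hasFiniteIntegral_iff_ofReal (ae_of_all _ fun x => (Real.exp_pos _).le)]
    simp only [hexp]
    exact lt_top_iff_ne_top.2 (h _ (hsmall r hr))
  have hμ := hint μ hfin
  have hν := hint ν fun b hb => heq b hb ▸ hfin b hb
  -- On this vertical strip both complex moment generating functions of `⟨·, t⟩` are analytic. They
  -- agree on its real points, hence on the whole strip.
  set S : Set ℂ := {z | z.re ∈ Set.Ioo (-δ) δ} with hS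
  have hSpre : IsPreconnected S :=
    ((convex_Ioo (-δ) δ).linear_preimage Complex.reLm).isPreconnected
  have hEq : Set.EqOn (complexMGF X μ) (complexMGF X ν) S := by
    refine AnalyticOnNhd.eqOn_of_preconnected_of_frequently_eq
      (analyticOnNhd_complexMGF.mono fun z hz => hμ hz)
      (analyticOnNhd_complexMGF.mono fun z hz => hν hz) hSpre (z₀ := 0)
      (by simp [hS, hδ0]) ?_
    have h0 : ∃ᶠ r : ℝ in nhdsWithin 0 {0}ᶜ, complexMGF X μ (r : ℂ) = complexMGF X ν (r : ℂ) := by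
      refine Filter.Eventually.frequently ?_
      have : ∀ᶠ r : ℝ in nhdsWithin 0 {0}ᶜ, r ∈ Set.Ioo (-δ) δ :=
        nhdsWithin_le_nhds (Ioo_mem_nhds (by simpa using hδ0) hδ0)
      filter_upwards [this] with r hr
      rw [complexMGF_ofReal, complexMGF_ofReal, mgf, mgf,
        integral_eq_lintegral_of_nonneg_ae (ae_of_all _ fun x => (Real.exp_pos _).le) (by fun_prop),
        integral_eq_lintegral_of_nonneg_ae (ae_of_all _ fun x => (Real.exp_pos _).le) (by fun_prop)]
      simp only [hexp]
      rw [heq _ (hsmall r hr)]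
    have ht : Filter.Tendsto (fun r : ℝ => (r : ℂ)) (nhdsWithin 0 {0}ᶜ) (nhdsWithin 0 {0}ᶜ) := by
      refine tendsto_nhdsWithin_iff.2 ⟨?_, ?_⟩
      · exact (Complex.continuous_ofReal.tendsto' 0 0 rfl).mono_left nhdsWithin_le_nhds
      · filter_upwards [self_mem_nhdsWithin] with r hr
        simpa using hr
    exact ht.frequently h0
  -- At `z = i` the moment generating functions are the characteristic functions at `t`.
  have hI := hEq (show Complex.I ∈ S by simp [hS, hδ0])
  rw [charFun_apply, charFun_apply]
  simp only [complexMGF] at hI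
  simpa only [mul_comm] using hI

end LaplaceUniqueness

/-! ### Gaussian integrals and the gamma function of the cone -/

section ConeGamma

variable {F : Type*} [NormedDivisionRing F] [StarRing F] [InnerProductSpace ℝ F]
  [IsRealComplexOrQuaternion F]
variable {q : ℕ} {ι : Type*} [Fintype ι]

/-- The identity matrix as an element of the space of Hermitian matrices. -/
def hermOne (F : Type*) [NormedDivisionRing F] [StarRing F] [InnerProductSpace ℝ F]
    [IsRealComplexOrQuaternion F] (q : ℕ) : Herm F q := ⟨1, conjTranspose_one⟩

theorem hermOne_mem : hermOne F q ∈ posCone F q := isPosDef_one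

theorem herm_inner_eq (a r : Herm F q) : inner ℝ a r =
    re (trace ((a : Matrix (Fin q) (Fin q) F) * (r : Matrix (Fin q) (Fin q) F))) := by
  rw [Submodule.coe_inner, inner_eq_re_trace, herm_conjTranspose]

theorem inner_hermOne (r : Herm F q) :
    inner ℝ (hermOne F q) r = re (trace (r : Matrix (Fin q) (Fin q) F)) := by
  rw [herm_inner_eq]
  change re (trace ((1 : Matrix (Fin q) (Fin q) F) * _)) = _
  rw [Matrix.one_mul]

theorem inner_sq_gram {s : Matrix (Fin q) (Fin q) F} (hs : IsPosDef s) {a : Herm F q}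
    (ha : (a : Matrix (Fin q) (Fin q) F) = s * s) (x : Matrix ι (Fin q) F) :
    inner ℝ a (gram x) = ‖x * s‖ ^ 2 := by
  rw [herm_inner_eq, ← real_inner_self_eq_norm_sq, inner_mul_right_eq, hs.1, Matrix.mul_assoc, ← ha,
    inner_eq_re_trace, coe_gram, re_trace_mul_comm, Matrix.mul_assoc]

theorem inner_hermOne_gram (x : Matrix ι (Fin q) F) :
    inner ℝ (hermOne F q) (gram x) = ‖x‖ ^ 2 := by
  rw [inner_sq_gram isPosDef_one (by simp [hermOne]), Matrix.mul_one]

theorem inner_sq {s : Matrix (Fin q) (Fin q) F} (hs : IsPosDef s) {a : Herm F q}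
    (ha : (a : Matrix (Fin q) (Fin q) F) = s * s) (r : Herm F q) :
    inner ℝ a r = inner ℝ (hermOne F q) (congruence s r) := by
  rw [inner_hermOne, coe_congruence, herm_inner_eq, ha, hs.1, Matrix.mul_assoc, re_trace_mul_comm]

theorem measurable_jdet_rpow (w : ℝ) :
    Measurable fun r : Herm F q => jdet (r : Matrix (Fin q) (Fin q) F) ^ w :=
  ((continuous_jdet (F := F) (q := q)).comp continuous_subtype_val).measurable.pow_const w

/-- The gamma function of the cone as an extended nonnegative real number. -/
def gammaL (F : Type*) [NormedDivisionRing F] [StarRing F] [InnerProductSpace ℝ F]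
    [IsRealComplexOrQuaternion F] (q : ℕ) (z : ℝ) : ℝ≥0∞ :=
  ∫⁻ r in posCone F q, ENNReal.ofReal (Real.exp (-inner ℝ (hermOne F q) r) *
    jdet (r : Matrix (Fin q) (Fin q) F) ^ (z - hermDim F q / q))

theorem coneGamma_eq (z : ℝ) : coneGamma F q z = (gammaL F q z).toReal := by
  rw [gammaL, coneGamma, ← integral_eq_lintegral_of_nonneg_ae]
  · simp only [inner_hermOne]; rfl
  · filter_upwards [ae_restrict_mem measurableSet_posCone] with r hr
    exact mul_nonneg (Real.exp_pos _).le (Real.rpow_nonneg (IsPosDef.jdet_pos hr).le _)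
  · refine Measurable.aestronglyMeasurable ?_
    exact Measurable.mul (by fun_prop) (measurable_jdet_rpow _)

/-- The total mass of the Gaussian measure. -/
def gaussMass (F : Type*) [NormedDivisionRing F] [StarRing F] [InnerProductSpace ℝ F]
    [IsRealComplexOrQuaternion F] (n q : ℕ) : ℝ := Real.pi ^ (scalarDim F * n * q / 2)

theorem gaussMass_pos (n : ℕ) : 0 < gaussMass F n q := Real.rpow_pos_of_pos Real.pi_pos _

theorem integrable_exp_neg_norm_sq : Integrable fun x : Matrix ι (Fin q) F => Real.exp (-‖x‖ ^ 2) := by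
  have := GaussianFourier.integral_rexp_neg_mul_sq_norm (V := Matrix ι (Fin q) F) one_pos
  simp only [neg_mul, one_mul] at this
  -- A non-integrable function has integral `0` by convention, whereas the Gaussian integral is
  -- positive.
  by_contra h
  rw [integral_undef h] at this
  exact (Real.rpow_pos_of_pos (by positivity : 0 < Real.pi / 1) _).ne this

theorem lintegral_gauss : ∫⁻ x : Matrix ι (Fin q) F, ENNReal.ofReal (Real.exp (-‖x‖ ^ 2)) =
    ENNReal.ofReal (gaussMass F (Fintype.card ι) q) := by
  have := GaussianFourier.integral_rexp_neg_mul_sq_norm (V := Matrix ι (Fin q) F) one_pos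
  rw [← ofReal_integral_eq_lintegral_ofReal integrable_exp_neg_norm_sq
    (ae_of_all _ fun x => (Real.exp_pos _).le)]
  congr 1
  simp only [neg_mul, one_mul, div_one] at this
  rw [this, finrank_matrix_eq, gaussMass, scalarDim]
  congr 1
  push_cast
  rw [Fintype.card_fin]
  ring

/-- For `a = s²` one has `⟨a, x* x⟩ = |x s|²`, so substituting `x s` reduces to the standard
Gaussian with Jacobian `Δ(s)^{d|ι|} = Δ(a)^{d|ι|/2}`. -/
theorem lintegral_gauss_weighted {a : Herm F q} (ha : a ∈ posCone F q) :
    ∫⁻ x : Matrix ι (Fin q) F, ENNReal.ofReal (Real.exp (-inner ℝ a (gram x))) =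
      ENNReal.ofReal (gaussMass F (Fintype.card ι) q) * ENNReal.ofReal
        (jdet (a : Matrix (Fin q) (Fin q) F) ^ (-(scalarDim F * Fintype.card ι / 2))) := by
  obtain ⟨s, hs, hsa⟩ := IsPosDef.exists_sqrt ha
  have h := lintegral_eq_rmul (ι := ι) hs
    (f := fun x => ENNReal.ofReal (Real.exp (-‖x‖ ^ 2))) (by fun_prop)
  rw [lintegral_gauss] at h
  simp only [inner_sq_gram hs hsa.symm]
  have hpos := Real.rpow_pos_of_pos hs.jdet_pos (scalarDim F * Fintype.card ι)
  rw [← hsa, jdet_sq hs, ← Real.rpow_natCast, ← Real.rpow_mul hs.jdet_pos.le, h, mul_right_comm,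
    ← ENNReal.ofReal_mul hpos.le, ← Real.rpow_add hs.jdet_pos]
  have : scalarDim F * Fintype.card ι + ((2 : ℕ) : ℝ) * -(scalarDim F * Fintype.card ι / 2) = 0 := by
    push_cast; ring
  rw [this, Real.rpow_zero, ENNReal.ofReal_one, one_mul]

/-- For `a = s²`, substitute `s r s`: the measure `Δ^{-n/q} dr` is invariant, and `Δ^z` contributes
`Δ(s)^{2z} = Δ(a)^z`. The identity holds in `[0, ∞]` for every `z`, so it is available before
convergence is known. -/
theorem lintegral_cone_weighted {a : Herm F q} (ha : a ∈ posCone F q) (hq : 1 ≤ q) (z : ℝ) :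
    ∫⁻ r in posCone F q, ENNReal.ofReal (Real.exp (-inner ℝ a r) *
      jdet (r : Matrix (Fin q) (Fin q) F) ^ (z - hermDim F q / q)) =
      gammaL F q z * ENNReal.ofReal (jdet (a : Matrix (Fin q) (Fin q) F) ^ (-z)) := by
  obtain ⟨s, hs, hsa⟩ := IsPosDef.exists_sqrt ha
  have hm : ∀ b : Herm F q, Measurable fun r : Herm F q => ENNReal.ofReal (Real.exp (-inner ℝ b r) *
      jdet (r : Matrix (Fin q) (Fin q) F) ^ (z - hermDim F q / q)) := fun b =>
    (Measurable.mul (by fun_prop) (measurable_jdet_rpow _)).ennreal_ofReal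
  have h := lintegral_eq_congruence hs (((hm (hermOne F q)).indicator measurableSet_posCone))
  rw [lintegral_indicator measurableSet_posCone] at h
  have h2 : ∀ r : Herm F q, (posCone F q).indicator (fun r => ENNReal.ofReal
      (Real.exp (-inner ℝ (hermOne F q) r) *
        jdet (r : Matrix (Fin q) (Fin q) F) ^ (z - hermDim F q / q))) (congruence s r) =
      ENNReal.ofReal (jdet s ^ (2 * (z - hermDim F q / q))) * (posCone F q).indicator (fun r =>
        ENNReal.ofReal (Real.exp (-inner ℝ a r) *
        jdet (r : Matrix (Fin q) (Fin q) F) ^ (z - hermDim F q / q))) r := by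
    intro r
    by_cases hr : r ∈ posCone F q
    · have hr' : IsPosDef (r : Matrix (Fin q) (Fin q) F) := hr
      rw [Set.indicator_of_mem hr, Set.indicator_of_mem ((congruence_mem_posCone_iff hs).2 hr),
        ← inner_sq hs hsa.symm, coe_congruence, hs.1, jdet_conj hs hr',
        Real.mul_rpow (by have := hs.jdet_pos; positivity) hr'.jdet_pos.le,
        ← ENNReal.ofReal_mul (Real.rpow_nonneg hs.jdet_pos.le _), Real.rpow_mul hs.jdet_pos.le,
        Real.rpow_two, mul_left_comm]
    · rw [Set.indicator_of_notMem hr,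
        Set.indicator_of_notMem (fun h => hr ((congruence_mem_posCone_iff hs).1 h)), mul_zero]
  simp only [h2] at h
  rw [lintegral_const_mul _ ((hm a).indicator measurableSet_posCone),
    lintegral_indicator measurableSet_posCone, ← mul_assoc,
    ← ENNReal.ofReal_mul (Real.rpow_nonneg hs.jdet_pos.le _), ← Real.rpow_add hs.jdet_pos] at h
  have hq' : (q : ℝ) ≠ 0 := by positivity
  have he : 2 * hermDim F q / q + 2 * (z - hermDim F q / q) = 2 * z := by
    field_simp
    ring
  rw [he] at h
  have hpos := Real.rpow_pos_of_pos hs.jdet_pos (2 * z)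
  rw [gammaL, h, ← hsa, jdet_sq hs, ← Real.rpow_natCast, ← Real.rpow_mul hs.jdet_pos.le,
    mul_right_comm, ← ENNReal.ofReal_mul hpos.le, ← Real.rpow_add hs.jdet_pos]
  have : 2 * z + ((2 : ℕ) : ℝ) * -z = 0 := by push_cast; ring
  rw [this, Real.rpow_zero, ENNReal.ofReal_one, one_mul]

theorem trace_diagonalization {u : Matrix (Fin q) (Fin q) F} (hu : uᴴ * u = 1) (ξ : Fin q → ℝ) :
    re (trace (u * diagonal (fun i => ξ i • (1 : F)) * uᴴ)) = ∑ i, ξ i := by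
  rw [re_trace_mul_comm, ← Matrix.mul_assoc, hu, Matrix.one_mul, trace_diagonal, re_sum]
  simp [re_smul_one]

/-- The `ℓ²` norm of the positive eigenvalues is at most their `ℓ¹` norm. -/
theorem IsPosDef.norm_le_trace {x : Matrix (Fin q) (Fin q) F} (hx : IsPosDef x) :
    ‖x‖ ≤ re (trace x) := by
  obtain ⟨u, ξ, hu, hu', hξ, h⟩ := hx.exists_diagonalization
  have h1 : 0 ≤ ∑ i, ξ i := Finset.sum_nonneg fun i _ => (hξ i).le
  have h2 : x * x = u * diagonal (fun i => (ξ i * ξ i) • (1 : F)) * uᴴ := by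
    rw [← diagonal_mul_diagonal_real, h, Matrix.mul_assoc, ← Matrix.mul_assoc uᴴ,
      ← Matrix.mul_assoc uᴴ, hu, Matrix.one_mul]
    simp only [Matrix.mul_assoc]
  have h3 : re (trace x) = ∑ i, ξ i := by rw [h, trace_diagonalization hu]
  rw [h3]
  refine le_of_sq_le_sq ?_ h1
  rw [norm_sq_eq_re_trace, hx.1, h2, trace_diagonalization hu]
  simp only [← pow_two]
  exact Finset.sum_sq_le_sq_sum_of_nonneg fun i _ => (hξ i).le

theorem IsPosDef.jdet_le {x : Matrix (Fin q) (Fin q) F} (hx : IsPosDef x) :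
    jdet x ≤ re (trace x) ^ q := by
  obtain ⟨u, ξ, hu, hu', hξ, h⟩ := hx.exists_diagonalization
  rw [h, trace_diagonalization hu, jdet_eq_prod u hu' ξ hξ]
  calc ∏ i, ξ i ≤ ∏ _i : Fin q, ∑ j, ξ j := Finset.prod_le_prod (fun i _ => (hξ i).le) fun i _ =>
        Finset.single_le_sum (f := ξ) (fun j _ => (hξ j).le) (Finset.mem_univ i)
    _ = _ := by simp

/-- The easy range: the exponent of `Δ` is nonnegative, so `Δ ≤ tr^q` bounds the power by a power of
the trace, and the exponential dominates it. -/
theorem gammaL_lt_top_of_le {z : ℝ} (hz : hermDim F q / q ≤ z) : gammaL F q z < ⊤ := by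
  set w := z - hermDim F q / q with hw
  have hw0 : 0 ≤ w := sub_nonneg.2 hz
  -- `(1 + |r|)^{-R}` is integrable because `R` exceeds the dimension. `N` is large enough to absorb
  -- both `R` and the growth of `Δ^w`, and `C = N! e` comes from `(1 + t)^N / N! ≤ e^{1 + t}`.
  set R : ℝ := Module.finrank ℝ (Herm F q) + 1 with hR
  obtain ⟨N, hN⟩ := exists_nat_ge (R + q * w)
  set C : ℝ := N.factorial * Real.exp 1 with hC
  have hint : Integrable fun r : Herm F q => C * (1 + ‖r‖) ^ (-R) :=
    (integrable_one_add_norm (by rw [hR]; linarith)).const_mul C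
  refine lt_of_le_of_lt (setLIntegral_mono' measurableSet_posCone (g := fun r =>
    ENNReal.ofReal (C * (1 + ‖r‖) ^ (-R))) fun r hr => ?_)
    (lt_of_le_of_lt (setLIntegral_le_lintegral _ _) ?_)
  · refine ENNReal.ofReal_le_ofReal ?_
    have hr' : IsPosDef (r : Matrix (Fin q) (Fin q) F) := hr
    have h1 : ‖r‖ ≤ inner ℝ (hermOne F q) r := by rw [inner_hermOne]; exact hr'.norm_le_trace
    have h2 : jdet (r : Matrix (Fin q) (Fin q) F) ≤ inner ℝ (hermOne F q) r ^ q := by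
      rw [inner_hermOne]; exact hr'.jdet_le
    set t := inner ℝ (hermOne F q) r
    have ht : 0 ≤ t := (norm_nonneg r).trans h1
    have h3 : jdet (r : Matrix (Fin q) (Fin q) F) ^ w ≤ (1 + t) ^ (q * w) := by
      calc jdet (r : Matrix (Fin q) (Fin q) F) ^ w ≤ (t ^ q) ^ w :=
            Real.rpow_le_rpow hr'.jdet_pos.le h2 hw0
        _ = t ^ (q * w) := by rw [← Real.rpow_natCast, ← Real.rpow_mul ht]
        _ ≤ _ := Real.rpow_le_rpow ht (by linarith) (by positivity)
    have h4 : (1 + t) ^ (q * w) ≤ (1 + t) ^ (N : ℝ) * (1 + t) ^ (-R) := by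
      rw [← Real.rpow_add (by linarith)]
      exact Real.rpow_le_rpow_of_exponent_le (by linarith) (by linarith)
    have h5 : (1 + t) ^ (N : ℝ) ≤ C * Real.exp t := by
      have := Real.pow_div_factorial_le_exp (x := 1 + t) (by linarith) N
      rw [div_le_iff₀ (by positivity), Real.exp_add] at this
      rw [Real.rpow_natCast, hC]
      linarith
    have h6 : (1 + t) ^ (-R) ≤ (1 + ‖r‖) ^ (-R) :=
      Real.rpow_le_rpow_of_nonpos (by positivity) (by linarith) (by rw [hR]; linarith [(Module.finrank ℝ (Herm F q)).cast_nonneg (α := ℝ)])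
    have h7 : 0 ≤ (1 + t) ^ (-R) := by positivity
    calc Real.exp (-t) * jdet (r : Matrix (Fin q) (Fin q) F) ^ w
        ≤ Real.exp (-t) * ((C * Real.exp t) * (1 + ‖r‖) ^ (-R)) := by
          gcongr
          exact h3.trans (h4.trans (mul_le_mul h5 h6 h7 (by positivity)))
      _ = C * (1 + ‖r‖) ^ (-R) := by
          rw [← mul_assoc, mul_left_comm, ← Real.exp_add, neg_add_cancel, Real.exp_zero, mul_one]
  · exact (hasFiniteIntegral_iff_ofReal (ae_of_all _ fun r => by positivity)).1 hint.2

/-- All eigenvalues `ξᵢ` of `1 + x* x` are at least `1`, so `∏ ξᵢ ≥ 1 + ∑ (ξᵢ - 1) = 1 + tr(x* x)`.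
The bound suffices for integrability. -/
theorem one_add_norm_sq_le_jdet (x : Matrix (Fin 1) (Fin q) F) :
    1 + ‖x‖ ^ 2 ≤ jdet (1 + xᴴ * x) := by
  have hpos := isPosDef_one.add_conjTranspose_mul_self x
  obtain ⟨u, ξ, hu, hu', hξ, h⟩ := hpos.exists_diagonalization
  have h1 : ∀ i, 1 ≤ ξ i := by
    intro i
    set e : Matrix (Fin q) (Fin 1) F := Matrix.of fun j _ => if j = i then 1 else 0 with he
    have h2 : (1 + xᴴ * x) * (u * e) = ξ i • (u * e) := by
      rw [h, Matrix.mul_assoc, ← Matrix.mul_assoc uᴴ, hu, Matrix.one_mul, Matrix.mul_assoc,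
        ← Matrix.mul_smul]
      congr 1
      ext j k
      by_cases hj : j = i
      · subst hj; simp [he]
      · simp [he, hj]
    have h3 : inner ℝ (u * e) ((1 + xᴴ * x) * (u * e)) = ‖u * e‖ ^ 2 + ‖x * (u * e)‖ ^ 2 := by
      rw [Matrix.add_mul, Matrix.one_mul, inner_add_right, Matrix.mul_assoc,
        ← real_inner_self_eq_norm_sq, ← real_inner_self_eq_norm_sq,
        inner_mul_left_eq x]
    have hne : 0 < ‖u * e‖ ^ 2 := by
      rw [norm_mul_of_conjTranspose_mul_self hu]
      have : e ≠ 0 := fun h0 => by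
        have := congrFun (congrFun h0 i) 0
        simp [he] at this
      have := norm_pos_iff.2 this
      positivity
    rw [h2, inner_smul_right, real_inner_self_eq_norm_sq] at h3
    nlinarith [sq_nonneg ‖x * (u * e)‖]
  have h4 : re (trace (1 + xᴴ * x)) = q + ‖x‖ ^ 2 := by
    rw [trace_add, re_add, ← norm_sq_eq_re_trace, trace_one]
    have : ((Fintype.card (Fin q) : ℕ) : F) = (q : ℝ) • (1 : F) := by
      simp [Nat.cast_smul_eq_nsmul]
    rw [this, re_smul_one]
  have h5 : 1 + ∑ i, (ξ i - 1) ≤ ∏ i, ξ i := by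
    have : ∀ s : Finset (Fin q), 1 + ∑ i ∈ s, (ξ i - 1) ≤ ∏ i ∈ s, ξ i := by
      intro s
      induction s using Finset.induction_on with
      | empty => simp
      | insert i s hi ih =>
        rw [Finset.sum_insert hi, Finset.prod_insert hi]
        have h6 : 0 ≤ ∑ i ∈ s, (ξ i - 1) := Finset.sum_nonneg fun j _ => by linarith [h1 j]
        nlinarith [h1 i]
    exact this _
  have h7 := trace_diagonalization hu ξ
  rw [← h, h4] at h7
  rw [h, jdet_eq_prod u hu' ξ hξ]
  refine le_trans (le_of_eq ?_) h5
  rw [Finset.sum_sub_distrib, ← h7]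
  simp

theorem hermDim_div (hq : 1 ≤ q) : hermDim F q / q = 1 + scalarDim F / 2 * (q - 1) := by
  have hq' : (q : ℝ) ≠ 0 := by positivity
  rw [hermDim]
  field_simp

/-- For `F = ℝ` and `m = q` the exponent `z - n/q` is negative, so `gammaL_lt_top_of_le` does not
reach this case. Expressing `Δ(r)^{-d/2}` as a Gaussian integral over one row `x` and exchanging
integrals gives `π^{dq/2} Γ(z) = Γ(z + d/2) ∫ Δ(1 + x* x)^{-(z + d/2)} dx`. Here `z + d/2 ≥ n/q`
because `d ≥ 1`, and the last integral converges because `d(m + 1) > dq`. -/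
theorem gammaL_lt_top {m : ℕ} (hq : 1 ≤ q) (hm : q ≤ m) :
    gammaL F q (scalarDim F * m / 2) < ⊤ := by
  set d := scalarDim F with hd
  have hd1 : 1 ≤ d := one_le_scalarDim
  set z : ℝ := d * m / 2 with hz
  set π' := ENNReal.ofReal (gaussMass F 1 q) with hπ
  have hπ0 : π' ≠ 0 := (ENNReal.ofReal_pos.2 (gaussMass_pos 1)).ne'
  have hm' : (q : ℝ) ≤ m := by exact_mod_cast hm
  have hfin : gammaL F q (z + d / 2) < ⊤ := by
    refine gammaL_lt_top_of_le ?_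
    rw [hermDim_div hq, ← hd, hz]
    nlinarith
  have hmeas : Measurable fun p : Herm F q × Matrix (Fin 1) (Fin q) F =>
      ENNReal.ofReal (Real.exp (-inner ℝ (hermOne F q + gram p.2) p.1) *
        jdet (p.1 : Matrix (Fin q) (Fin q) F) ^ (z + d / 2 - hermDim F q / q)) := by
    refine (Measurable.mul (Continuous.measurable ?_) ?_).ennreal_ofReal
    · exact Real.continuous_exp.comp ((continuous_const.add (continuous_gram.comp
        continuous_snd)).inner continuous_fst).neg
    · exact (measurable_jdet_rpow _).comp measurable_fst
  have h1 : ∀ r ∈ posCone F q, π' * ENNReal.ofReal (Real.exp (-inner ℝ (hermOne F q) r) *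
      jdet (r : Matrix (Fin q) (Fin q) F) ^ (z - hermDim F q / q)) =
      ∫⁻ x : Matrix (Fin 1) (Fin q) F, ENNReal.ofReal (Real.exp (-inner ℝ (hermOne F q + gram x) r) *
        jdet (r : Matrix (Fin q) (Fin q) F) ^ (z + d / 2 - hermDim F q / q)) := by
    intro r hr
    have hr' : 0 < jdet (r : Matrix (Fin q) (Fin q) F) := IsPosDef.jdet_pos hr
    have h2 := lintegral_gauss_weighted (ι := Fin 1) hr
    have h3 : ∀ x : Matrix (Fin 1) (Fin q) F,
        ENNReal.ofReal (Real.exp (-inner ℝ (hermOne F q + gram x) r) *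
          jdet (r : Matrix (Fin q) (Fin q) F) ^ (z + d / 2 - hermDim F q / q)) =
        ENNReal.ofReal (Real.exp (-inner ℝ (hermOne F q) r) *
          jdet (r : Matrix (Fin q) (Fin q) F) ^ (z + d / 2 - hermDim F q / q)) *
        ENNReal.ofReal (Real.exp (-inner ℝ r (gram x))) := by
      intro x
      rw [← ENNReal.ofReal_mul (by positivity), inner_add_left, neg_add, Real.exp_add,
        real_inner_comm r (gram x), mul_right_comm]
    simp only [h3]
    rw [lintegral_const_mul' _ _ ENNReal.ofReal_ne_top, h2, Fintype.card_fin, ← hπ, mul_left_comm,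
      ← ENNReal.ofReal_mul (p := Real.exp (-inner ℝ (hermOne F q) r) *
          jdet (r : Matrix (Fin q) (Fin q) F) ^ (z + d / 2 - hermDim F q / q)) (by positivity),
      mul_assoc (Real.exp _), ← Real.rpow_add hr']
    congr 4
    push_cast
    ring
  have h4 : π' * gammaL F q z = ∫⁻ x : Matrix (Fin 1) (Fin q) F,
      gammaL F q (z + d / 2) * ENNReal.ofReal (jdet (1 + xᴴ * x) ^ (-(z + d / 2))) := by
    rw [gammaL, ← lintegral_const_mul' _ _ ENNReal.ofReal_ne_top,
      setLIntegral_congr_fun measurableSet_posCone h1,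
      lintegral_lintegral_swap hmeas.aemeasurable]
    refine lintegral_congr fun x => ?_
    exact lintegral_cone_weighted (a := hermOne F q + gram x)
      (isPosDef_one.add_conjTranspose_mul_self x) hq _
  have h5 : ∫⁻ x : Matrix (Fin 1) (Fin q) F,
      ENNReal.ofReal (jdet (1 + xᴴ * x) ^ (-(z + d / 2))) < ⊤ := by
    have hint := integrable_rpow_neg_one_add_norm_sq (E := Matrix (Fin 1) (Fin q) F)
      (μ := volume) (r := d * (m + 1)) (by
        rw [finrank_matrix_eq]
        simp only [Fintype.card_fin, one_mul]
        push_cast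
        rw [← scalarDim, ← hd]
        nlinarith)
    refine lt_of_le_of_lt (lintegral_mono fun x => ENNReal.ofReal_le_ofReal ?_)
      ((hasFiniteIntegral_iff_ofReal (ae_of_all _ fun x => by positivity)).1 hint.2)
    have : -(z + d / 2) = -(d * (m + 1)) / 2 := by rw [hz]; ring
    rw [this]
    refine Real.rpow_le_rpow_of_nonpos (by positivity) (one_add_norm_sq_le_jdet x) ?_
    have : 0 ≤ d * (m + 1) := by positivity
    linarith
  -- Were `Γ(z)` infinite, the left side of the identity would be infinite and the right side
  -- finite.
  by_contra htop
  rw [not_lt, top_le_iff] at htop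
  rw [htop, ENNReal.mul_top hπ0, lintegral_const_mul' _ _ hfin.ne] at h4
  exact (ENNReal.mul_lt_top hfin h5).ne h4.symm

theorem gammaL_ne_zero (z : ℝ) : gammaL F q z ≠ 0 := by
  rw [gammaL, ← lintegral_indicator measurableSet_posCone, Ne, lintegral_eq_zero_iff]
  · intro h
    have h1 : ∀ᵐ r : Herm F q, r ∉ posCone F q := by
      filter_upwards [h] with r hr hmem
      rw [Set.indicator_of_mem hmem] at hr
      have h2 := Real.rpow_pos_of_pos (IsPosDef.jdet_pos hmem) (z - hermDim F q / q)
      have h3 : 0 < Real.exp (-inner ℝ (hermOne F q) r) *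
        jdet (r : Matrix (Fin q) (Fin q) F) ^ (z - hermDim F q / q) := by positivity
      exact (ENNReal.ofReal_pos.2 h3).ne' hr
    have h2 := isOpen_posCone.measure_pos (volume : Measure (Herm F q)) ⟨hermOne F q, hermOne_mem⟩
    rw [ae_iff] at h1
    simp only [not_not] at h1
    exact h2.ne' h1
  · exact ((Measurable.mul (by fun_prop)
      (measurable_jdet_rpow _)).ennreal_ofReal).indicator measurableSet_posCone

end ConeGamma

/-! ### The Wishart distribution of the Gram matrix -/

section Wishart

variable {F : Type*} [NormedDivisionRing F] [StarRing F] [InnerProductSpace ℝ F]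
  [IsRealComplexOrQuaternion F]
variable {q m : ℕ}

/-- The (unnormalized) Gaussian measure `exp(-|x|²) dx` on a matrix space. -/
def gaussM (F : Type*) [NormedDivisionRing F] [StarRing F] [InnerProductSpace ℝ F]
    [IsRealComplexOrQuaternion F] (m q : ℕ) : Measure (Matrix (Fin m) (Fin q) F) :=
  volume.withDensity fun x => ENNReal.ofReal (Real.exp (-‖x‖ ^ 2))

/-- The density of the Wishart distribution. -/
def coneDensity (z : ℝ) (r : Herm F q) : ℝ≥0∞ :=
  ENNReal.ofReal (Real.exp (-inner ℝ (hermOne F q) r) *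
    jdet (r : Matrix (Fin q) (Fin q) F) ^ (z - hermDim F q / q))

theorem measurable_coneDensity (z : ℝ) : Measurable (coneDensity (F := F) (q := q) z) :=
  (Measurable.mul (by fun_prop) (measurable_jdet_rpow _)).ennreal_ofReal

theorem measurable_gauss_density :
    Measurable fun x : Matrix (Fin m) (Fin q) F => ENNReal.ofReal (Real.exp (-‖x‖ ^ 2)) := by
  fun_prop

theorem lintegral_gaussM {f : Matrix (Fin m) (Fin q) F → ℝ≥0∞} (hf : Measurable f) :
    ∫⁻ x, f x ∂(gaussM F m q) = ∫⁻ x, ENNReal.ofReal (Real.exp (-‖x‖ ^ 2)) * f x :=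
  lintegral_withDensity_eq_lintegral_mul _ measurable_gauss_density hf

theorem gaussM_univ : gaussM F m q Set.univ = ENNReal.ofReal (gaussMass F m q) := by
  rw [gaussM, withDensity_apply _ MeasurableSet.univ, Measure.restrict_univ, lintegral_gauss,
    Fintype.card_fin]

instance : IsFiniteMeasure (gaussM F m q) := ⟨by rw [gaussM_univ]; exact ENNReal.ofReal_lt_top⟩

/-- The Gram matrix of a Gaussian matrix has the Wishart distribution. -/
theorem map_gram_gaussM (hq : 1 ≤ q) (hm : q ≤ m) :
    gammaL F q (scalarDim F * m / 2) • (gaussM F m q).map gram =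
      ENNReal.ofReal (gaussMass F m q) •
        (volume.restrict (posCone F q)).withDensity (coneDensity (scalarDim F * m / 2)) := by
  set z := scalarDim F * m / 2 with hz
  set G := gammaL F q z with hG
  have hGtop : G < ⊤ := gammaL_lt_top hq hm
  set A := ENNReal.ofReal (gaussMass F m q) with hA
  have hAtop : A < ⊤ := ENNReal.ofReal_lt_top
  have hgm : Measurable (gram : Matrix (Fin m) (Fin q) F → Herm F q) := continuous_gram.measurable
  -- For `|b| < ε` the factor `e^{⟨b, r⟩}` turns the weight `1` into the positive definite weight `1
  -- - b`, so both Laplace transforms are given by the weighted formulas above.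
  obtain ⟨ε, hε, hball⟩ := Metric.isOpen_iff.1 (isOpen_posCone (F := F) (q := q)) _ hermOne_mem
  have hmem : ∀ b : Herm F q, ‖b‖ < ε → hermOne F q - b ∈ posCone F q := fun b hb =>
    hball (by rwa [Metric.mem_ball, dist_eq_norm, sub_sub_cancel_left, norm_neg])
  have hexpm : ∀ b : Herm F q, Measurable fun r : Herm F q =>
      ENNReal.ofReal (Real.exp (inner ℝ b r)) := fun b => by fun_prop
  have h1 : ∀ b : Herm F q, ‖b‖ < ε →
      ∫⁻ r, ENNReal.ofReal (Real.exp (inner ℝ b r)) ∂((gaussM F m q).map gram) =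
      A * ENNReal.ofReal (jdet ((hermOne F q - b : Herm F q) : Matrix (Fin q) (Fin q) F) ^ (-z)) := by
    intro b hb
    rw [lintegral_map (hexpm b) hgm, lintegral_gaussM
      (f := fun x => ENNReal.ofReal (Real.exp (inner ℝ b (gram x)))) ((hexpm b).comp hgm)]
    have h := lintegral_gauss_weighted (ι := Fin m) (hmem b hb)
    rw [Fintype.card_fin] at h
    rw [hA, hz, ← h]
    refine lintegral_congr fun x => ?_
    rw [← ENNReal.ofReal_mul (Real.exp_pos _).le, ← Real.exp_add, inner_sub_left,
      inner_hermOne_gram]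
    congr 2
    ring
  have h2 : ∀ b : Herm F q, ‖b‖ < ε →
      ∫⁻ r, ENNReal.ofReal (Real.exp (inner ℝ b r))
        ∂((volume.restrict (posCone F q)).withDensity (coneDensity z)) =
      G * ENNReal.ofReal (jdet ((hermOne F q - b : Herm F q) : Matrix (Fin q) (Fin q) F) ^ (-z)) := by
    intro b hb
    rw [lintegral_withDensity_eq_lintegral_mul _ (measurable_coneDensity z) (hexpm b), hG,
      ← lintegral_cone_weighted (hmem b hb) hq]
    refine setLIntegral_congr_fun measurableSet_posCone fun r hr => ?_
    have := Real.rpow_pos_of_pos (IsPosDef.jdet_pos hr) (z - hermDim F q / q)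
    rw [Pi.mul_apply, coneDensity, ← ENNReal.ofReal_mul (by positivity), mul_right_comm,
      ← Real.exp_add, inner_sub_left]
    congr 3
    ring
  have hfin1 : IsFiniteMeasure (G • (gaussM F m q).map gram) :=
    Measure.smul_finite _ hGtop.ne
  have hfin2 : IsFiniteMeasure
      (A • (volume.restrict (posCone F q)).withDensity (coneDensity z)) := by
    have : IsFiniteMeasure ((volume.restrict (posCone F q)).withDensity
        (coneDensity (F := F) (q := q) z)) :=
      isFiniteMeasure_withDensity hGtop.ne
    exact Measure.smul_finite _ hAtop.ne
  refine measure_ext_of_laplace hε (fun b hb => ?_) (fun b hb => ?_)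
  · rw [lintegral_smul_measure, h1 b hb]
    exact (ENNReal.mul_lt_top hGtop (ENNReal.mul_lt_top hAtop ENNReal.ofReal_lt_top)).ne
  · rw [lintegral_smul_measure, lintegral_smul_measure, h1 b hb, h2 b hb, smul_eq_mul, smul_eq_mul,
      mul_left_comm]

/-- The Wishart measure is carried by the cone: almost every matrix with at least `q` rows has full
column rank. -/
theorem ae_gram_mem_posCone (hq : 1 ≤ q) (hm : q ≤ m) :
    ∀ᵐ x ∂(gaussM F m q), gram x ∈ posCone F q := by
  have h := map_gram_gaussM (F := F) hq hm
  have h1 : (gammaL F q (scalarDim F * m / 2) • (gaussM F m q).map gram) (posCone F q)ᶜ = 0 := by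
    rw [h, Measure.smul_apply, withDensity_apply _ measurableSet_posCone.compl,
      Measure.restrict_restrict measurableSet_posCone.compl]
    simp
  rw [Measure.smul_apply, smul_eq_mul, mul_eq_zero, or_iff_right (gammaL_ne_zero _),
    Measure.map_apply continuous_gram.measurable measurableSet_posCone.compl] at h1
  exact h1

theorem lintegral_gram_gaussM (hq : 1 ≤ q) (hm : q ≤ m) {f : Herm F q → ℝ≥0∞}
    (hf : Measurable f) :
    gammaL F q (scalarDim F * m / 2) * ∫⁻ x, f (gram x) ∂(gaussM F m q) =
      ENNReal.ofReal (gaussMass F m q) *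
        ∫⁻ r in posCone F q, coneDensity (scalarDim F * m / 2) r * f r := by
  have h := congrArg (fun μ => ∫⁻ r, f r ∂μ) (map_gram_gaussM (F := F) hq hm)
  simp only [lintegral_smul_measure, smul_eq_mul] at h
  rw [lintegral_map hf continuous_gram.measurable,
    lintegral_withDensity_eq_lintegral_mul _ (measurable_coneDensity _) hf] at h
  exact h

end Wishart

/-! ### The Stiefel manifold: tangent spaces, finite positive volume, invariance -/

section StiefelMeasure

variable {F : Type*} [NormedDivisionRing F] [StarRing F] [InnerProductSpace ℝ F]
  [IsRealComplexOrQuaternion F]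
variable {p q : ℕ}

theorem mem_stiefel {x : Matrix (Fin p) (Fin q) F} : x ∈ stiefel F p q ↔ xᴴ * x = 1 := Iff.rfl

theorem mem_stiefel_iff_gram {x : Matrix (Fin p) (Fin q) F} :
    x ∈ stiefel F p q ↔ gram x = hermOne F q :=
  ⟨fun h => Subtype.ext h, fun h => congrArg Subtype.val h⟩

theorem isClosed_stiefel : IsClosed (stiefel F p q) := by
  have : stiefel F p q = gram ⁻¹' {hermOne F q} := by
    ext x; exact mem_stiefel_iff_gram
  rw [this]
  exact isClosed_singleton.preimage continuous_gram

theorem measurableSet_stiefel : MeasurableSet (stiefel F p q) := isClosed_stiefel.measurableSet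

theorem isCompact_stiefel : IsCompact (stiefel F p q) := by
  refine Metric.isCompact_of_isClosed_isBounded isClosed_stiefel
    ((Metric.isBounded_closedBall (x := 0) (r := √q)).subset fun x hx => ?_)
  rw [mem_closedBall_zero_iff]
  refine Real.le_sqrt_of_sq_le ?_
  rw [norm_sq_eq_re_trace, mem_stiefel.1 hx, trace_one, Fintype.card_fin]
  have : ((q : ℕ) : F) = (q : ℝ) • (1 : F) := by simp [Nat.cast_smul_eq_nsmul]
  rw [this, re_smul_one]

theorem stiefel_nonempty (h : q ≤ p) : (stiefel F p q).Nonempty := by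
  refine ⟨(1 : Matrix (Fin p) (Fin p) F).submatrix id (Fin.castLE h), ?_⟩
  have : ((1 : Matrix (Fin p) (Fin p) F).submatrix id (Fin.castLE h))ᴴ *
      (1 : Matrix (Fin p) (Fin p) F).submatrix id (Fin.castLE h) =
      ((1 : Matrix (Fin p) (Fin p) F)ᴴ * 1).submatrix (Fin.castLE h) (Fin.castLE h) := rfl
  rw [mem_stiefel, this, conjTranspose_one, Matrix.one_mul,
    submatrix_one _ (Fin.castLE_injective h)]

/-- A preimage of `a` is `x a / 2`, since `x* x = 1`; thus `1` is a regular value of the Gram map.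
-/
theorem gramDeriv_surjective {x : Matrix (Fin p) (Fin q) F} (hx : x ∈ stiefel F p q) :
    Function.Surjective (gramDeriv x) := by
  intro a
  refine ⟨x * ((1 / 2 : ℝ) • (a : Matrix (Fin q) (Fin q) F)), Subtype.ext ?_⟩
  rw [coe_gramDeriv, conjTranspose_mul, conjTranspose_smul, herm_conjTranspose, Matrix.mul_assoc,
    ← Matrix.mul_assoc, mem_stiefel.1 hx, Matrix.one_mul, Matrix.mul_one, star_trivial, ← two_smul ℝ,
    smul_smul]
  norm_num

/-- The tangent space of the Stiefel manifold. -/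
def stiefelTangent (x : Matrix (Fin p) (Fin q) F) : Submodule ℝ (Matrix (Fin p) (Fin q) F) :=
  LinearMap.ker (gramDeriv x : Matrix (Fin p) (Fin q) F →ₗ[ℝ] Herm F q)

theorem finrank_herm_add_finrank_stiefelTangent {x : Matrix (Fin p) (Fin q) F}
    (hx : x ∈ stiefel F p q) :
    Module.finrank ℝ (Herm F q) + Module.finrank ℝ (stiefelTangent x) =
      Module.finrank ℝ (Matrix (Fin p) (Fin q) F) := by
  have h := LinearMap.finrank_range_add_finrank_ker
    (gramDeriv x : Matrix (Fin p) (Fin q) F →ₗ[ℝ] Herm F q)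
  rwa [LinearMap.range_eq_top.2 (gramDeriv_surjective hx), finrank_top] at h

theorem finrank_stiefelTangent {x : Matrix (Fin p) (Fin q) F} (hx : x ∈ stiefel F p q) :
    (Module.finrank ℝ (stiefelTangent x) : ℝ) = stiefelDim F p q := by
  have h := congrArg (Nat.cast : ℕ → ℝ) (finrank_herm_add_finrank_stiefelTangent hx)
  rw [finrank_matrix_eq] at h
  push_cast at h
  rw [finrank_herm, Fintype.card_fin, Fintype.card_fin] at h
  rw [stiefelDim, scalarDim]
  linarith

/-- The chart `x ↦ (x* x, projection of x to the tangent space)` near a point. -/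
def stiefelChart (x₀ x : Matrix (Fin p) (Fin q) F) : Herm F q × stiefelTangent x₀ :=
  (gram x, (stiefelTangent x₀).orthogonalProjectionOnto x)

/-- The first component of the derivative vanishes exactly on the tangent space, where the second is
the identity. So the derivative is injective, and bijective by dimension. -/
theorem exists_hasStrictFDerivAt_stiefelChart {x : Matrix (Fin p) (Fin q) F}
    (hx : x ∈ stiefel F p q) :
    ∃ e : Matrix (Fin p) (Fin q) F ≃L[ℝ] Herm F q × stiefelTangent x,
      HasStrictFDerivAt (stiefelChart x)
        (e : Matrix (Fin p) (Fin q) F →L[ℝ] Herm F q × stiefelTangent x) x := by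
  set L := (gramDeriv x).prod (stiefelTangent x).orthogonalProjectionOnto with hL
  have hinj : Function.Injective L := by
    refine (injective_iff_map_eq_zero L).2 fun h hh => ?_
    have h1 : gramDeriv x h = 0 := congrArg Prod.fst hh
    have h2 : (stiefelTangent x).orthogonalProjectionOnto h = 0 := congrArg Prod.snd hh
    have h3 : h ∈ stiefelTangent x := h1
    have h4 := Submodule.orthogonalProjectionOnto_mem_subspace_eq_self (⟨h, h3⟩ : stiefelTangent x)
    rw [h2] at h4
    exact (congrArg Subtype.val h4).symm
  have hdim : Module.finrank ℝ (Matrix (Fin p) (Fin q) F) =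
      Module.finrank ℝ (Herm F q × stiefelTangent x) := by
    rw [Module.finrank_prod, finrank_herm_add_finrank_stiefelTangent hx]
  refine ⟨(LinearMap.linearEquivOfInjective
    (L : Matrix (Fin p) (Fin q) F →ₗ[ℝ] Herm F q × stiefelTangent x) hinj
      hdim).toContinuousLinearEquiv, ?_⟩
  have : (((LinearMap.linearEquivOfInjective
      (L : Matrix (Fin p) (Fin q) F →ₗ[ℝ] Herm F q × stiefelTangent x) hinj
      hdim).toContinuousLinearEquiv :
        Matrix (Fin p) (Fin q) F ≃L[ℝ] Herm F q × stiefelTangent x) :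
          Matrix (Fin p) (Fin q) F →L[ℝ] Herm F q × stiefelTangent x) = L := by
    ext1 y; rfl
  rw [this]
  exact (hasStrictFDerivAt_gram x).prodMk
    (stiefelTangent x).orthogonalProjectionOnto.hasStrictFDerivAt

open Measure in
-- Orthogonal projection onto the tangent space is `1`-Lipschitz and does not increase Hausdorff
-- measure, while its image of a relatively open piece contains a nonempty open set.
theorem hausdorffMeasure_stiefel_inter_pos {x : Matrix (Fin p) (Fin q) F} (hx : x ∈ stiefel F p q)
    {W : Set (Matrix (Fin p) (Fin q) F)} (hW : IsOpen W) (hxW : x ∈ W) :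
    0 < μH[stiefelDim F p q] (stiefel F p q ∩ W) := by
  obtain ⟨e, he⟩ := exists_hasStrictFDerivAt_stiefelChart hx
  set Ψ := he.toOpenPartialHomeomorph (stiefelChart x) with hΨ
  have hΨc : ∀ y, Ψ y = stiefelChart x y := fun y => rfl
  have hxs : x ∈ Ψ.source := he.mem_toOpenPartialHomeomorph_source
  set O : Set (Herm F q × stiefelTangent x) := Ψ.target ∩ Ψ.symm ⁻¹' W with hO
  have hOopen : IsOpen O := Ψ.symm.isOpen_inter_preimage hW
  -- The slice `x* x = 1` of the chart, in tangential coordinates.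
  set V : Set (stiefelTangent x) := (fun t => (hermOne F q, t)) ⁻¹' O with hV
  have hVopen : IsOpen V := hOopen.preimage (by fun_prop)
  have hVne : V.Nonempty := by
    refine ⟨(stiefelTangent x).orthogonalProjectionOnto x, ?_⟩
    have h1 : (hermOne F q, (stiefelTangent x).orthogonalProjectionOnto x) = Ψ x := by
      rw [hΨc, stiefelChart, mem_stiefel_iff_gram.1 hx]
    change (hermOne F q, (stiefelTangent x).orthogonalProjectionOnto x) ∈ O
    rw [h1]
    refine ⟨Ψ.map_source hxs, ?_⟩
    change Ψ.symm (Ψ x) ∈ W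
    rwa [Ψ.left_inv hxs]
  have hsub : V ⊆ (stiefelTangent x).orthogonalProjectionOnto '' (stiefel F p q ∩ W) := by
    intro t ht
    have h1 : Ψ (Ψ.symm (hermOne F q, t)) = (hermOne F q, t) := Ψ.right_inv ht.1
    rw [hΨc] at h1
    exact ⟨Ψ.symm (hermOne F q, t), ⟨mem_stiefel_iff_gram.2 (congrArg Prod.fst h1), ht.2⟩,
      congrArg Prod.snd h1⟩
  have hpos : 0 < μH[stiefelDim F p q] V := by
    rw [← finrank_stiefelTangent hx]
    exact hVopen.measure_pos _ hVne
  have hdim : 0 ≤ stiefelDim F p q := by rw [← finrank_stiefelTangent hx]; positivity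
  have hle := ((stiefelTangent x).orthogonalProjectionOnto.lipschitz).hausdorffMeasure_image_le hdim
    (stiefel F p q ∩ W)
  by_contra h0
  rw [not_lt, nonpos_iff_eq_zero] at h0
  rw [h0, mul_zero, nonpos_iff_eq_zero] at hle
  exact hpos.ne' (measure_mono_null hsub hle)

open Measure in
-- By compactness a local bound suffices: near each point the manifold is a Lipschitz image, under
-- the inverse chart, of a bounded subset of the tangent space.
theorem hausdorffMeasure_stiefel_lt_top : μH[stiefelDim F p q] (stiefel F p q) < ⊤ := by
  refine isCompact_stiefel.measure_lt_top_of_nhdsWithin fun x hx => ?_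
  obtain ⟨e, he⟩ := exists_hasStrictFDerivAt_stiefelChart hx
  set Ψ := he.toOpenPartialHomeomorph (stiefelChart x) with hΨ
  have hΨc : ∀ y, Ψ y = stiefelChart x y := fun y => rfl
  have hxs : x ∈ Ψ.source := he.mem_toOpenPartialHomeomorph_source
  obtain ⟨K, N, hN, hK⟩ := he.to_localInverse.exists_lipschitzOnWith
  have hdim : 0 ≤ stiefelDim F p q := by rw [← finrank_stiefelTangent hx]; positivity
  have hcont : ContinuousAt (stiefelChart x) x := he.continuousAt
  set B : Set (stiefelTangent x) := {t | (hermOne F q, t) ∈ N} ∩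
    Metric.ball ((stiefelTangent x).orthogonalProjectionOnto x) 1 with hB
  have hBfin : μH[stiefelDim F p q] B < ⊤ := by
    rw [← finrank_stiefelTangent hx]
    exact lt_of_le_of_lt (measure_mono Set.inter_subset_right) measure_ball_lt_top
  have hlip : LipschitzOnWith K (fun t => Ψ.symm (hermOne F q, t)) B := by
    intro s hs t ht
    have h1 := hK hs.1 ht.1
    have h2 : edist (hermOne F q, s) (hermOne F q, t) = edist s t := by
      rw [Prod.edist_eq]; simp
    rw [h2] at h1
    exact h1
  refine ⟨_, ?_, lt_of_le_of_lt (hlip.hausdorffMeasure_image_le hdim)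
    (ENNReal.mul_lt_top (ENNReal.rpow_lt_top_of_nonneg hdim ENNReal.coe_ne_top) hBfin)⟩
  have h1 : ∀ᶠ y in nhds x, stiefelChart x y ∈ N := hcont.eventually_mem hN
  have h2 : ∀ᶠ y in nhds x, y ∈ Ψ.source := Ψ.open_source.mem_nhds hxs
  have h3 : ∀ᶠ y in nhds x, (stiefelTangent x).orthogonalProjectionOnto y ∈
      Metric.ball ((stiefelTangent x).orthogonalProjectionOnto x) 1 :=
    (stiefelTangent x).orthogonalProjectionOnto.continuous.continuousAt.eventually_mem
      (Metric.ball_mem_nhds _ one_pos)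
  filter_upwards [nhdsWithin_le_nhds h1, nhdsWithin_le_nhds h2, nhdsWithin_le_nhds h3,
    self_mem_nhdsWithin] with y hy1 hy2 hy3 hy4
  have h4 : stiefelChart x y = (hermOne F q, (stiefelTangent x).orthogonalProjectionOnto y) := by
    rw [stiefelChart, mem_stiefel_iff_gram.1 hy4]
  refine ⟨(stiefelTangent x).orthogonalProjectionOnto y, ⟨?_, hy3⟩, ?_⟩
  · change (_, _) ∈ N
    rw [← h4]
    exact hy1
  · change Ψ.symm (_, _) = y
    rw [← h4, ← hΨc, Ψ.left_inv hy2]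

theorem isProbabilityMeasure_stiefelMeasure (h : q ≤ p) :
    IsProbabilityMeasure (stiefelMeasure F p q) := by
  obtain ⟨x, hx⟩ := stiefel_nonempty (F := F) h
  have h0 := hausdorffMeasure_stiefel_inter_pos hx isOpen_univ (Set.mem_univ x)
  rw [Set.inter_univ] at h0
  refine ⟨?_⟩
  rw [stiefelMeasure, Measure.smul_apply, Measure.restrict_apply_univ, smul_eq_mul]
  exact ENNReal.inv_mul_cancel h0.ne' hausdorffMeasure_stiefel_lt_top.ne

theorem stiefelMeasure_pos_of_isOpen {x : Matrix (Fin p) (Fin q) F} (hx : x ∈ stiefel F p q)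
    {W : Set (Matrix (Fin p) (Fin q) F)} (hW : IsOpen W) (hxW : x ∈ W) :
    0 < stiefelMeasure F p q W := by
  rw [stiefelMeasure, Measure.smul_apply, Measure.restrict_apply hW.measurableSet, smul_eq_mul,
    Set.inter_comm]
  exact ENNReal.mul_pos (ENNReal.inv_ne_zero.2 hausdorffMeasure_stiefel_lt_top.ne)
    (hausdorffMeasure_stiefel_inter_pos hx hW hxW).ne'

theorem ae_mem_stiefel : ∀ᵐ x ∂(stiefelMeasure F p q), x ∈ stiefel F p q :=
  Measure.ae_smul_measure (ae_restrict_mem measurableSet_stiefel) _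

/-- Hausdorff measure depends only on the metric, so each isometry of the ambient space preserving
the manifold preserves its volume. -/
theorem map_stiefelMeasure_of_isometry
    (e : Matrix (Fin p) (Fin q) F ≃ᵢ Matrix (Fin p) (Fin q) F)
    (he : e ⁻¹' (stiefel F p q) = stiefel F p q) :
    (stiefelMeasure F p q).map e = stiefelMeasure F p q := by
  rw [stiefelMeasure, Measure.map_smul]
  congr 1
  conv_lhs => rw [← he]
  rw [← Measure.restrict_map e.continuous.measurable measurableSet_stiefel, e.map_hausdorffMeasure]

theorem map_mul_left_stiefelMeasure {u : Matrix (Fin p) (Fin p) F} (hu : uᴴ * u = 1) :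
    (stiefelMeasure F p q).map (fun x => u * x) = stiefelMeasure F p q := by
  have hu' := mul_conjTranspose_eq_one rfl hu
  let e : Matrix (Fin p) (Fin q) F ≃ᵢ Matrix (Fin p) (Fin q) F :=
    { toFun := fun x => u * x
      invFun := fun x => uᴴ * x
      left_inv := fun x => by beta_reduce; rw [← Matrix.mul_assoc, hu, Matrix.one_mul]
      right_inv := fun x => by beta_reduce; rw [← Matrix.mul_assoc, hu', Matrix.one_mul]
      isometry_toFun := Isometry.of_dist_eq fun x y => by
        rw [dist_eq_norm, dist_eq_norm, ← Matrix.mul_sub, norm_mul_of_conjTranspose_mul_self hu] }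
  refine map_stiefelMeasure_of_isometry e (Set.ext fun x => ?_)
  change (u * x)ᴴ * (u * x) = 1 ↔ xᴴ * x = 1
  rw [conjTranspose_mul, Matrix.mul_assoc, ← Matrix.mul_assoc uᴴ, hu, Matrix.one_mul]

theorem map_mul_right_stiefelMeasure {w : Matrix (Fin q) (Fin q) F} (hw : wᴴ * w = 1) :
    (stiefelMeasure F p q).map (fun x => x * w) = stiefelMeasure F p q := by
  have hw' := mul_conjTranspose_eq_one rfl hw
  let e : Matrix (Fin p) (Fin q) F ≃ᵢ Matrix (Fin p) (Fin q) F :=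
    { toFun := fun x => x * w
      invFun := fun x => x * wᴴ
      left_inv := fun x => by beta_reduce; rw [Matrix.mul_assoc, hw', Matrix.mul_one]
      right_inv := fun x => by beta_reduce; rw [Matrix.mul_assoc, hw, Matrix.mul_one]
      isometry_toFun := Isometry.of_dist_eq fun x y => by
        rw [dist_eq_norm, dist_eq_norm, ← Matrix.sub_mul, norm_mul_of_mul_conjTranspose_self hw'] }
  refine map_stiefelMeasure_of_isometry e (Set.ext fun x => ?_)
  change (x * w)ᴴ * (x * w) = 1 ↔ xᴴ * x = 1
  rw [conjTranspose_mul, Matrix.mul_assoc, ← Matrix.mul_assoc xᴴ]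
  constructor
  · intro h
    calc xᴴ * x = w * (wᴴ * (xᴴ * x * w)) * wᴴ := by
          simp only [Matrix.mul_assoc, hw', Matrix.mul_one]
          rw [← Matrix.mul_assoc, hw', Matrix.one_mul]
      _ = 1 := by rw [h, Matrix.mul_one, hw']
  · intro h
    rw [h, Matrix.one_mul, hw]

theorem measurable_mul_left {κ : Type*} [Fintype κ] (u : Matrix (Fin p) (Fin p) F) :
    Measurable fun x : Matrix (Fin p) κ F => u * x :=
  (mulCLM u).continuous.measurable

theorem measurable_mul_right {ι : Type*} [Fintype ι] (w : Matrix (Fin q) κ F) [Fintype κ] :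
    Measurable fun x : Matrix ι (Fin q) F => x * w :=
  (mulCLM.flip w).continuous.measurable

theorem measurable_matrix_mul {ι κ μ : Type*} [Fintype ι] [Fintype κ] [Fintype μ] :
    Measurable fun z : Matrix ι κ F × Matrix κ μ F => z.1 * z.2 :=
  continuous_matrix_mul.measurable

theorem lintegral_mul_left_stiefel {u : Matrix (Fin p) (Fin p) F} (hu : uᴴ * u = 1)
    {f : Matrix (Fin p) (Fin q) F → ℝ≥0∞} (hf : Measurable f) :
    ∫⁻ x, f (u * x) ∂(stiefelMeasure F p q) = ∫⁻ x, f x ∂(stiefelMeasure F p q) := by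
  conv_rhs => rw [← map_mul_left_stiefelMeasure hu]
  rw [lintegral_map hf (measurable_mul_left u)]

theorem lintegral_mul_right_stiefel {w : Matrix (Fin q) (Fin q) F} (hw : wᴴ * w = 1)
    {f : Matrix (Fin p) (Fin q) F → ℝ≥0∞} (hf : Measurable f) :
    ∫⁻ x, f (x * w) ∂(stiefelMeasure F p q) = ∫⁻ x, f x ∂(stiefelMeasure F p q) := by
  conv_rhs => rw [← map_mul_right_stiefelMeasure hw]
  rw [lintegral_map hf (measurable_mul_right w)]

/-- The normalized measure of the Stiefel manifold is the orbital measure of each of its points. -/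
theorem lintegral_unitary_mul (h : q ≤ p) {y : Matrix (Fin p) (Fin q) F} (hy : y ∈ stiefel F p q)
    {f : Matrix (Fin p) (Fin q) F → ℝ≥0∞} (hf : Measurable f) :
    ∫⁻ u, f (u * y) ∂(stiefelMeasure F p p) = ∫⁻ x, f x ∂(stiefelMeasure F p q) := by
  have hp1 := isProbabilityMeasure_stiefelMeasure (F := F) (le_refl p)
  have hp2 := isProbabilityMeasure_stiefelMeasure (F := F) h
  -- The orbital average does not depend on the base point: `y' = w y` with `w` unitary, and `u ↦ u
  -- w` preserves the measure on the unitary group. Averaging over `y'` and exchanging the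
  -- integrals, the left invariance of the Stiefel measure removes `u`.
  have hconst : ∀ y' ∈ stiefel F p q, ∫⁻ u, f (u * y') ∂(stiefelMeasure F p p) =
      ∫⁻ u, f (u * y) ∂(stiefelMeasure F p p) := by
    intro y' hy'
    obtain ⟨w, hw, -, rfl⟩ := exists_unitary_mul_eq hy hy' (by simpa using h)
    have := lintegral_mul_right_stiefel hw (f := fun u => f (u * y))
      (hf.comp (measurable_mul_right y))
    simpa only [Matrix.mul_assoc] using this
  have hmeas : Measurable fun z : Matrix (Fin p) (Fin p) F × Matrix (Fin p) (Fin q) F =>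
      f (z.1 * z.2) := hf.comp measurable_matrix_mul
  calc ∫⁻ u, f (u * y) ∂(stiefelMeasure F p p)
      = ∫⁻ _y' : Matrix (Fin p) (Fin q) F, ∫⁻ u, f (u * y) ∂(stiefelMeasure F p p)
          ∂(stiefelMeasure F p q) := by
        rw [lintegral_const, measure_univ, mul_one]
    _ = ∫⁻ y', ∫⁻ u, f (u * y') ∂(stiefelMeasure F p p) ∂(stiefelMeasure F p q) := by
        refine lintegral_congr_ae ?_
        filter_upwards [ae_mem_stiefel] with y' hy' using (hconst y' hy').symm
    _ = ∫⁻ u, ∫⁻ y', f (u * y') ∂(stiefelMeasure F p q) ∂(stiefelMeasure F p p) :=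
        (lintegral_lintegral_swap hmeas.aemeasurable).symm
    _ = ∫⁻ _u, ∫⁻ y', f y' ∂(stiefelMeasure F p q) ∂(stiefelMeasure F p p) := by
        refine lintegral_congr_ae ?_
        filter_upwards [ae_mem_stiefel] with u hu using lintegral_mul_left_stiefel hu hf
    _ = _ := by rw [lintegral_const, measure_univ, mul_one]

end StiefelMeasure

/-! ### Polar decomposition of the Gaussian measure -/

section Polar

variable {F : Type*} [NormedDivisionRing F] [StarRing F] [InnerProductSpace ℝ F]
  [IsRealComplexOrQuaternion F]
variable {m q : ℕ}

open Classical in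
/-- The square root on the cone, extended by zero. -/
def coneSqrt (r : Herm F q) : Matrix (Fin q) (Fin q) F :=
  if r ∈ posCone F q then msqrt (r : Matrix (Fin q) (Fin q) F) else 0

open Classical in
/-- The inverse square root on the cone, extended by zero. -/
def coneInvSqrt (r : Herm F q) : Matrix (Fin q) (Fin q) F :=
  if r ∈ posCone F q then Ring.inverse (msqrt (r : Matrix (Fin q) (Fin q) F)) else 0

theorem coneSqrt_eq {r : Herm F q} (hr : r ∈ posCone F q) :
    coneSqrt r = msqrt (r : Matrix (Fin q) (Fin q) F) := if_pos hr

theorem coneInvSqrt_eq {r : Herm F q} (hr : r ∈ posCone F q) :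
    coneInvSqrt r = Ring.inverse (msqrt (r : Matrix (Fin q) (Fin q) F)) := if_pos hr

theorem isPosDef_coneSqrt {r : Herm F q} (hr : r ∈ posCone F q) : IsPosDef (coneSqrt r) := by
  rw [coneSqrt_eq hr]; exact isPosDef_msqrt hr

theorem coneSqrt_mul_self {r : Herm F q} (hr : r ∈ posCone F q) :
    coneSqrt r * coneSqrt r = (r : Matrix (Fin q) (Fin q) F) := by
  rw [coneSqrt_eq hr, msqrt_mul_msqrt hr]

theorem isPosDef_coneInvSqrt {r : Herm F q} (hr : r ∈ posCone F q) : IsPosDef (coneInvSqrt r) := by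
  rw [coneInvSqrt_eq hr]; exact (isPosDef_msqrt hr).inverse

theorem coneSqrt_mul_coneInvSqrt {r : Herm F q} (hr : r ∈ posCone F q) :
    coneSqrt r * coneInvSqrt r = 1 := by
  rw [coneSqrt_eq hr, coneInvSqrt_eq hr, (isPosDef_msqrt hr).mul_inverse]

theorem coneInvSqrt_mul_coneSqrt {r : Herm F q} (hr : r ∈ posCone F q) :
    coneInvSqrt r * coneSqrt r = 1 := by
  rw [coneSqrt_eq hr, coneInvSqrt_eq hr, (isPosDef_msqrt hr).inverse_mul]

theorem coneInvSqrt_conj {r : Herm F q} (hr : r ∈ posCone F q) :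
    coneInvSqrt r * (r : Matrix (Fin q) (Fin q) F) * coneInvSqrt r = 1 := by
  rw [← coneSqrt_mul_self hr, ← Matrix.mul_assoc, coneInvSqrt_mul_coneSqrt hr, Matrix.one_mul,
    coneSqrt_mul_coneInvSqrt hr]

/-- Continuous on the open cone and constant off it, hence Borel; `msqrt` itself is controlled only
on the cone. -/
theorem measurable_coneSqrt : Measurable (coneSqrt (F := F) (q := q)) := by
  classical
  exact ContinuousOn.measurable_piecewise (s := posCone F q) continuousOn_msqrt
    (continuousOn_const (c := (0 : Matrix (Fin q) (Fin q) F))) measurableSet_posCone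

theorem measurable_coneInvSqrt : Measurable (coneInvSqrt (F := F) (q := q)) := by
  classical
  refine ContinuousOn.measurable_piecewise (s := posCone F q)
    (f := fun r : Herm F q => Ring.inverse (msqrt (r : Matrix (Fin q) (Fin q) F))) (fun r hr => ?_)
    (continuousOn_const (c := (0 : Matrix (Fin q) (Fin q) F))) measurableSet_posCone
  have h1 := (contDiffAt_mul_inverse (isPosDef_msqrt hr) (1 : Matrix (Fin q) (Fin q) F)).continuousAt
  have h2 : ContinuousAt (fun r : Herm F q =>
      ((1 : Matrix (Fin q) (Fin q) F), msqrt (r : Matrix (Fin q) (Fin q) F))) r :=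
    continuousAt_const.prodMk (contDiffAt_msqrt hr).continuousAt
  have h3 := ContinuousAt.comp (f := fun r : Herm F q =>
      ((1 : Matrix (Fin q) (Fin q) F), msqrt (r : Matrix (Fin q) (Fin q) F))) h1 h2
  simp only [Function.comp_def, Matrix.one_mul] at h3
  exact h3.continuousWithinAt

theorem mul_coneInvSqrt_mem_stiefel {x : Matrix (Fin m) (Fin q) F} (hx : gram x ∈ posCone F q) :
    x * coneInvSqrt (gram x) ∈ stiefel F m q := by
  rw [mem_stiefel, conjTranspose_mul, (isPosDef_coneInvSqrt hx).1, Matrix.mul_assoc,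
    ← Matrix.mul_assoc xᴴ, ← coe_gram, ← Matrix.mul_assoc, coneInvSqrt_conj hx]

theorem gram_mul_coneSqrt {s : Matrix (Fin m) (Fin q) F} (hs : s ∈ stiefel F m q) {r : Herm F q}
    (hr : r ∈ posCone F q) : gram (s * coneSqrt r) = r := by
  refine Subtype.ext ?_
  rw [coe_gram, conjTranspose_mul, (isPosDef_coneSqrt hr).1, Matrix.mul_assoc,
    ← Matrix.mul_assoc sᴴ, mem_stiefel.1 hs, Matrix.one_mul, coneSqrt_mul_self hr]

theorem lintegral_mul_left_gaussM {u : Matrix (Fin m) (Fin m) F} (hu : uᴴ * u = 1)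
    {f : Matrix (Fin m) (Fin q) F → ℝ≥0∞} (hf : Measurable f) :
    ∫⁻ x, f (u * x) ∂(gaussM F m q) = ∫⁻ x, f x ∂(gaussM F m q) := by
  have hu' := mul_conjTranspose_eq_one rfl hu
  let e : Matrix (Fin m) (Fin q) F ≃ₗᵢ[ℝ] Matrix (Fin m) (Fin q) F :=
    { toFun := fun x => u * x
      invFun := fun x => uᴴ * x
      map_add' := Matrix.mul_add u
      map_smul' := fun c x => Matrix.mul_smul u c x
      left_inv := fun x => by beta_reduce; rw [← Matrix.mul_assoc, hu, Matrix.one_mul]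
      right_inv := fun x => by beta_reduce; rw [← Matrix.mul_assoc, hu', Matrix.one_mul]
      norm_map' := norm_mul_of_conjTranspose_mul_self hu }
  rw [lintegral_gaussM (f := fun x => f (u * x)) (hf.comp (measurable_mul_left u)),
    lintegral_gaussM hf, ← e.measurePreserving.lintegral_comp
      (f := fun x => ENNReal.ofReal (Real.exp (-‖x‖ ^ 2)) * f x) (measurable_gauss_density.mul hf)]
  refine lintegral_congr fun x => ?_
  have : ‖e x‖ = ‖x‖ := e.norm_map x
  rw [this]
  rfl

/-- Polar decomposition of the Gaussian measure. -/
theorem lintegral_gaussM_polar (hq : 1 ≤ q) (hm : q ≤ m) {f : Matrix (Fin m) (Fin q) F → ℝ≥0∞}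
    (hf : Measurable f) :
    ∫⁻ x, f x ∂(gaussM F m q) =
      ∫⁻ x, ∫⁻ s, f (s * coneSqrt (gram x)) ∂(stiefelMeasure F m q) ∂(gaussM F m q) := by
  have hp := isProbabilityMeasure_stiefelMeasure (F := F) (le_refl m)
  have hp2 := isProbabilityMeasure_stiefelMeasure (F := F) hm
  have hmeas : Measurable fun z : Matrix (Fin m) (Fin m) F × Matrix (Fin m) (Fin q) F =>
      f (z.1 * z.2) := hf.comp measurable_matrix_mul
  calc ∫⁻ x, f x ∂(gaussM F m q)
      = ∫⁻ _u : Matrix (Fin m) (Fin m) F, ∫⁻ x, f x ∂(gaussM F m q) ∂(stiefelMeasure F m m) := by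
        rw [lintegral_const, measure_univ, mul_one]
    _ = ∫⁻ u, ∫⁻ x, f (u * x) ∂(gaussM F m q) ∂(stiefelMeasure F m m) := by
        refine lintegral_congr_ae ?_
        filter_upwards [ae_mem_stiefel] with u hu using (lintegral_mul_left_gaussM hu hf).symm
    _ = ∫⁻ x, ∫⁻ u, f (u * x) ∂(stiefelMeasure F m m) ∂(gaussM F m q) :=
        lintegral_lintegral_swap hmeas.aemeasurable
    _ = _ := by
        refine lintegral_congr_ae ?_
        filter_upwards [ae_gram_mem_posCone hq hm] with x hx
        -- `u x = (u · x r^{-1/2}) r^{1/2}`, and the orbit of the frame `x r^{-1/2}` under the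
        -- unitary group is uniformly distributed.
        rw [← lintegral_unitary_mul hm (mul_coneInvSqrt_mem_stiefel hx)
          (f := fun s => f (s * coneSqrt (gram x))) (hf.comp (measurable_mul_right _))]
        refine lintegral_congr fun u => ?_
        rw [Matrix.mul_assoc, Matrix.mul_assoc, coneInvSqrt_mul_coneSqrt hx, Matrix.mul_one]

theorem measurable_polar_inner {f : Matrix (Fin m) (Fin q) F → ℝ≥0∞} (hf : Measurable f)
    [SFinite (stiefelMeasure F m q)] :
    Measurable fun r : Herm F q => ∫⁻ s, f (s * coneSqrt r) ∂(stiefelMeasure F m q) := by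
  refine Measurable.lintegral_prod_right'
    (f := fun z : Herm F q × Matrix (Fin m) (Fin q) F => f (z.2 * coneSqrt z.1)) ?_
  exact hf.comp (measurable_matrix_mul.comp
    (measurable_snd.prodMk (measurable_coneSqrt.comp measurable_fst)))

/-- In the polar formula the inner integral depends on `x` only through `x* x`, whose law is
Wishart. -/
theorem lintegral_gaussM_cone (hq : 1 ≤ q) (hm : q ≤ m) {f : Matrix (Fin m) (Fin q) F → ℝ≥0∞}
    (hf : Measurable f) :
    gammaL F q (scalarDim F * m / 2) * ∫⁻ x, f x ∂(gaussM F m q) =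
      ENNReal.ofReal (gaussMass F m q) * ∫⁻ r in posCone F q, coneDensity (scalarDim F * m / 2) r *
        ∫⁻ s, f (s * coneSqrt r) ∂(stiefelMeasure F m q) := by
  have hp2 := isProbabilityMeasure_stiefelMeasure (F := F) hm
  rw [lintegral_gaussM_polar hq hm hf, lintegral_gram_gaussM hq hm (measurable_polar_inner hf)]

/-- The angular part of a Gaussian matrix is uniformly distributed on the Stiefel manifold. -/
theorem lintegral_gaussM_angular (hq : 1 ≤ q) (hm : q ≤ m) {f : Matrix (Fin m) (Fin q) F → ℝ≥0∞}
    (hf : Measurable f) :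
    ∫⁻ x, f (x * coneInvSqrt (gram x)) ∂(gaussM F m q) =
      ENNReal.ofReal (gaussMass F m q) * ∫⁻ s, f s ∂(stiefelMeasure F m q) := by
  have hmeas : Measurable fun x : Matrix (Fin m) (Fin q) F => f (x * coneInvSqrt (gram x)) :=
    hf.comp (measurable_matrix_mul.comp
      (measurable_id.prodMk (measurable_coneInvSqrt.comp continuous_gram.measurable)))
  rw [lintegral_gaussM_polar hq hm hmeas, ← gaussM_univ, mul_comm, ← lintegral_const]
  refine lintegral_congr_ae ?_
  filter_upwards [ae_gram_mem_posCone hq hm] with x hx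
  refine lintegral_congr_ae ?_
  filter_upwards [ae_mem_stiefel] with s hs
  rw [gram_mul_coneSqrt hs hx, Matrix.mul_assoc, coneSqrt_mul_coneInvSqrt hx, Matrix.mul_one]

end Polar

/-! ### The matrix beta integral over the ball -/

section Beta

variable {F : Type*} [NormedDivisionRing F] [StarRing F] [InnerProductSpace ℝ F]
  [IsRealComplexOrQuaternion F]
variable {k m q : ℕ}

/-- `1 - v* v` as a Hermitian matrix. -/
def defect (v : Matrix (Fin k) (Fin q) F) : Herm F q := hermOne F q - gram v

@[simp] theorem coe_defect (v : Matrix (Fin k) (Fin q) F) :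
    (defect v : Matrix (Fin q) (Fin q) F) = 1 - vᴴ * v := rfl

theorem contDiff_defect {n : WithTop ℕ∞} :
    ContDiff ℝ n (defect : Matrix (Fin k) (Fin q) F → Herm F q) :=
  contDiff_const.sub contDiff_gram

theorem measurable_defect : Measurable (defect : Matrix (Fin k) (Fin q) F → Herm F q) :=
  (contDiff_defect (F := F) (k := k) (q := q) (n := 0)).continuous.measurable

theorem mem_matBall {v : Matrix (Fin k) (Fin q) F} : v ∈ matBall F k q ↔ defect v ∈ posCone F q :=
  Iff.rfl

theorem isOpen_matBall : IsOpen (matBall F k q) :=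
  isOpen_posCone.preimage (contDiff_defect (F := F) (k := k) (q := q) (n := 0)).continuous

theorem measurableSet_matBall : MeasurableSet (matBall F k q) := isOpen_matBall.measurableSet

/-- The cone point `r^{1/2} (1 - v* v) r^{1/2}`. -/
def ballCone (r : Herm F q) (v : Matrix (Fin k) (Fin q) F) : Herm F q :=
  congruence (coneSqrt r) (defect v)

theorem ballCone_mem_iff {r : Herm F q} (hr : r ∈ posCone F q) {v : Matrix (Fin k) (Fin q) F} :
    ballCone r v ∈ posCone F q ↔ v ∈ matBall F k q :=
  congruence_mem_posCone_iff (isPosDef_coneSqrt hr)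

/-- The identity behind the change of variables: `x = v r^{1/2}` and `r' = ballCone r v` satisfy `x*
x + r' = r`. -/
theorem ballCone_add {r : Herm F q} (hr : r ∈ posCone F q) (v : Matrix (Fin k) (Fin q) F) :
    ballCone r v = r - gram (v * coneSqrt r) := by
  refine Subtype.ext ?_
  change coneSqrt r * (1 - vᴴ * v) * (coneSqrt r)ᴴ =
    (r : Matrix (Fin q) (Fin q) F) - (v * coneSqrt r)ᴴ * (v * coneSqrt r)
  rw [(isPosDef_coneSqrt hr).1, conjTranspose_mul, (isPosDef_coneSqrt hr).1, Matrix.mul_sub,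
    Matrix.sub_mul, Matrix.mul_one, coneSqrt_mul_self hr]
  simp only [Matrix.mul_assoc]

theorem jdet_coneSqrt {r : Herm F q} (hr : r ∈ posCone F q) (w : ℝ) :
    jdet (coneSqrt r) ^ w = jdet (r : Matrix (Fin q) (Fin q) F) ^ (w / 2) := by
  have h := isPosDef_coneSqrt hr
  rw [← coneSqrt_mul_self hr, jdet_sq h, ← Real.rpow_natCast, ← Real.rpow_mul h.jdet_pos.le]
  congr 1
  push_cast
  ring

theorem jdet_ballCone {r : Herm F q} (hr : r ∈ posCone F q) {v : Matrix (Fin k) (Fin q) F}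
    (hv : v ∈ matBall F k q) : jdet (ballCone r v : Matrix (Fin q) (Fin q) F) =
      jdet (r : Matrix (Fin q) (Fin q) F) * jdet (1 - vᴴ * v) := by
  have h := isPosDef_coneSqrt hr
  have hv' : IsPosDef (1 - vᴴ * v) := hv
  rw [ballCone, coe_congruence, h.1, coe_defect, jdet_conj h hv', ← jdet_sq h, coneSqrt_mul_self hr]

/-- Two elementary substitutions: translate the cone variable by `x* x`, then, with the sum `r`
fixed, put `x = v r^{1/2}`, whose Jacobian is `Δ(r)^{dk/2}`. -/
theorem lintegral_matrix_cone {g : Matrix (Fin k) (Fin q) F × Herm F q → ℝ≥0∞}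
    (hg : Measurable g) :
    ∫⁻ x : Matrix (Fin k) (Fin q) F, ∫⁻ r in posCone F q, g (x, r) =
      ∫⁻ r in posCone F q, ENNReal.ofReal (jdet (r : Matrix (Fin q) (Fin q) F) ^
        (scalarDim F * k / 2)) * ∫⁻ v in matBall F k q, g (v * coneSqrt r, ballCone r v) := by
  -- Extension by zero, so that translation and the exchange of integrals take place on the whole
  -- space `H_q`.
  set G : Matrix (Fin k) (Fin q) F × Herm F q → ℝ≥0∞ :=
    (Prod.snd ⁻¹' posCone F q).indicator g with hG
  have hGm : Measurable G := hg.indicator (measurable_snd measurableSet_posCone)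
  have hsub : Measurable fun z : Matrix (Fin k) (Fin q) F × Herm F q => G (z.1, z.2 - gram z.1) :=
    hGm.comp (measurable_fst.prodMk
      (measurable_snd.sub (continuous_gram.measurable.comp measurable_fst)))
  have hsr : ∀ r : Herm F q, Measurable fun x : Matrix (Fin k) (Fin q) F => G (x, r - gram x) :=
    fun r => hsub.comp measurable_prodMk_right
  have hGi : ∀ x r, G (x, r) = (posCone F q).indicator (fun r => g (x, r)) r := fun x r => rfl
  calc ∫⁻ x : Matrix (Fin k) (Fin q) F, ∫⁻ r in posCone F q, g (x, r)
      = ∫⁻ x : Matrix (Fin k) (Fin q) F, ∫⁻ r, G (x, r - gram x) := by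
        refine lintegral_congr fun x => ?_
        rw [lintegral_sub_right_eq_self (fun r => G (x, r))]
        simp only [hGi]
        rw [lintegral_indicator measurableSet_posCone]
    _ = ∫⁻ r : Herm F q, ∫⁻ x : Matrix (Fin k) (Fin q) F, G (x, r - gram x) :=
        lintegral_lintegral_swap hsub.aemeasurable
    _ = ∫⁻ r in posCone F q, ∫⁻ x : Matrix (Fin k) (Fin q) F, G (x, r - gram x) := by
        rw [← lintegral_indicator measurableSet_posCone]
        refine lintegral_congr fun r => ?_
        by_cases hr : r ∈ posCone F q
        · rw [Set.indicator_of_mem hr]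
        -- If `r - x* x` is positive definite then so is `r`; other `r` contribute nothing.
        · rw [Set.indicator_of_notMem hr, lintegral_eq_zero_iff (hsr r)]
          refine ae_of_all _ fun x => ?_
          refine Set.indicator_of_notMem (fun h => hr ?_) _
          have h1 := IsPosDef.add_conjTranspose_mul_self (x := ((r - gram x : Herm F q) :
            Matrix (Fin q) (Fin q) F)) h x
          have h2 : ((r - gram x : Herm F q) : Matrix (Fin q) (Fin q) F) + xᴴ * x = r := by
            rw [Submodule.coe_sub, coe_gram, sub_add_cancel]
          rwa [h2] at h1
    _ = _ := by
        refine setLIntegral_congr_fun measurableSet_posCone fun r hr => ?_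
        rw [lintegral_eq_rmul (isPosDef_coneSqrt hr) (hsr r),
          jdet_coneSqrt hr, Fintype.card_fin, ← lintegral_indicator measurableSet_matBall]
        congr 1
        refine lintegral_congr fun v => ?_
        rw [← ballCone_add hr, hGi]
        by_cases hv : v ∈ matBall F k q
        · rw [Set.indicator_of_mem hv, Set.indicator_of_mem ((ballCone_mem_iff hr).2 hv)]
        · rw [Set.indicator_of_notMem hv,
            Set.indicator_of_notMem fun h => hv ((ballCone_mem_iff hr).1 h)]

/-- The matrix-variate beta integral, in the form of a change of variables. -/
theorem lintegral_gaussM_coneDensity {φ : Matrix (Fin k) (Fin q) F × Herm F q → ℝ≥0∞}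
    (hφ : Measurable φ) :
    ∫⁻ x, (∫⁻ r in posCone F q, coneDensity (scalarDim F * m / 2) r * φ (x, r)) ∂(gaussM F k q) =
      ∫⁻ r in posCone F q, coneDensity (scalarDim F * ((k + m : ℕ) : ℝ) / 2) r *
        ∫⁻ v in matBall F k q, ENNReal.ofReal (jdet (1 - vᴴ * v) ^
          (scalarDim F / 2 * m - hermDim F q / q)) * φ (v * coneSqrt r, ballCone r v) := by
  set g : Matrix (Fin k) (Fin q) F × Herm F q → ℝ≥0∞ := fun z =>
    ENNReal.ofReal (Real.exp (-‖z.1‖ ^ 2)) * (coneDensity (scalarDim F * m / 2) z.2 * φ z) with hg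
  have hgm : Measurable g := (measurable_gauss_density.comp measurable_fst).mul
    (((measurable_coneDensity _).comp measurable_snd).mul hφ)
  have hinner : Measurable fun x : Matrix (Fin k) (Fin q) F =>
      ∫⁻ r in posCone F q, coneDensity (scalarDim F * m / 2) r * φ (x, r) :=
    Measurable.lintegral_prod_right'
      (f := fun z : Matrix (Fin k) (Fin q) F × Herm F q =>
        coneDensity (scalarDim F * m / 2) z.2 * φ z)
      (((measurable_coneDensity _).comp measurable_snd).mul hφ)
  rw [lintegral_gaussM hinner]
  have h1 : ∀ x : Matrix (Fin k) (Fin q) F, ENNReal.ofReal (Real.exp (-‖x‖ ^ 2)) *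
      ∫⁻ r in posCone F q, coneDensity (scalarDim F * m / 2) r * φ (x, r) =
      ∫⁻ r in posCone F q, g (x, r) := fun x => by
    rw [← lintegral_const_mul' _ _ ENNReal.ofReal_ne_top]
  simp only [h1]
  rw [lintegral_matrix_cone hgm]
  refine setLIntegral_congr_fun measurableSet_posCone fun r hr => ?_
  have hr' : IsPosDef (r : Matrix (Fin q) (Fin q) F) := hr
  have hr0 := hr'.jdet_pos
  rw [← lintegral_const_mul' _ _ ENNReal.ofReal_ne_top,
    ← lintegral_const_mul' _ _ (by exact ENNReal.ofReal_ne_top)]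
  refine setLIntegral_congr_fun measurableSet_matBall fun v hv => ?_
  have hv0 : 0 < jdet (1 - vᴴ * v) := IsPosDef.jdet_pos hv
  have h2 : inner ℝ (hermOne F q) (ballCone r v) =
      inner ℝ (hermOne F q) r - ‖v * coneSqrt r‖ ^ 2 := by
    rw [ballCone_add hr, inner_sub_right, inner_hermOne_gram]
  simp only [hg, coneDensity]
  rw [h2, jdet_ballCone hr hv, ← mul_assoc, ← mul_assoc, ← mul_assoc,
    ← ENNReal.ofReal_mul (by positivity), ← ENNReal.ofReal_mul (by positivity),
    ← ENNReal.ofReal_mul (by positivity)]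
  congr 2
  rw [Real.mul_rpow hr0.le hv0.le]
  -- The Jacobian `Δ(r)^{dk/2}` combines with the `r`-factor of `Δ(ballCone r v)^{dm/2 - n/q}`, and
  -- the exponentials combine because `|x|² + tr r' = tr r`.
  have h3 : scalarDim F * ((k + m : ℕ) : ℝ) / 2 - hermDim F q / q =
      scalarDim F * k / 2 + (scalarDim F * m / 2 - hermDim F q / q) := by
    push_cast; ring
  have h4 : scalarDim F / 2 * m - hermDim F q / q = scalarDim F * m / 2 - hermDim F q / q := by ring
  have h5 : Real.exp (-‖v * coneSqrt r‖ ^ 2) *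
      Real.exp (-(inner ℝ (hermOne F q) r - ‖v * coneSqrt r‖ ^ 2)) =
      Real.exp (-inner ℝ (hermOne F q) r) := by
    rw [← Real.exp_add]; congr 1; ring
  rw [h3, h4, Real.rpow_add hr0, ← h5]
  ring

/-- The integral of `Δ(1 - v* v)^η` over the ball. -/
def ballIntegral (F : Type*) [NormedDivisionRing F] [StarRing F] [InnerProductSpace ℝ F]
    [IsRealComplexOrQuaternion F] (k q : ℕ) (η : ℝ) : ℝ≥0∞ :=
  ∫⁻ v in matBall F k q, ENNReal.ofReal (jdet (1 - vᴴ * v) ^ η)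

/-- The change of variables for the constant function `1`. As an identity in `[0, ∞]` it needs no
convergence, and it yields finiteness of the ball integral as well as its value. -/
theorem gammaL_mul_ballIntegral :
    gammaL F q (scalarDim F * ((k + m : ℕ) : ℝ) / 2) *
      ballIntegral F k q (scalarDim F / 2 * m - hermDim F q / q) =
    ENNReal.ofReal (gaussMass F k q) * gammaL F q (scalarDim F * m / 2) := by
  have h := lintegral_gaussM_coneDensity (F := F) (k := k) (m := m) (q := q) (φ := fun _ => 1)
    measurable_const
  simp only [mul_one] at h
  rw [lintegral_const, gaussM_univ, lintegral_mul_const _ (measurable_coneDensity _)] at h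
  rw [mul_comm (ENNReal.ofReal _)]
  exact h.symm

theorem ballIntegral_lt_top (hq : 1 ≤ q) (hm : q ≤ m) :
    ballIntegral F k q (scalarDim F / 2 * m - hermDim F q / q) < ⊤ := by
  by_contra h
  rw [not_lt, top_le_iff] at h
  have h1 := gammaL_mul_ballIntegral (F := F) (k := k) (m := m) (q := q)
  rw [h, ENNReal.mul_top (gammaL_ne_zero _)] at h1
  exact (ENNReal.mul_lt_top ENNReal.ofReal_lt_top (gammaL_lt_top hq hm)).ne h1.symm

theorem ballIntegral_ne_zero :
    ballIntegral F k q (scalarDim F / 2 * m - hermDim F q / q) ≠ 0 := by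
  intro h
  have h1 := gammaL_mul_ballIntegral (F := F) (k := k) (m := m) (q := q)
  rw [h, mul_zero] at h1
  exact mul_ne_zero (ENNReal.ofReal_pos.2 (gaussMass_pos k)).ne' (gammaL_ne_zero _) h1.symm

end Beta

/-- Uniqueness of Haar measure. The constant may stay unknown, since total mass fixes the final
normalization. -/
theorem exists_volume_eq_smul_map_prod {E₁ E₂ E : Type*}
    [NormedAddCommGroup E₁] [InnerProductSpace ℝ E₁] [FiniteDimensional ℝ E₁] [MeasurableSpace E₁]
    [BorelSpace E₁] [NormedAddCommGroup E₂] [InnerProductSpace ℝ E₂] [FiniteDimensional ℝ E₂]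
    [MeasurableSpace E₂] [BorelSpace E₂] [NormedAddCommGroup E] [InnerProductSpace ℝ E]
    [FiniteDimensional ℝ E] [MeasurableSpace E] [BorelSpace E] (e : (E₁ × E₂) ≃L[ℝ] E) :
    ∃ c : ℝ≥0∞, (volume : Measure E) =
      c • Measure.map e ((volume : Measure E₁).prod (volume : Measure E₂)) := by
  have hH : Measure.IsAddHaarMeasure (Measure.map e
      ((volume : Measure E₁).prod (volume : Measure E₂))) := e.isAddHaarMeasure_map _
  exact ⟨_, Measure.isAddLeftInvariant_eq_smul (volume : Measure E) (Measure.map e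
    ((volume : Measure E₁).prod (volume : Measure E₂)))⟩

/-! ### Splitting a Gaussian matrix into two blocks of rows -/

section Split

variable {F : Type*} [NormedDivisionRing F] [StarRing F] [InnerProductSpace ℝ F]
  [IsRealComplexOrQuaternion F]
variable {k m q : ℕ}

/-- Stacking two matrices on top of each other. -/
def stack (F : Type*) [NormedDivisionRing F] [StarRing F] [InnerProductSpace ℝ F]
    [IsRealComplexOrQuaternion F] (k m q : ℕ) :
    (Matrix (Fin k) (Fin q) F × Matrix (Fin m) (Fin q) F) ≃L[ℝ] Matrix (Fin (k + m)) (Fin q) F :=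
  LinearEquiv.toContinuousLinearEquiv
    { toFun := fun x => (fromRows x.1 x.2).submatrix finSumFinEquiv.symm id
      invFun := fun y => (y.submatrix (finSumFinEquiv ∘ Sum.inl) id,
        y.submatrix (finSumFinEquiv ∘ Sum.inr) id)
      map_add' := fun x y => by
        ext i j
        obtain ⟨l, rfl⟩ := finSumFinEquiv.surjective i
        rcases l with l | l <;> simp
      map_smul' := fun c x => by
        ext i j
        obtain ⟨l, rfl⟩ := finSumFinEquiv.surjective i
        rcases l with l | l <;> simp
      left_inv := fun x => by ext i j <;> simp
      right_inv := fun y => by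
        ext i j
        obtain ⟨l, rfl⟩ := finSumFinEquiv.surjective i
        rcases l with l | l <;> simp }

theorem stack_apply (x : Matrix (Fin k) (Fin q) F × Matrix (Fin m) (Fin q) F) :
    stack F k m q x = (fromRows x.1 x.2).submatrix finSumFinEquiv.symm id := rfl

theorem gram_stack (x : Matrix (Fin k) (Fin q) F × Matrix (Fin m) (Fin q) F) :
    gram (stack F k m q x) = gram x.1 + gram x.2 := by
  refine Subtype.ext ?_
  rw [coe_gram, stack_apply, conjTranspose_submatrix, submatrix_mul_equiv, submatrix_id_id,
    conjTranspose_fromRows_eq_fromCols_conjTranspose, fromCols_mul_fromRows]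
  rfl

theorem stack_mul (x : Matrix (Fin k) (Fin q) F × Matrix (Fin m) (Fin q) F)
    (a : Matrix (Fin q) (Fin q) F) : stack F k m q x * a = stack F k m q (x.1 * a, x.2 * a) := by
  rw [stack_apply, stack_apply, ← fromRows_mul]
  rfl

theorem splitMap_eq (x : Matrix (Fin k) (Fin q) F × Matrix (Fin m) (Fin q) F) :
    splitMap x = stack F k m q (x.1, x.2 * msqrt (defect x.1 : Matrix (Fin q) (Fin q) F)) := rfl

/-- A Borel measurable map which agrees with `splitMap` over the ball. -/
def splitMapM (x : Matrix (Fin k) (Fin q) F × Matrix (Fin m) (Fin q) F) :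
    Matrix (Fin (k + m)) (Fin q) F := stack F k m q (x.1, x.2 * coneSqrt (defect x.1))

theorem splitMapM_eq {x : Matrix (Fin k) (Fin q) F × Matrix (Fin m) (Fin q) F}
    (hx : x.1 ∈ matBall F k q) : splitMapM x = splitMap x := by
  rw [splitMapM, splitMap_eq, coneSqrt_eq hx]

theorem measurable_splitMapM : Measurable (splitMapM (F := F) (k := k) (m := m) (q := q)) :=
  (stack F k m q).continuous.measurable.comp (measurable_fst.prodMk (measurable_matrix_mul.comp
    (measurable_snd.prodMk (measurable_coneSqrt.comp (measurable_defect.comp measurable_fst)))))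

/-- Stacking adds Gram matrices, hence squared norms, so the Gaussian weight factors over the two
blocks. -/
theorem exists_lintegral_gaussM_stack : ∃ c : ℝ≥0∞,
    ∀ f : Matrix (Fin (k + m)) (Fin q) F → ℝ≥0∞, Measurable f →
      ∫⁻ x, f x ∂(gaussM F (k + m) q) =
        c * ∫⁻ x, ∫⁻ y, f (stack F k m q (x, y)) ∂(gaussM F m q) ∂(gaussM F k q) := by
  obtain ⟨c, hc⟩ := exists_volume_eq_smul_map_prod (stack F k m q)
  refine ⟨c, fun f hf => ?_⟩
  have hst : Measurable (stack F k m q) := (stack F k m q).continuous.measurable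
  have hfs : Measurable fun z : Matrix (Fin k) (Fin q) F × Matrix (Fin m) (Fin q) F =>
      f (stack F k m q z) := hf.comp hst
  have hin : Measurable fun x : Matrix (Fin k) (Fin q) F =>
      ∫⁻ y, f (stack F k m q (x, y)) ∂(gaussM F m q) := hfs.lintegral_prod_right'
  have hW : Measurable fun x : Matrix (Fin (k + m)) (Fin q) F =>
      ENNReal.ofReal (Real.exp (-‖x‖ ^ 2)) * f x := measurable_gauss_density.mul hf
  have hWs : Measurable fun z : Matrix (Fin k) (Fin q) F × Matrix (Fin m) (Fin q) F =>
      ENNReal.ofReal (Real.exp (-‖stack F k m q z‖ ^ 2)) * f (stack F k m q z) := hW.comp hst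
  rw [lintegral_gaussM hf, lintegral_gaussM hin, hc, lintegral_smul_measure, smul_eq_mul,
    lintegral_map hW hst, lintegral_prod _ hWs.aemeasurable]
  congr 1
  refine lintegral_congr fun x => ?_
  rw [lintegral_gaussM (f := fun y => f (stack F k m q (x, y)))
      (hfs.comp measurable_prodMk_left),
    ← lintegral_const_mul' _ _ ENNReal.ofReal_ne_top]
  refine lintegral_congr fun y => ?_
  rw [← mul_assoc, ← ENNReal.ofReal_mul (Real.exp_pos _).le, ← Real.exp_add,
    ← inner_hermOne_gram, gram_stack, inner_add_right, inner_hermOne_gram, inner_hermOne_gram,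
    neg_add]

/-- Let `a` be the root of `ballCone r v`. Both `a r^{-1/2}` and `b = (1 - v* v)^{1/2}` have Gram
matrix `1 - v* v`, so `a r^{-1/2} = w b` with `w` unitary, and right invariance of the measure in
`s` absorbs `w`. The result no longer depends on `r`. -/
theorem lintegral_splitMapM_of_unitary {r : Herm F q} (hr : r ∈ posCone F q)
    {v : Matrix (Fin k) (Fin q) F} (hv : v ∈ matBall F k q)
    {f : Matrix (Fin (k + m)) (Fin q) F → ℝ≥0∞} (hf : Measurable f) :
    ∫⁻ s, f (stack F k m q (v * coneSqrt r, s * coneSqrt (ballCone r v)) * coneInvSqrt r)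
        ∂(stiefelMeasure F m q) =
      ∫⁻ s, f (splitMapM (v, s)) ∂(stiefelMeasure F m q) := by
  have hb : ballCone r v ∈ posCone F q := (ballCone_mem_iff hr).2 hv
  set a := coneSqrt (ballCone r v) with ha
  set b := coneSqrt (defect v) with hbdef
  set w := a * coneInvSqrt r * coneInvSqrt (defect v) with hw
  have hi := isPosDef_coneInvSqrt hr
  have hj := isPosDef_coneInvSqrt (mem_matBall.1 hv)
  have hwb : w * b = a * coneInvSqrt r := by
    rw [hw, Matrix.mul_assoc, coneInvSqrt_mul_coneSqrt (mem_matBall.1 hv), Matrix.mul_one]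
  have hww : wᴴ * w = 1 := by
    have h1 : aᴴ * a = coneSqrt r * (1 - vᴴ * v) * coneSqrt r := by
      rw [(isPosDef_coneSqrt hb).1, coneSqrt_mul_self hb, ballCone, coe_congruence,
        (isPosDef_coneSqrt hr).1, coe_defect]
    calc wᴴ * w = coneInvSqrt (defect v) * (coneInvSqrt r * (aᴴ * a) * coneInvSqrt r) *
          coneInvSqrt (defect v) := by
          rw [hw, conjTranspose_mul, conjTranspose_mul, hi.1, hj.1]
          simp only [Matrix.mul_assoc]
      _ = coneInvSqrt (defect v) * (1 - vᴴ * v) * coneInvSqrt (defect v) := by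
          rw [h1, ← Matrix.mul_assoc (coneInvSqrt r), ← Matrix.mul_assoc (coneInvSqrt r),
            coneInvSqrt_mul_coneSqrt hr, Matrix.one_mul, Matrix.mul_assoc (1 - vᴴ * v),
            coneSqrt_mul_coneInvSqrt hr, Matrix.mul_one]
      _ = 1 := coneInvSqrt_conj (mem_matBall.1 hv)
  have hmeas : Measurable fun s : Matrix (Fin m) (Fin q) F => f (splitMapM (v, s)) :=
    hf.comp (measurable_splitMapM.comp measurable_prodMk_left)
  rw [← lintegral_mul_right_stiefel hww hmeas]
  refine lintegral_congr fun s => ?_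
  rw [stack_mul, splitMapM]
  simp only [Matrix.mul_assoc]
  rw [coneSqrt_mul_coneInvSqrt hr, Matrix.mul_one, ← hbdef, hwb]

/-- The Gaussian integral of `f` of the angular part is computed in two ways: on the whole matrix,
where it gives a multiple of the Stiefel integral, and through the two blocks. -/
theorem lintegral_stiefel_split_aux (hq : 1 ≤ q) (hm : q ≤ m) :
    ∃ C : ℝ≥0∞, ∀ f : Matrix (Fin (k + m)) (Fin q) F → ℝ≥0∞, Measurable f →
      ∫⁻ x, f x ∂(stiefelMeasure F (k + m) q) = C * ∫⁻ v in matBall F k q,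
        ENNReal.ofReal (jdet (1 - vᴴ * v) ^ (scalarDim F / 2 * m - hermDim F q / q)) *
          ∫⁻ s, f (splitMapM (v, s)) ∂(stiefelMeasure F m q) := by
  have hpm := isProbabilityMeasure_stiefelMeasure (F := F) hm
  obtain ⟨c, hc⟩ := exists_lintegral_gaussM_stack (F := F) (k := k) (m := m) (q := q)
  set A := ENNReal.ofReal (gaussMass F (k + m) q) with hA
  have hA0 : A ≠ 0 := (ENNReal.ofReal_pos.2 (gaussMass_pos _)).ne'
  set G := gammaL F q (scalarDim F * m / 2) with hG
  have hG0 : G ≠ 0 := gammaL_ne_zero _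
  have hGt : G ≠ ⊤ := (gammaL_lt_top hq hm).ne
  set B := ENNReal.ofReal (gaussMass F m q)
  set G' := gammaL F q (scalarDim F * ((k + m : ℕ) : ℝ) / 2) with hG'
  refine ⟨(G * A)⁻¹ * (c * B * G'), fun f hf => ?_⟩
  set J := ∫⁻ v in matBall F k q,
        ENNReal.ofReal (jdet (1 - vᴴ * v) ^ (scalarDim F / 2 * m - hermDim F q / q)) *
          ∫⁻ s, f (splitMapM (v, s)) ∂(stiefelMeasure F m q) with hJ
  have hfm : Measurable fun x : Matrix (Fin (k + m)) (Fin q) F => f (x * coneInvSqrt (gram x)) :=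
    hf.comp (measurable_matrix_mul.comp
      (measurable_id.prodMk (measurable_coneInvSqrt.comp continuous_gram.measurable)))
  -- The average of `f` of the angular part, given the upper block and the Gram matrix of the lower
  -- block; the Gram matrix of the whole is the sum of the two.
  set φ : Matrix (Fin k) (Fin q) F × Herm F q → ℝ≥0∞ := fun z =>
    ∫⁻ s, f (stack F k m q (z.1, s * coneSqrt z.2) * coneInvSqrt (gram z.1 + z.2))
      ∂(stiefelMeasure F m q) with hφ
  have hφm : Measurable φ := by
    refine Measurable.lintegral_prod_right' (f := fun z : (Matrix (Fin k) (Fin q) F × Herm F q) ×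
      Matrix (Fin m) (Fin q) F =>
        f (stack F k m q (z.1.1, z.2 * coneSqrt z.1.2) * coneInvSqrt (gram z.1.1 + z.1.2))) ?_
    have h1 : Measurable fun z : (Matrix (Fin k) (Fin q) F × Herm F q) ×
        Matrix (Fin m) (Fin q) F => z.1.1 := measurable_fst.comp measurable_fst
    have h2 : Measurable fun z : (Matrix (Fin k) (Fin q) F × Herm F q) ×
        Matrix (Fin m) (Fin q) F => z.1.2 := measurable_snd.comp measurable_fst
    refine hf.comp (measurable_matrix_mul.comp (Measurable.prodMk ?_ ?_))
    · exact (stack F k m q).continuous.measurable.comp (h1.prodMk (measurable_matrix_mul.comp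
        (measurable_snd.prodMk (measurable_coneSqrt.comp h2))))
    · exact measurable_coneInvSqrt.comp ((continuous_gram.measurable.comp h1).add h2)
  have hx : ∀ x : Matrix (Fin k) (Fin q) F,
      G * ∫⁻ y, f (stack F k m q (x, y) * coneInvSqrt (gram (stack F k m q (x, y))))
        ∂(gaussM F m q) =
      B * ∫⁻ r in posCone F q, coneDensity (scalarDim F * m / 2) r * φ (x, r) := by
    intro x
    have hm1 : Measurable fun y : Matrix (Fin m) (Fin q) F =>
        f (stack F k m q (x, y) * coneInvSqrt (gram (stack F k m q (x, y)))) :=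
      hfm.comp ((stack F k m q).continuous.measurable.comp measurable_prodMk_left)
    rw [hG, lintegral_gaussM_cone hq hm hm1]
    congr 1
    refine setLIntegral_congr_fun measurableSet_posCone fun r hr => ?_
    congr 1
    refine lintegral_congr_ae ?_
    filter_upwards [ae_mem_stiefel] with s hs
    rw [gram_stack, gram_mul_coneSqrt hs hr]
  -- In the coordinates `(v, r)` the ball integral does not depend on `r`, so the integral over `r`
  -- contributes only the gamma value `G'`.
  have hmain : G * (A * ∫⁻ x, f x ∂(stiefelMeasure F (k + m) q)) = c * B * G' * J := by
    have h3 := lintegral_gaussM_angular (F := F) hq (hm.trans (Nat.le_add_left m k)) hf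
    rw [← hA] at h3
    rw [← h3, hc _ hfm, mul_left_comm, ← lintegral_const_mul' _ _ hGt]
    simp only [hx]
    rw [lintegral_const_mul' _ _ ENNReal.ofReal_ne_top, lintegral_gaussM_coneDensity hφm,
      mul_assoc, mul_assoc]
    congr 2
    change _ = (∫⁻ r in posCone F q, coneDensity _ r) * J
    rw [← lintegral_mul_const _ (measurable_coneDensity _)]
    refine setLIntegral_congr_fun measurableSet_posCone fun r hr => ?_
    congr 1
    refine setLIntegral_congr_fun measurableSet_matBall fun v hv => ?_
    congr 1
    rw [hφ]
    have : gram (v * coneSqrt r) + ballCone r v = r := by rw [ballCone_add hr, add_sub_cancel]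
    simp only [this]
    exact lintegral_splitMapM_of_unitary hr hv hf
  rw [mul_assoc, ← hmain, ← mul_assoc G, ← mul_assoc, ENNReal.inv_mul_cancel
    (mul_ne_zero hG0 hA0) (ENNReal.mul_ne_top hGt ENNReal.ofReal_ne_top), one_mul]

/-- The splitting formula for the normalized measure of the Stiefel manifold. -/
theorem lintegral_stiefel_split (hq : 1 ≤ q) (hm : q ≤ m)
    {f : Matrix (Fin (k + m)) (Fin q) F → ℝ≥0∞} (hf : Measurable f) :
    ∫⁻ x, f x ∂(stiefelMeasure F (k + m) q) =
      (ballIntegral F k q (scalarDim F / 2 * m - hermDim F q / q))⁻¹ * ∫⁻ v in matBall F k q,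
        ENNReal.ofReal (jdet (1 - vᴴ * v) ^ (scalarDim F / 2 * m - hermDim F q / q)) *
          ∫⁻ s, f (splitMapM (v, s)) ∂(stiefelMeasure F m q) := by
  have hpm := isProbabilityMeasure_stiefelMeasure (F := F) hm
  have hpkm := isProbabilityMeasure_stiefelMeasure (F := F) (hm.trans (Nat.le_add_left m k))
  obtain ⟨C, hC⟩ := lintegral_stiefel_split_aux (F := F) (k := k) hq hm
  rw [hC f hf]
  congr 1
  -- Both Stiefel measures have mass one, so testing on `1` determines `C`.
  have h1 := hC (fun _ => 1) measurable_const
  simp only [lintegral_const, measure_univ, mul_one] at h1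
  exact ENNReal.eq_inv_of_mul_eq_one_left h1.symm

end Split

/-! ### The map `Φ` as a diffeomorphism -/

section Chart

variable {F : Type*} [NormedDivisionRing F] [StarRing F] [InnerProductSpace ℝ F]
  [IsRealComplexOrQuaternion F]
variable {k m q : ℕ}

/-- The inverse of `splitMap`. -/
def splitInv (x : Matrix (Fin (k + m)) (Fin q) F) :
    Matrix (Fin k) (Fin q) F × Matrix (Fin m) (Fin q) F :=
  (((stack F k m q).symm x).1, ((stack F k m q).symm x).2 *
    Ring.inverse (msqrt (defect ((stack F k m q).symm x).1 : Matrix (Fin q) (Fin q) F)))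

/-- The matrices whose upper block lies in the ball. -/
def upperBall (F : Type*) [NormedDivisionRing F] [StarRing F] [InnerProductSpace ℝ F]
    [IsRealComplexOrQuaternion F] (k m q : ℕ) : Set (Matrix (Fin (k + m)) (Fin q) F) :=
  {x | ((stack F k m q).symm x).1 ∈ matBall F k q}

theorem isOpen_upperBall : IsOpen (upperBall F k m q) :=
  isOpen_matBall.preimage (continuous_fst.comp (stack F k m q).symm.continuous)

theorem measurableSet_stiefel_inter_upperBall :
    MeasurableSet (stiefel F (k + m) q ∩ upperBall F k m q) :=
  measurableSet_stiefel.inter isOpen_upperBall.measurableSet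

theorem mapsTo_splitMap : Set.MapsTo splitMap (matBall F k q ×ˢ stiefel F m q)
    (stiefel F (k + m) q ∩ upperBall F k m q) := by
  rintro ⟨v, s⟩ ⟨hv, hs⟩
  have hv' : defect v ∈ posCone F q := hv
  constructor
  · rw [mem_stiefel_iff_gram, splitMap_eq, gram_stack]
    change gram v + gram (s * msqrt (defect v : Matrix (Fin q) (Fin q) F)) = _
    rw [← coneSqrt_eq hv', gram_mul_coneSqrt hs hv', defect, add_sub_cancel]
  · rw [upperBall, Set.mem_ofPred_eq, splitMap_eq, ContinuousLinearEquiv.symm_apply_apply]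
    exact hv

/-- On the Stiefel manifold the Gram matrices of the two blocks add up to `1`; this makes `splitInv`
land in `Σ_{m,q}`. -/
theorem gram_eq_defect {x : Matrix (Fin (k + m)) (Fin q) F} (hx : x ∈ stiefel F (k + m) q) :
    gram ((stack F k m q).symm x).2 = defect ((stack F k m q).symm x).1 := by
  have h := gram_stack ((stack F k m q).symm x)
  rw [ContinuousLinearEquiv.apply_symm_apply, mem_stiefel_iff_gram.1 hx] at h
  rw [defect, h, add_sub_cancel_left]

theorem mapsTo_splitInv : Set.MapsTo splitInv (stiefel F (k + m) q ∩ upperBall F k m q)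
    (matBall F k q ×ˢ stiefel F m q) := by
  rintro x ⟨hx, hx'⟩
  have hd : defect ((stack F k m q).symm x).1 ∈ posCone F q := hx'
  refine ⟨hx', ?_⟩
  have h := mul_coneInvSqrt_mem_stiefel (x := ((stack F k m q).symm x).2)
    (by rw [gram_eq_defect hx]; exact hd)
  rw [gram_eq_defect hx, coneInvSqrt_eq hd] at h
  exact h

theorem invOn_splitInv : Set.InvOn splitInv splitMap (matBall F k q ×ˢ stiefel F m q)
    (stiefel F (k + m) q ∩ upperBall F k m q) := by
  constructor
  · rintro ⟨v, s⟩ ⟨hv, -⟩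
    rw [splitInv, splitMap_eq, ContinuousLinearEquiv.symm_apply_apply]
    refine Prod.ext rfl ?_
    change s * msqrt (defect v : Matrix (Fin q) (Fin q) F) *
      Ring.inverse (msqrt (defect v : Matrix (Fin q) (Fin q) F)) = s
    have hd : IsPosDef (defect v : Matrix (Fin q) (Fin q) F) := hv
    rw [Matrix.mul_assoc, (isPosDef_msqrt hd).mul_inverse, Matrix.mul_one]
  · rintro x ⟨-, hx⟩
    have hd : IsPosDef (defect ((stack F k m q).symm x).1 : Matrix (Fin q) (Fin q) F) := hx
    rw [splitMap_eq, splitInv]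
    dsimp only
    rw [Matrix.mul_assoc, (isPosDef_msqrt hd).inverse_mul, Matrix.mul_one]
    exact (stack F k m q).apply_symm_apply x

theorem splitMap_image : splitMap '' (matBall F k q ×ˢ stiefel F m q) =
    stiefel F (k + m) q ∩ upperBall F k m q :=
  (invOn_splitInv.bijOn mapsTo_splitMap mapsTo_splitInv).image_eq

theorem contDiffAt_splitMap {x : Matrix (Fin k) (Fin q) F × Matrix (Fin m) (Fin q) F}
    (hx : x.1 ∈ matBall F k q) : ContDiffAt ℝ ∞ splitMap x := by
  have h0 : ContDiff ℝ ∞ fun z : Matrix (Fin k) (Fin q) F × Matrix (Fin m) (Fin q) F => z.1 :=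
    contDiff_fst
  have h1 : ContDiffAt ℝ ∞ (fun z : Matrix (Fin k) (Fin q) F × Matrix (Fin m) (Fin q) F =>
      msqrt (defect z.1 : Matrix (Fin q) (Fin q) F)) x :=
    ContDiffAt.comp (f := fun z : Matrix (Fin k) (Fin q) F × Matrix (Fin m) (Fin q) F =>
      defect z.1) x (contDiffAt_msqrt (r := defect x.1) hx)
      (contDiff_defect.comp h0).contDiffAt
  have h2 : ContDiffAt ℝ ∞ (fun z : Matrix (Fin k) (Fin q) F × Matrix (Fin m) (Fin q) F =>
      z.2 * msqrt (defect z.1 : Matrix (Fin q) (Fin q) F)) x :=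
    contDiff_matrix_mul.contDiffAt.comp x (contDiffAt_snd.prodMk h1)
  exact (stack F k m q).contDiff.contDiffAt.comp x (contDiffAt_fst.prodMk h2)

theorem contDiffAt_splitInv {x : Matrix (Fin (k + m)) (Fin q) F} (hx : x ∈ upperBall F k m q) :
    ContDiffAt ℝ ∞ splitInv x := by
  have hs : ContDiff ℝ ∞ (stack F k m q).symm := (stack F k m q).symm.contDiff
  have h0 : ContDiff ℝ ∞ fun z : Matrix (Fin (k + m)) (Fin q) F => ((stack F k m q).symm z).1 :=
    contDiff_fst.comp hs
  have h1 : ContDiffAt ℝ ∞ (fun z : Matrix (Fin (k + m)) (Fin q) F =>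
      msqrt (defect ((stack F k m q).symm z).1 : Matrix (Fin q) (Fin q) F)) x :=
    ContDiffAt.comp (f := fun z : Matrix (Fin (k + m)) (Fin q) F =>
      defect ((stack F k m q).symm z).1) x
      (contDiffAt_msqrt (r := defect ((stack F k m q).symm x).1) hx)
      (contDiff_defect.comp h0).contDiffAt
  have h2 := (contDiffAt_mul_inverse (isPosDef_msqrt hx) ((stack F k m q).symm x).2).comp x
    ((contDiff_snd.comp hs).contDiffAt.prodMk h1)
  exact h0.contDiffAt.prodMk h2

theorem isDiffeoOnto_splitMap : IsDiffeoOnto splitMap (matBall F k q ×ˢ stiefel F m q)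
    (stiefel F (k + m) q ∩ upperBall F k m q) := by
  refine ⟨splitInv, mapsTo_splitMap, mapsTo_splitInv, invOn_splitInv, fun x hx => ?_, fun x hx => ?_⟩
  -- The defining formulas of both maps are already smooth on open sets of the ambient matrix
  -- spaces, so they serve as their own extensions.
  · exact ⟨matBall F k q ×ˢ Set.univ, isOpen_matBall.prod isOpen_univ, ⟨hx.1, trivial⟩, splitMap,
      fun y hy => (contDiffAt_splitMap hy.1).contDiffWithinAt, fun _ _ => rfl⟩
  · exact ⟨upperBall F k m q, isOpen_upperBall, hx.2, splitInv,
      fun y hy => (contDiffAt_splitInv hy).contDiffWithinAt, fun _ _ => rfl⟩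

end Chart

/-! ### Density of the image, the measure formula and its constant -/

section Measure

variable {F : Type*} [NormedDivisionRing F] [StarRing F] [InnerProductSpace ℝ F]
  [IsRealComplexOrQuaternion F]
variable {k m q : ℕ}

/-- The splitting formula applied to the indicator of the complement: it vanishes at every `Φ(v, s)`
with `v` in the ball and `s` on the Stiefel manifold. -/
theorem ae_mem_stiefel_inter_upperBall (hq : 1 ≤ q) (hm : q ≤ m) :
    ∀ᵐ x ∂(stiefelMeasure F (k + m) q), x ∈ stiefel F (k + m) q ∩ upperBall F k m q := by
  have hS := measurableSet_stiefel_inter_upperBall (F := F) (k := k) (m := m) (q := q)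
  rw [ae_iff]
  change stiefelMeasure F (k + m) q (stiefel F (k + m) q ∩ upperBall F k m q)ᶜ = 0
  rw [← lintegral_indicator_one hS.compl,
    lintegral_stiefel_split hq hm (measurable_one.indicator hS.compl)]
  refine mul_eq_zero_of_right _ ?_
  rw [setLIntegral_congr_fun (g := fun _ => 0) measurableSet_matBall fun v hv => ?_,
    lintegral_zero]
  refine mul_eq_zero_of_right _ ?_
  rw [lintegral_congr_ae (g := fun _ => 0) ?_, lintegral_zero]
  filter_upwards [ae_mem_stiefel] with s hs
  refine Set.indicator_of_notMem (Set.notMem_compl_iff.2 ?_) _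
  rw [splitMapM_eq (x := (v, s)) hv]
  exact mapsTo_splitMap ⟨hv, hs⟩

/-- A set of full measure meets each relatively open piece, since such pieces have positive measure.
-/
theorem stiefel_subset_closure (hq : 1 ≤ q) (hm : q ≤ m) :
    stiefel F (k + m) q ⊆ closure (stiefel F (k + m) q ∩ upperBall F k m q) := by
  intro x hx
  refine mem_closure_iff.2 fun W hW hxW => ?_
  have h1 := stiefelMeasure_pos_of_isOpen hx hW hxW
  by_contra h
  refine h1.ne' (measure_mono_null (fun y hy hyS => h ⟨y, hy, hyS⟩)
    (ae_iff.1 (ae_mem_stiefel_inter_upperBall (F := F) (k := k) hq hm)))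

theorem measurable_jdet_defect (η : ℝ) :
    Measurable fun v : Matrix (Fin k) (Fin q) F => jdet (1 - vᴴ * v) ^ η := by
  have h : Measurable fun v : Matrix (Fin k) (Fin q) F =>
      jdet (defect v : Matrix (Fin q) (Fin q) F) ^ η :=
    (measurable_jdet_rpow (F := F) (q := q) η).comp measurable_defect
  exact h

theorem jdet_defect_rpow_nonneg (η : ℝ) :
    0 ≤ᵐ[volume.restrict (matBall F k q)] fun v => jdet (1 - vᴴ * v) ^ η := by
  filter_upwards [ae_restrict_mem measurableSet_matBall] with v hv
  exact (Real.rpow_pos_of_pos (IsPosDef.jdet_pos hv) η).le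

theorem integral_jdet_defect (η : ℝ) :
    ∫ v in matBall F k q, jdet (1 - vᴴ * v) ^ η = (ballIntegral F k q η).toReal :=
  integral_eq_lintegral_of_nonneg_ae (jdet_defect_rpow_nonneg η)
    (measurable_jdet_defect η).aestronglyMeasurable

theorem integrableOn_jdet_defect (hq : 1 ≤ q) (hm : q ≤ m) :
    IntegrableOn (fun v => jdet (1 - vᴴ * v) ^ (scalarDim F / 2 * m - hermDim F q / q))
      (matBall F k q) := by
  refine ⟨(measurable_jdet_defect _).aestronglyMeasurable, ?_⟩
  rw [hasFiniteIntegral_iff_ofReal (jdet_defect_rpow_nonneg _)]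
  exact ballIntegral_lt_top hq hm

theorem inv_integral_jdet_defect (hq : 1 ≤ q) (hm : q ≤ m) :
    (∫ v in matBall F k q, jdet (1 - vᴴ * v) ^ (scalarDim F / 2 * m - hermDim F q / q))⁻¹ =
      Real.pi ^ (-(scalarDim F * k * q / 2)) *
        (coneGamma F q (scalarDim F * ((k + m : ℕ) : ℝ) / 2) /
          coneGamma F q (scalarDim F * m / 2)) := by
  have h := congrArg ENNReal.toReal
    (gammaL_mul_ballIntegral (F := F) (k := k) (m := m) (q := q))
  rw [ENNReal.toReal_mul, ENNReal.toReal_mul, ← coneGamma_eq, ← coneGamma_eq,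
    ENNReal.toReal_ofReal (gaussMass_pos k).le, ← integral_jdet_defect, gaussMass] at h
  have h1 : 0 < coneGamma F q (scalarDim F * m / 2) := by
    rw [coneGamma_eq]
    exact ENNReal.toReal_pos (gammaL_ne_zero _) (gammaL_lt_top hq hm).ne
  have h2 : 0 < ∫ v in matBall F k q,
      jdet (1 - vᴴ * v) ^ (scalarDim F / 2 * m - hermDim F q / q) := by
    rw [integral_jdet_defect]
    exact ENNReal.toReal_pos ballIntegral_ne_zero (ballIntegral_lt_top hq hm).ne
  have h3 : 0 < Real.pi ^ (scalarDim F * k * q / 2) := Real.rpow_pos_of_pos Real.pi_pos _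
  rw [Real.rpow_neg Real.pi_pos.le, ← mul_div_assoc, inv_mul_eq_div, div_div, inv_eq_one_div,
    div_eq_div_iff h2.ne' (mul_pos h3 h1).ne', one_mul, h]

theorem ofReal_inv_integral_jdet_defect (hq : 1 ≤ q) (hm : q ≤ m) :
    ENNReal.ofReal (∫ v in matBall F k q,
        jdet (1 - vᴴ * v) ^ (scalarDim F / 2 * m - hermDim F q / q))⁻¹ =
      (ballIntegral F k q (scalarDim F / 2 * m - hermDim F q / q))⁻¹ := by
  have h := ballIntegral_lt_top (F := F) (k := k) hq hm
  rw [integral_jdet_defect, ENNReal.ofReal_inv_of_pos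
    (ENNReal.toReal_pos ballIntegral_ne_zero h.ne), ENNReal.ofReal_toReal h.ne]

theorem stiefelMeasure_restrict_eq_map (hq : 1 ≤ q) (hm : q ≤ m) :
    (stiefelMeasure F (k + m) q).restrict (stiefel F (k + m) q ∩ upperBall F k m q) =
      ENNReal.ofReal (∫ v in matBall F k q,
          jdet (1 - vᴴ * v) ^ (scalarDim F / 2 * m - hermDim F q / q))⁻¹ •
        Measure.map splitMap (((volume.restrict (matBall F k q)).withDensity fun v =>
          ENNReal.ofReal (jdet (1 - vᴴ * v) ^ (scalarDim F / 2 * m - hermDim F q / q))).prod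
            (stiefelMeasure F m q)) := by
  have hp := isProbabilityMeasure_stiefelMeasure (F := F) hm
  set η := scalarDim F / 2 * m - hermDim F q / q with hη
  have hw : Measurable fun v : Matrix (Fin k) (Fin q) F =>
      ENNReal.ofReal (jdet (1 - vᴴ * v) ^ η) := (measurable_jdet_defect η).ennreal_ofReal
  set ν := (volume.restrict (matBall F k q)).withDensity fun v =>
    ENNReal.ofReal (jdet (1 - vᴴ * v) ^ η) with hν
  have hae : ∀ᵐ v ∂ν, v ∈ matBall F k q :=
    (withDensity_absolutelyContinuous _ _).ae_le (ae_restrict_mem measurableSet_matBall)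
  -- `Measure.map` is `0` for maps that are not almost everywhere measurable. Agreement with the
  -- Borel map `splitMapM` over the ball, which carries `ν`, excludes this.
  have hmap : Measure.map splitMap (ν.prod (stiefelMeasure F m q)) =
      Measure.map splitMapM (ν.prod (stiefelMeasure F m q)) := by
    refine Measure.map_congr ?_
    filter_upwards [Measure.quasiMeasurePreserving_fst.ae hae] with z hz
    exact (splitMapM_eq hz).symm
  -- The image of `Φ` has full measure, so the restriction is the whole measure and the splitting
  -- formula can be applied to every test function.
  rw [Measure.restrict_eq_self_of_ae_mem (ae_mem_stiefel_inter_upperBall hq hm), hmap,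
    ofReal_inv_integral_jdet_defect hq hm]
  refine Measure.ext_of_lintegral _ fun f hf => ?_
  have hfs : Measurable fun z : Matrix (Fin k) (Fin q) F × Matrix (Fin m) (Fin q) F =>
      f (splitMapM z) := hf.comp measurable_splitMapM
  rw [lintegral_stiefel_split hq hm hf, lintegral_smul_measure, smul_eq_mul,
    lintegral_map hf measurable_splitMapM, lintegral_prod _ hfs.aemeasurable, hν,
    lintegral_withDensity_eq_lintegral_mul _ hw hfs.lintegral_prod_right']
  rfl

end Measure

end SplitStiefel

end

open SplitStiefel in
theorem proposition3p1 (F : Type*) [NormedDivisionRing F] [StarRing F] [InnerProductSpace ℝ F]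
    [IsRealComplexOrQuaternion F] (k m q : ℕ) (hq : 1 ≤ q) (hqm : q ≤ m)
    (S : Set (Matrix (Fin (k + m)) (Fin q) F)) (hS : S = splitMap '' (matBall F k q ×ˢ stiefel F m q))
    (η c : ℝ) (hη : η = scalarDim F / 2 * m - hermDim F q / q)
    (hc : c = (∫ v in matBall F k q, jdet (1 - vᴴ * v) ^ η)⁻¹) :
    -- `Φ` is a diffeomorphism onto `S`, an open and dense subset of `Σ_{k+m,q}`
    (IsDiffeoOnto splitMap (matBall F k q ×ˢ stiefel F m q) S ∧
      S ⊆ stiefel F (k + m) q ∧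
      (∃ U, IsOpen U ∧ S = stiefel F (k + m) q ∩ U) ∧
      stiefel F (k + m) q ⊆ closure S) ∧
    -- the volume measures are normalized and invariant under the unitary group
    (∀ p : ℕ, q ≤ p → IsProbabilityMeasure (stiefelMeasure F p q) ∧
      ∀ u ∈ unitary (Matrix (Fin p) (Fin p) F),
        (stiefelMeasure F p q).map (fun x => u * x) = stiefelMeasure F p q) ∧
    -- `dσ = c Δ(I - v* v)^η dσ' dv` on `S`
    (stiefelMeasure F (k + m) q).restrict S =
      ENNReal.ofReal c • Measure.map splitMap
        (((volume.restrict (matBall F k q)).withDensity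
          (fun v => ENNReal.ofReal (jdet (1 - vᴴ * v) ^ η))).prod (stiefelMeasure F m q)) ∧
    -- the constant
    IntegrableOn (fun v => jdet (1 - vᴴ * v) ^ η) (matBall F k q) ∧
    c = Real.pi ^ (-(scalarDim F * k * q / 2)) *
      (coneGamma F q (scalarDim F * ((k + m : ℕ) : ℝ) / 2) /
        coneGamma F q (scalarDim F * m / 2)) := by
  have hS' : S = stiefel F (k + m) q ∩ upperBall F k m q := hS.trans splitMap_image
  subst hη hc hS'
  refine ⟨⟨isDiffeoOnto_splitMap, Set.inter_subset_left, ⟨_, isOpen_upperBall, rfl⟩,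
    stiefel_subset_closure hq hqm⟩, fun p hp => ⟨isProbabilityMeasure_stiefelMeasure hp, fun u hu =>
      map_mul_left_stiefelMeasure (Unitary.mem_iff.1 hu).1⟩, stiefelMeasure_restrict_eq_map hq hqm,
    integrableOn_jdet_defect hq hqm, inv_integral_jdet_defect hq hqm⟩
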